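/- **Setting.** Let $m_1,m_2\ge 1$ be integers, let $V=\mathbb C^4$ with its standard bilinear form $(\cdot,\cdot)$ and orthonormal basis $x_1,\dots,x_4$, and let $R$ be the root system consisting of the unit vectors $$\alpha_p=\bigl(\sin\tfrac{p\pi}{m_1},-\cos\tfrac{p\pi}{m_1},0,0\bigr)\ (1\le p\le 2m_1),\qquad \beta_q=\bigl(0,0,\sin\tfrac{q\pi}{m_2},-\cos\tfrac{q\pi}{m_2}\bigr)\ (1\le q\le 2m_2),$$ with positive roots $R_+=\{\alpha_p\}_{p\le m_1}\cup\{\beta_q\}_{q\le m_2}$. Let $W\subset O(4)$ be the group generated by the reflections $s_\alpha$, $\alpha\in R$ (a product of the dihedral groups of orders $2m_1$ and $2m_2$), and let $\kappa\colon R\to\mathbb C$ be $W$-invariant. Write $\kappa_1=\kappa(\alpha_1)$, $\kappa_2=\kappa(\alpha_2)$, $\kappa_3=\kappa(\beta_1)$, $\kappa_4=\kappa(\beta_2)$. The rational Cherednik algebra $H_\kappa$ is the quotient of $T(V\oplus V^*)\rtimes\mathbb CW$ by the relations $[x,y]=0=[\xi,\eta]$ and $$[\xi,x]=\xi(x)+\sum_{\alpha\in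 R_+}2\kappa(\alpha)\,\xi(\alpha)\,(x,\alpha)\,s_\alpha \qquad (x,y\in V,\ \xi,\eta\in V^*).$$ Let $\mathcal C$ be the complex Clifford algebra of $V$, with canonical map $\gamma\colon V\to\mathcal C$, $\gamma(x)\gamma(y)+\gamma(y)\gamma(x)=2(x,y)$, extended to $\bigwedge V\to\mathcal C$ by antisymmetrisation, and put $e_j=\gamma(x_j)$. The algebra $H_\kappa\otimes\mathcal C$ is $\mathbb Z/2$-graded through $\mathcal C$; let $[\![\cdot,\cdot]\!]$ be its graded commutator. With $\xi_j=(x_j,\cdot)$ put $$\Delta=\sum_j\xi_j^2\otimes1,\quad D=\sum_j\xi_j\otimes e_j,\quad E=\tfrac12\sum_j(x_j\xi_j+\xi_jx_j)\otimes1,\quad \underline x=\sum_jx_j\otimes e_j,\quad |x|^2=\sum_jx_j^2\otimes1 .$$ These five elements span a copy of $\mathfrak{osp}(1|2)$. The Dunkl total angular momentum algebra is its graded centraliser $$\mathfrak O_\kappa=\{a\in H_\kappa\otimes\mathcal C:\ [\![a,g]\!]=0\ \text{for all } g\in\mathfrak{osp}(1|2)\}.$$ Let $P(a)=a-\tfrac12[\![D,[\![\underline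 x,a]\!]]\!]$ and, for $\omega\in\bigwedge V$, $O(\omega)=-\tfrac12P(1\otimes\gamma(\omega))$. For $\omega\in\bigwedge V$ this lies in $\mathfrak O_\kappa$, as do the elements $\tilde s_\alpha=s_\alpha\otimes\gamma(\alpha)$ for $\alpha\in R$. For $a\in\{1,2\}$ put $z_a^{\pm}=x_{2a-1}\pm i\,x_{2a}$, $z_a=z_a^+$, $\bar z_a=z_a^-$, and, with $\{u,v\}=uv+vu$ and $\delta,\varepsilon\in\{+,-\}$, $$H_a=\tfrac12O(z_a\wedge\bar z_a),\qquad Z=O(x_1\wedge x_2\wedge x_3\wedge x_4),\qquad \tilde r_1=-\tilde s_{\alpha_{m_1}}\tilde s_{\alpha_1},\qquad \tilde r_2=-\tilde s_{\beta_{m_2}}\tilde s_{\beta_1},$$ $$L_{12}^{\delta\varepsilon}=\{H_1,\{H_2,O(z_1^\delta\wedge z_2^\varepsilon)\}\},\qquad L_2^{\varepsilon}=\{H_2,O(z_2^\varepsilon\wedge z_1\wedge\bar z_1)\}.$$ **Small parameters.** For $a\in\{1,2\}$ and $j\in\mathbb Z$ let $$Q_a(j)=\begin{cases} m_a\kappa_{2a-1},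 & m_a\text{ odd},\ j\equiv0 \pmod{2m_a},\\ \tfrac{m_a}2(\kappa_{2a}+\kappa_{2a-1}), & m_a\text{ even},\ j\equiv0 \pmod{2m_a},\\ \tfrac{m_a}2(\kappa_{2a}-\kappa_{2a-1}), & m_a\text{ even},\ j\equiv m_a \pmod{2m_a},\\ 0,&\text{otherwise.}\end{cases}$$ The function $\kappa$ is *small* if $|Q_a(j)|<\tfrac12$ for all $j\in\mathbb Z$ and $a\in\{1,2\}$. **Weights.** Let $\zeta_a=e^{i\pi/m_a}$, and let $M$ be an $\mathfrak O_\kappa$-module. A *weight* of $M$ is a tuple $\mu=(\lambda_1,\lambda_2,\Lambda,\zeta_1^{\ell_1},\zeta_2^{\ell_2})$, with $\lambda_1,\lambda_2,\Lambda\in\mathbb C$ and odd integers $\ell_a\in\{1,\dots,2m_a-1\}$, such that the weight space $M_\mu$ of common eigenvectors of $H_1,H_2,Z,\tilde r_1,\tilde r_2$ with these respective eigenvalues is nonzero. For an eigenvalue $\lambda$ of $H_a$ let $\lambda^0=\lfloor\operatorname{Re}\lambda\rfloor+\tfrac12$ (for small $\kappa$, its value at $\kappa=0$). A weight $\mu$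 is *higher than* a weight $\mu'$ if $(\lambda_1^0,\lambda_2^0,\operatorname{Re}\Lambda,-\ell_1,-\ell_2)\ge(\lambda_1'^{\,0},\lambda_2'^{\,0},\operatorname{Re}\Lambda',-\ell_1',-\ell_2')$ in the lexicographic order, and $\mu$ is a *highest weight* of $M$ if it is a weight of $M$ that is higher than every weight of $M$. **Triangle-representations.** A representation $M$ of $\mathfrak O_\kappa$ is a *triangle-representation* if it has a highest weight $\mu=(\lambda_1,\lambda_2,\Lambda,\zeta_1^{\ell_1},\zeta_2^{\ell_2})$ such that, for some integer $N\ge0$ and some choice of the two signs, $$\lambda_1=N+\tfrac12\pm Q_1(\ell_1-2N-1),\qquad \lambda_2=\tfrac12\pm Q_2(\ell_2-1),\qquad \Lambda=-\tfrac12-\lambda_1-\lambda_2, \tag{1}$$ and such that $$L_2^{+}v=0,\qquad L_2^{-}v=0,\qquad L_{12}^{--}v=0\qquad\text{for all } v\in M_\mu. \tag{2}$$ **Theorem.** Suppose that $\kappa$ is small. Then every finite-dimensional irreducible $\mathfrak O_\kappa$-representation $M$ is a triangle-representation. Moreover, every highest weight of $M$ is of the form (1), for some $N\ge0$ and some choice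 of signs, and satisfies (2). -/

import Mathlib

open scoped TensorProduct

noncomputable section

namespace DunklTAMA

/-! ### The space `V = ℂ⁴`, its roots, and the reflection group -/

/-- The complexified Euclidean space `V = ℂ⁴`. The index `(a, j)` (with `a, j ∈ {0, 1}`) stands for
the `2 a + j + 1`-st standard basis vector, so that `V = V₁ ⊕ V₂` with `V₁` the part `a = 0` and
`V₂` the part `a = 1`. -/
abbrev V : Type := Fin 2 × Fin 2 → ℂ

/-- The complex bilinear extension `(x, y) = ∑ xᵢ yᵢ` of the standard inner product. -/
abbrev form : V →ₗ[ℂ] V →ₗ[ℂ] ℂ := dotProductBilin ℂ ℂ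

/-- The orthonormal basis vector `x_{2a+j+1}`. -/
def basisVec (i : Fin 2 × Fin 2) : V := Pi.single i 1

/-- The isotropic vector `z_a^δ = x_{2a+1} + δ i x_{2a+2}` (with `a ∈ {0, 1}`). -/
def zvec (a : Fin 2) (δ : ℤˣ) : V :=
  basisVec (a, 0) + (((δ : ℤ) : ℂ) * Complex.I) • basisVec (a, 1)

/-- The roots: `root m 0 p` is `α_p = (sin (pπ/m₁), -cos (pπ/m₁), 0, 0)` and `root m 1 q` is
`β_q = (0, 0, sin (qπ/m₂), -cos (qπ/m₂))`. They are unit vectors. -/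
def root (m : Fin 2 → ℕ) (a : Fin 2) (p : ℕ) : V :=
  ((Real.sin (p * Real.pi / m a) : ℝ) : ℂ) • basisVec (a, 0)
    - ((Real.cos (p * Real.pi / m a) : ℝ) : ℂ) • basisVec (a, 1)

/-- The root system `R` of type `I₂(m₁) ⊕ I₂(m₂)`. As `root m a p` is `2 * m a`-periodic in `p`,
letting `p` run through all natural numbers gives the same set as `1 ≤ p ≤ 2 * m a`. -/
def rootSet (m : Fin 2 → ℕ) : Set V :=
  {v | ∃ a p, v = root m a p}

theorem form_basisVec (i j : Fin 2 × Fin 2) :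
    form (basisVec i) (basisVec j) = if i = j then 1 else 0 := by
  simp [basisVec, dotProductBilin, Pi.single_apply]

theorem form_root_root (m : Fin 2 → ℕ) (a : Fin 2) (p : ℕ) :
    form (root m a p) (root m a p) = 1 := by
  have h' : ((Real.sin (p * Real.pi / m a) : ℝ) : ℂ) ^ 2
      + ((Real.cos (p * Real.pi / m a) : ℝ) : ℂ) ^ 2 = 1 := by
    exact_mod_cast Real.sin_sq_add_cos_sq (p * Real.pi / m a)
  simp only [root, map_sub, map_smul, LinearMap.sub_apply, LinearMap.smul_apply, form_basisVec,
    smul_eq_mul, Prod.mk.injEq, true_and, if_true, zero_ne_one, one_ne_zero, if_false]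
  linear_combination h'

theorem two_form_root_root (m : Fin 2 → ℕ) (a : Fin 2) (p : ℕ) :
    ((2 : ℂ) • form (root m a p)) (root m a p) = 2 := by
  rw [LinearMap.smul_apply, form_root_root, smul_eq_mul, mul_one]

/-- The reflection `s_α (x) = x - 2 (x, α) / (α, α) α` in the unit root `α = root m a p`. -/
def refl (m : Fin 2 → ℕ) (a : Fin 2) (p : ℕ) : V ≃ₗ[ℂ] V :=
  Module.reflection (two_form_root_root m a p)

/-- The group `W = D_{2m₁} × D_{2m₂} ⊂ O(4)`, generated by the reflections in the roots. -/
def W (m : Fin 2 → ℕ) : Subgroup (V ≃ₗ[ℂ] V) :=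
  Subgroup.closure {s | ∃ a p, s = refl m a p}

/-- The reflection in the root `root m a p`, as an element of `W`. -/
def reflW (m : Fin 2 → ℕ) (a : Fin 2) (p : ℕ) : W m :=
  ⟨refl m a p, Subgroup.subset_closure ⟨a, p, rfl⟩⟩

/-- `κ` is `W`-invariant on the root system. (Only the values of `κ` on roots are ever used.) -/
def IsInvariant (m : Fin 2 → ℕ) (κ : V → ℂ) : Prop :=
  ∀ w ∈ W m, ∀ α ∈ rootSet m, κ (w α) = κ α

/-! ### The rational Cherednik algebra -/

/-- Generators of the rational Cherednik algebra: vectors, covectors and group elements. -/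
abbrev Gen (m : Fin 2 → ℕ) : Type := V ⊕ Module.Dual ℂ V ⊕ W m

/-- The generator attached to a vector. -/
def gVec (m : Fin 2 → ℕ) (x : V) : FreeAlgebra ℂ (Gen m) := FreeAlgebra.ι ℂ (Sum.inl x)

/-- The generator attached to a covector. -/
def gCov (m : Fin 2 → ℕ) (ξ : Module.Dual ℂ V) : FreeAlgebra ℂ (Gen m) :=
  FreeAlgebra.ι ℂ (Sum.inr (Sum.inl ξ))

/-- The generator attached to a group element. -/
def gGrp (m : Fin 2 → ℕ) (w : W m) : FreeAlgebra ℂ (Gen m) :=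
  FreeAlgebra.ι ℂ (Sum.inr (Sum.inr w))

/-- The defining relations of `H_κ`: the first eight families say that the free algebra is cut down
to the smash product `T(V ⊕ V*) ⋊ ℂW`, the last three are the relations imposed on it. -/
inductive Rel (m : Fin 2 → ℕ) (κ : V → ℂ) :
    FreeAlgebra ℂ (Gen m) → FreeAlgebra ℂ (Gen m) → Prop
  | vec_add (x y : V) : Rel m κ (gVec m (x + y)) (gVec m x + gVec m y)
  | vec_smul (c : ℂ) (x : V) : Rel m κ (gVec m (c • x)) (c • gVec m x)
  | cov_add (ξ η : Module.Dual ℂ V) :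
      Rel m κ (gCov m (ξ + η)) (gCov m ξ + gCov m η)
  | cov_smul (c : ℂ) (ξ : Module.Dual ℂ V) : Rel m κ (gCov m (c • ξ)) (c • gCov m ξ)
  | grp_one : Rel m κ (gGrp m 1) 1
  | grp_mul (g h : W m) : Rel m κ (gGrp m (g * h)) (gGrp m g * gGrp m h)
  | grp_vec (g : W m) (x : V) :
      Rel m κ (gGrp m g * gVec m x) (gVec m (g.1 x) * gGrp m g)
  | grp_cov (g : W m) (ξ : Module.Dual ℂ V) :
      Rel m κ (gGrp m g * gCov m ξ)
        (gCov m (ξ ∘ₗ (g.1.symm : V →ₗ[ℂ] V)) * gGrp m g)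
  | vec_comm (x y : V) : Rel m κ (gVec m x * gVec m y) (gVec m y * gVec m x)
  | cov_comm (ξ η : Module.Dual ℂ V) :
      Rel m κ (gCov m ξ * gCov m η) (gCov m η * gCov m ξ)
  | cov_vec (ξ : Module.Dual ℂ V) (x : V) :
      Rel m κ (gCov m ξ * gVec m x - gVec m x * gCov m ξ)
        (algebraMap ℂ _ (ξ x) + ∑ a : Fin 2, ∑ p ∈ Finset.Icc 1 (m a),
          (2 * κ (root m a p) * ξ (root m a p) * form x (root m a p))
            • gGrp m (reflW m a p))

/-- The rational Cherednik algebra `H_κ = H_κ(V, W)`. -/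
def Cherednik (m : Fin 2 → ℕ) (κ : V → ℂ) : Type := RingQuot (Rel m κ)

instance (m : Fin 2 → ℕ) (κ : V → ℂ) : Ring (Cherednik m κ) :=
  inferInstanceAs (Ring (RingQuot (Rel m κ)))

instance (m : Fin 2 → ℕ) (κ : V → ℂ) : Algebra ℂ (Cherednik m κ) :=
  inferInstanceAs (Algebra ℂ (RingQuot (Rel m κ)))

section Generators

variable (m : Fin 2 → ℕ) (κ : V → ℂ)

/-- The quotient map from the free algebra to `H_κ`. -/
def proj : FreeAlgebra ℂ (Gen m) →ₐ[ℂ] Cherednik m κ := RingQuot.mkAlgHom ℂ (Rel m κ)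

theorem proj_rel {a b : FreeAlgebra ℂ (Gen m)} (h : Rel m κ a b) : proj m κ a = proj m κ b :=
  RingQuot.mkAlgHom_rel ℂ h

/-- The image of a vector in `H_κ`. -/
def hx : V →ₗ[ℂ] Cherednik m κ where
  toFun x := proj m κ (gVec m x)
  map_add' x y := by rw [proj_rel m κ (.vec_add x y), map_add]
  map_smul' c x := by rw [proj_rel m κ (.vec_smul c x), map_smul]; rfl

/-- The image of a covector in `H_κ`. -/
def hxi : Module.Dual ℂ V →ₗ[ℂ] Cherednik m κ where
  toFun x := proj m κ (gCov m x)
  map_add' x y := by rw [proj_rel m κ (.cov_add x y), map_add]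
  map_smul' c x := by rw [proj_rel m κ (.cov_smul c x), map_smul]; rfl

/-- The image of a group element in `H_κ`. -/
def hw : W m →* Cherednik m κ where
  toFun g := proj m κ (gGrp m g)
  map_one' := by rw [proj_rel m κ .grp_one, map_one]
  map_mul' g h := by rw [proj_rel m κ (.grp_mul g h), map_mul]

theorem hw_hx (g : W m) (x : V) : hw m κ g * hx m κ x = hx m κ (g.1 x) * hw m κ g := by
  have h := proj_rel m κ (.grp_vec g x)
  simp only [map_mul] at h
  exact h

theorem hw_hxi (g : W m) (ξ : Module.Dual ℂ V) :
    hw m κ g * hxi m κ ξ = hxi m κ (ξ ∘ₗ (g.1.symm : V →ₗ[ℂ] V)) * hw m κ g := by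
  have h := proj_rel m κ (.grp_cov g ξ)
  simp only [map_mul] at h
  exact h

theorem hx_comm (x y : V) : hx m κ x * hx m κ y = hx m κ y * hx m κ x := by
  have h := proj_rel m κ (.vec_comm x y)
  simp only [map_mul] at h
  exact h

theorem hxi_comm (ξ η : Module.Dual ℂ V) :
    hxi m κ ξ * hxi m κ η = hxi m κ η * hxi m κ ξ := by
  have h := proj_rel m κ (.cov_comm ξ η)
  simp only [map_mul] at h
  exact h

theorem hxi_hx (ξ : Module.Dual ℂ V) (x : V) :
    hxi m κ ξ * hx m κ x - hx m κ x * hxi m κ ξ =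
      algebraMap ℂ _ (ξ x) + ∑ a : Fin 2, ∑ p ∈ Finset.Icc 1 (m a),
        (2 * κ (root m a p) * ξ (root m a p) * form x (root m a p)) • hw m κ (reflW m a p) := by
  have h := proj_rel m κ (.cov_vec ξ x)
  simp only [map_mul, map_sub, map_add, map_sum, map_smul, AlgHom.commutes] at h
  exact h

end Generators

/-! ### The Clifford algebra -/

/-- The quadratic form `x ↦ (x, x)`. -/
abbrev quadForm : QuadraticForm ℂ V := LinearMap.BilinMap.toQuadraticMap form

/-- The Clifford algebra `𝒞` of `V`; its generators satisfy `x y + y x = 2 (x, y)`. -/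
abbrev Cl : Type := CliffordAlgebra quadForm

/-- The canonical embedding `γ : V → 𝒞`. -/
abbrev gam : V →ₗ[ℂ] Cl := CliffordAlgebra.ι quadForm

/-- The value `γ(v₁ ∧ ⋯ ∧ v_p) = (1 / p!) ∑_g sgn(g) γ(v_{g(1)}) ⋯ γ(v_{g(p)})` of the quantization
map on a decomposable `p`-vector. -/
def quant {p : ℕ} (v : Fin p → V) : Cl :=
  ((p.factorial : ℂ)⁻¹) • ∑ g : Equiv.Perm (Fin p),
    ((Equiv.Perm.sign g : ℤ) : ℂ) • (List.ofFn fun i => gam (v (g i))).prod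

/-! ### The algebra `H_κ ⊗ 𝒞` and the total angular momentum algebra -/

/-- `H_κ ⊗ 𝒞`. -/
abbrev HC (m : Fin 2 → ℕ) (κ : V → ℂ) : Type := Cherednik m κ ⊗[ℂ] Cl

section TAMA

variable (m : Fin 2 → ℕ) (κ : V → ℂ)

/-- The grading automorphism of `H_κ ⊗ 𝒞`: `1` on the even part `H_κ ⊗ 𝒞₀`, `-1` on the odd part
`H_κ ⊗ 𝒞₁`. -/
def grading : HC m κ →ₐ[ℂ] HC m κ :=
  Algebra.TensorProduct.map (AlgHom.id ℂ _) CliffordAlgebra.involute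

/-- The even part of an element. -/
def evenPart (a : HC m κ) : HC m κ := (2⁻¹ : ℂ) • (a + grading m κ a)

/-- The odd part of an element. -/
def oddPart (a : HC m κ) : HC m κ := (2⁻¹ : ℂ) • (a - grading m κ a)

/-- The graded commutator `⟦a, b⟧`, the bilinear extension of `a b - (-1)^{|a||b|} b a`. Note that
`grading a` is `(-1)^{|a|} a` for homogeneous `a`. -/
def gradedComm (a b : HC m κ) : HC m κ :=
  a * b - evenPart m κ b * a - oddPart m κ b * grading m κ a

/-- The Dunkl Laplacian `Δ_κ = ∑ ξ_j² ⊗ 1`, where `ξ_j = B(x_j)`. -/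
def lap : HC m κ := ∑ i, (hxi m κ (form (basisVec i)) * hxi m κ (form (basisVec i))) ⊗ₜ 1

/-- The Euler element `E = ½ ∑ (x_j ξ_j + ξ_j x_j) ⊗ 1`. -/
def euler : HC m κ := (2⁻¹ : ℂ) • ∑ i,
  (hx m κ (basisVec i) * hxi m κ (form (basisVec i))
    + hxi m κ (form (basisVec i)) * hx m κ (basisVec i)) ⊗ₜ 1

/-- The element `|x|² = ∑ x_j² ⊗ 1`. -/
def normSq : HC m κ := ∑ i, (hx m κ (basisVec i) * hx m κ (basisVec i)) ⊗ₜ 1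

/-- The Dunkl–Dirac operator `∑ ξ_j ⊗ e_j`. -/
def dirac : HC m κ := ∑ i, hxi m κ (form (basisVec i)) ⊗ₜ gam (basisVec i)

/-- The vector variable `x̲ = ∑ x_j ⊗ e_j`. -/
def xvar : HC m κ := ∑ i, hx m κ (basisVec i) ⊗ₜ gam (basisVec i)

/-- The copy of `𝔬𝔰𝔭(1|2)` in `H_κ ⊗ 𝒞`. -/
def osp : Submodule ℂ (HC m κ) :=
  Submodule.span ℂ {lap m κ, dirac m κ, euler m κ, xvar m κ, normSq m κ}

/-- The operator `P = id - ½ ad(D) ad(x̲)`. -/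
def projP (a : HC m κ) : HC m κ :=
  a - (2⁻¹ : ℂ) • gradedComm m κ (dirac m κ) (gradedComm m κ (xvar m κ) a)

/-! #### The relations of `𝔬𝔰𝔭(1|2)` needed for the membership proofs below -/

theorem gam_mul_add (i j : Fin 2 × Fin 2) :
    gam (basisVec i) * gam (basisVec j) + gam (basisVec j) * gam (basisVec i)
      = algebraMap ℂ Cl (if i = j then 2 else 0) := by
  rw [CliffordAlgebra.ι_mul_ι_add_swap]
  congr 1
  simp only [QuadraticMap.polar, LinearMap.BilinMap.toQuadraticMap_apply, map_add,
    LinearMap.add_apply, form_basisVec]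
  by_cases h : i = j
  · subst h
    simp
    norm_num
  · simp [h, Ne.symm h]

theorem sum_symm (c : Fin 2 × Fin 2 → Fin 2 × Fin 2 → Cherednik m κ)
    (hc : ∀ i j, c i j = c j i) :
    ∑ i, ∑ j, c i j ⊗ₜ[ℂ] (gam (basisVec i) * gam (basisVec j)) = ∑ i, c i i ⊗ₜ[ℂ] (1 : Cl) := by
  have h1 : ∑ i, ∑ j, c i j ⊗ₜ[ℂ] (gam (basisVec i) * gam (basisVec j))
      = ∑ i, ∑ j, c i j ⊗ₜ[ℂ] (gam (basisVec j) * gam (basisVec i)) := by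
    rw [Finset.sum_comm]
    exact Finset.sum_congr rfl fun i _ => Finset.sum_congr rfl fun j _ => by rw [hc]
  have h2 : ∑ i, ∑ j, c i j ⊗ₜ[ℂ] (gam (basisVec i) * gam (basisVec j))
      + ∑ i, ∑ j, c i j ⊗ₜ[ℂ] (gam (basisVec i) * gam (basisVec j))
      = (2 : ℂ) • ∑ i, c i i ⊗ₜ[ℂ] (1 : Cl) := by
    nth_rewrite 2 [h1]
    simp only [← Finset.sum_add_distrib, ← TensorProduct.tmul_add, gam_mul_add, Finset.smul_sum]
    refine Finset.sum_congr rfl fun i _ => ?_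
    rw [Finset.sum_eq_single i]
    · rw [if_pos rfl, Algebra.algebraMap_eq_smul_one, TensorProduct.tmul_smul]
    · intro j _ hj
      rw [if_neg (Ne.symm hj), map_zero, TensorProduct.tmul_zero]
    · simp
  rw [← two_smul ℂ] at h2
  exact smul_right_injective _ (two_ne_zero : (2 : ℂ) ≠ 0) h2

theorem form_symm (x y : V) : form x y = form y x := by
  simp [dotProductBilin, dotProduct_comm]

theorem hxi_hx_symm (i j : Fin 2 × Fin 2) :
    hxi m κ (form (basisVec i)) * hx m κ (basisVec j)
        - hx m κ (basisVec j) * hxi m κ (form (basisVec i))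
      = hxi m κ (form (basisVec j)) * hx m κ (basisVec i)
        - hx m κ (basisVec i) * hxi m κ (form (basisVec j)) := by
  rw [hxi_hx, hxi_hx, form_symm (basisVec i) (basisVec j)]
  congr 1
  refine Finset.sum_congr rfl fun a _ => Finset.sum_congr rfl fun p _ => ?_
  congr 1
  ring

theorem dirac_mul_dirac : dirac m κ * dirac m κ = lap m κ := by
  simp only [dirac, lap, Finset.sum_mul_sum, Algebra.TensorProduct.tmul_mul_tmul]
  exact sum_symm m κ (fun i j => hxi m κ (form (basisVec i)) * hxi m κ (form (basisVec j)))
    fun i j => hxi_comm m κ _ _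

theorem xvar_mul_xvar : xvar m κ * xvar m κ = normSq m κ := by
  simp only [xvar, normSq, Finset.sum_mul_sum, Algebra.TensorProduct.tmul_mul_tmul]
  exact sum_symm m κ (fun i j => hx m κ (basisVec i) * hx m κ (basisVec j))
    fun i j => hx_comm m κ _ _

theorem dirac_xvar : dirac m κ * xvar m κ + xvar m κ * dirac m κ = (2 : ℂ) • euler m κ := by
  have h := sum_symm m κ (fun i j => hxi m κ (form (basisVec i)) * hx m κ (basisVec j)
        - hx m κ (basisVec j) * hxi m κ (form (basisVec i))) (hxi_hx_symm m κ)
  have h' : ∑ i, ∑ j, (hx m κ (basisVec j) * hxi m κ (form (basisVec i))) ⊗ₜ[ℂ]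
        (gam (basisVec i) * gam (basisVec j))
      + ∑ i, ∑ j, (hx m κ (basisVec j) * hxi m κ (form (basisVec i))) ⊗ₜ[ℂ]
        (gam (basisVec j) * gam (basisVec i))
      = (2 : ℂ) • ∑ i, (hx m κ (basisVec i) * hxi m κ (form (basisVec i))) ⊗ₜ[ℂ] (1 : Cl) := by
    simp only [← Finset.sum_add_distrib, ← TensorProduct.tmul_add, gam_mul_add, Finset.smul_sum]
    refine Finset.sum_congr rfl fun i _ => ?_
    rw [Finset.sum_eq_single i]
    · rw [if_pos rfl, Algebra.algebraMap_eq_smul_one, TensorProduct.tmul_smul]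
    · intro j _ hj
      rw [if_neg (Ne.symm hj), map_zero, TensorProduct.tmul_zero]
    · simp
  simp only [TensorProduct.sub_tmul, Finset.sum_sub_distrib] at h
  rw [Finset.sum_comm (f := fun i j => (hx m κ (basisVec j) * hxi m κ (form (basisVec i)))
    ⊗ₜ[ℂ] (gam (basisVec j) * gam (basisVec i)))] at h'
  simp only [dirac, xvar, euler, Finset.sum_mul_sum, Algebra.TensorProduct.tmul_mul_tmul,
    TensorProduct.add_tmul, Finset.sum_add_distrib, smul_smul]
  rw [two_smul] at h'
  rw [mul_inv_cancel₀ (two_ne_zero : (2 : ℂ) ≠ 0), one_smul]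
  rw [sub_eq_iff_eq_add.mp h, add_assoc, h']
  abel

theorem sum_basis (x : V) : x = ∑ i, (x i) • basisVec i := by
  ext j
  simp [basisVec, Pi.single_apply]

theorem form_basis (i : Fin 2 × Fin 2) (x : V) : form (basisVec i) x = x i := by
  simp [basisVec, dotProductBilin]

theorem refl_root (a : Fin 2) (p : ℕ) : refl m a p (root m a p) = - root m a p :=
  Module.reflection_apply_self _

theorem refl_symm (a : Fin 2) (p : ℕ) : (refl m a p).symm = refl m a p :=
  Module.reflection_symm _

theorem form_refl (a : Fin 2) (p : ℕ) (x y : V) :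
    form (refl m a p x) (refl m a p y) = form x y := by
  have h := form_root_root m a p
  simp only [refl, Module.reflection_apply, map_sub, map_smul, LinearMap.sub_apply,
    LinearMap.smul_apply, smul_eq_mul, h]
  rw [form_symm x (root m a p)]
  ring

theorem form_comp_refl (a : Fin 2) (p : ℕ) (x : V) :
    form x ∘ₗ ((refl m a p).symm : V →ₗ[ℂ] V) = form (refl m a p x) := by
  refine LinearMap.ext fun y => ?_
  rw [LinearMap.comp_apply, ← form_refl m a p]
  simp

theorem hw_hxi_root (a : Fin 2) (p : ℕ) :
    hw m κ (reflW m a p) * hxi m κ (form (root m a p))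
      = - (hxi m κ (form (root m a p)) * hw m κ (reflW m a p)) := by
  rw [hw_hxi]
  change hxi m κ (form (root m a p) ∘ₗ ((refl m a p).symm : V →ₗ[ℂ] V)) * _ = _
  rw [form_comp_refl, refl_root, map_neg, map_neg, neg_mul]

theorem hw_hx_root (a : Fin 2) (p : ℕ) :
    hw m κ (reflW m a p) * hx m κ (root m a p)
      = - (hx m κ (root m a p) * hw m κ (reflW m a p)) := by
  rw [hw_hx]
  change hx m κ (refl m a p (root m a p)) * _ = _
  rw [refl_root, map_neg, neg_mul]

theorem sum_hxi_root (a : Fin 2) (p : ℕ) :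
    ∑ i, (root m a p i) • hxi m κ (form (basisVec i)) = hxi m κ (form (root m a p)) := by
  conv_rhs => rw [sum_basis (root m a p)]
  simp only [map_sum, map_smul]

theorem sum_hx_root (a : Fin 2) (p : ℕ) :
    ∑ i, (root m a p i) • hx m κ (basisVec i) = hx m κ (root m a p) := by
  conv_rhs => rw [sum_basis (root m a p)]
  simp only [map_sum, map_smul]

theorem sum_sq_hx (j : Fin 2 × Fin 2) :
    (∑ i, hxi m κ (form (basisVec i)) * hxi m κ (form (basisVec i))) * hx m κ (basisVec j)
      - hx m κ (basisVec j) * (∑ i, hxi m κ (form (basisVec i)) * hxi m κ (form (basisVec i)))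
      = (2 : ℂ) • hxi m κ (form (basisVec j)) := by
  have key : ∀ i, hxi m κ (form (basisVec i)) * hxi m κ (form (basisVec i)) * hx m κ (basisVec j)
      - hx m κ (basisVec j) * (hxi m κ (form (basisVec i)) * hxi m κ (form (basisVec i)))
      = (2 * if i = j then (1 : ℂ) else 0) • hxi m κ (form (basisVec i))
        + ∑ a : Fin 2, ∑ p ∈ Finset.Icc 1 (m a), (2 * κ (root m a p) * form (basisVec j) (root m a p))
          • ((root m a p i • hxi m κ (form (basisVec i))) * hw m κ (reflW m a p)
            + hw m κ (reflW m a p) * (root m a p i • hxi m κ (form (basisVec i)))) := by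
    intro i
    have h := hxi_hx m κ (form (basisVec i)) (basisVec j)
    rw [form_basisVec] at h
    have e : ∀ u v w : Cherednik m κ, u * v - v * u = w → u * u * v - v * (u * u)
        = u * w + w * u := by
      rintro u v w rfl
      noncomm_ring
    rw [e _ _ _ h]
    simp only [mul_add, add_mul, Finset.mul_sum, Finset.sum_mul, Algebra.algebraMap_eq_smul_one,
      mul_smul_comm, smul_mul_assoc, mul_one, one_mul, form_basis, smul_add, smul_smul,
      Finset.sum_add_distrib, two_mul, add_smul]
    have r : ∀ (a : Fin 2) (p : ℕ), κ (root m a p) * root m a p i * root m a p j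
        = κ (root m a p) * root m a p j * root m a p i := fun a p => by ring
    simp only [r]
    abel
  rw [Finset.sum_mul, Finset.mul_sum, ← Finset.sum_sub_distrib, Finset.sum_congr rfl fun i _ => key i,
    Finset.sum_add_distrib, Finset.sum_comm]
  have z : ∑ a : Fin 2, ∑ i, ∑ p ∈ Finset.Icc 1 (m a),
      (2 * κ (root m a p) * form (basisVec j) (root m a p))
          • ((root m a p i • hxi m κ (form (basisVec i))) * hw m κ (reflW m a p)
            + hw m κ (reflW m a p) * (root m a p i • hxi m κ (form (basisVec i)))) = 0 := by
    refine Finset.sum_eq_zero fun a _ => ?_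
    rw [Finset.sum_comm]
    refine Finset.sum_eq_zero fun p _ => ?_
    rw [← Finset.smul_sum, Finset.sum_add_distrib, ← Finset.sum_mul, ← Finset.mul_sum,
      sum_hxi_root, hw_hxi_root, add_neg_cancel, smul_zero]
  rw [z, add_zero]
  simp

theorem sum_sq_hxi (j : Fin 2 × Fin 2) :
    (∑ i, hx m κ (basisVec i) * hx m κ (basisVec i)) * hxi m κ (form (basisVec j))
      - hxi m κ (form (basisVec j)) * (∑ i, hx m κ (basisVec i) * hx m κ (basisVec i))
      = (-2 : ℂ) • hx m κ (basisVec j) := by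
  have key : ∀ i, hx m κ (basisVec i) * hx m κ (basisVec i) * hxi m κ (form (basisVec j))
      - hxi m κ (form (basisVec j)) * (hx m κ (basisVec i) * hx m κ (basisVec i))
      = -((2 * if j = i then (1 : ℂ) else 0) • hx m κ (basisVec i)
        + ∑ a : Fin 2, ∑ p ∈ Finset.Icc 1 (m a), (2 * κ (root m a p) * form (basisVec j) (root m a p))
          • ((root m a p i • hx m κ (basisVec i)) * hw m κ (reflW m a p)
            + hw m κ (reflW m a p) * (root m a p i • hx m κ (basisVec i)))) := by
    intro i
    have h := hxi_hx m κ (form (basisVec j)) (basisVec i)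
    rw [form_basisVec] at h
    have e : ∀ u v w : Cherednik m κ, v * u - u * v = w → u * u * v - v * (u * u)
        = -(u * w + w * u) := by
      rintro u v w rfl
      noncomm_ring
    rw [e _ _ _ h]
    simp only [mul_add, add_mul, Finset.mul_sum, Finset.sum_mul, Algebra.algebraMap_eq_smul_one,
      mul_smul_comm, smul_mul_assoc, mul_one, one_mul, form_basis, smul_add, smul_smul,
      Finset.sum_add_distrib, two_mul, add_smul]
    abel
  rw [Finset.sum_mul, Finset.mul_sum, ← Finset.sum_sub_distrib, Finset.sum_congr rfl fun i _ => key i,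
    Finset.sum_neg_distrib, Finset.sum_add_distrib, Finset.sum_comm]
  have z : ∑ a : Fin 2, ∑ i, ∑ p ∈ Finset.Icc 1 (m a),
      (2 * κ (root m a p) * form (basisVec j) (root m a p))
          • ((root m a p i • hx m κ (basisVec i)) * hw m κ (reflW m a p)
            + hw m κ (reflW m a p) * (root m a p i • hx m κ (basisVec i))) = 0 := by
    refine Finset.sum_eq_zero fun a _ => ?_
    rw [Finset.sum_comm]
    refine Finset.sum_eq_zero fun p _ => ?_
    rw [← Finset.smul_sum, Finset.sum_add_distrib, ← Finset.sum_mul, ← Finset.mul_sum,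
      sum_hx_root, hw_hx_root, add_neg_cancel, smul_zero]
  rw [z, add_zero]
  simp

theorem lap_xvar : lap m κ * xvar m κ - xvar m κ * lap m κ = (2 : ℂ) • dirac m κ := by
  simp only [lap, xvar, dirac, ← TensorProduct.sum_tmul, Finset.mul_sum, Finset.sum_mul (R := HC m κ),
    Algebra.TensorProduct.tmul_mul_tmul, one_mul, mul_one, ← Finset.sum_sub_distrib,
    ← TensorProduct.sub_tmul, Finset.smul_sum]
  refine Finset.sum_congr rfl fun j _ => ?_
  rw [← Finset.mul_sum, sum_sq_hx, TensorProduct.smul_tmul']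

theorem normSq_dirac :
    normSq m κ * dirac m κ - dirac m κ * normSq m κ = (-2 : ℂ) • xvar m κ := by
  simp only [normSq, xvar, dirac, ← TensorProduct.sum_tmul, Finset.mul_sum,
    Finset.sum_mul (R := HC m κ),
    Algebra.TensorProduct.tmul_mul_tmul, one_mul, mul_one, ← Finset.sum_sub_distrib,
    ← TensorProduct.sub_tmul, Finset.smul_sum]
  refine Finset.sum_congr rfl fun j _ => ?_
  rw [← Finset.mul_sum, sum_sq_hxi, TensorProduct.smul_tmul']

theorem grading_tmul (h : Cherednik m κ) (c : Cl) :
    grading m κ (h ⊗ₜ c) = h ⊗ₜ CliffordAlgebra.involute c := by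
  simp [grading]

theorem grading_dirac : grading m κ (dirac m κ) = - dirac m κ := by
  simp [dirac, grading_tmul, TensorProduct.tmul_neg]

theorem grading_xvar : grading m κ (xvar m κ) = - xvar m κ := by
  simp [xvar, grading_tmul, TensorProduct.tmul_neg]

theorem grading_grading (a : HC m κ) : grading m κ (grading m κ a) = a := by
  refine TensorProduct.induction_on a (by simp) (fun x y => by simp [grading_tmul]) ?_
  intro x y hx hy
  rw [map_add, map_add, hx, hy]

theorem gradedComm_even {a b : HC m κ} (hb : grading m κ b = b) :
    gradedComm m κ a b = a * b - b * a := by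
  simp only [gradedComm, evenPart, oddPart, hb, sub_self, smul_zero, zero_mul, sub_zero, ← two_smul ℂ b,
    smul_smul]
  norm_num

theorem gradedComm_odd {a b : HC m κ} (hb : grading m κ b = - b) :
    gradedComm m κ a b = a * b - b * grading m κ a := by
  simp only [gradedComm, evenPart, oddPart, hb, add_neg_cancel, smul_zero, zero_mul, sub_zero,
    sub_neg_eq_add, ← two_smul ℂ b, smul_smul]
  norm_num

theorem gradedComm_odd_left {a b : HC m κ} (ha : grading m κ a = - a) :
    gradedComm m κ a b = a * b - grading m κ b * a := by
  have h : evenPart m κ b - oddPart m κ b = grading m κ b := by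
    simp only [evenPart, oddPart, ← smul_sub, add_sub_sub_cancel, ← two_smul ℂ (grading m κ b),
      smul_smul]
    norm_num
  rw [← h, gradedComm, ha]
  noncomm_ring

theorem grading_lap : grading m κ (lap m κ) = lap m κ := by
  rw [← dirac_mul_dirac, map_mul, grading_dirac, neg_mul_neg]

theorem grading_normSq : grading m κ (normSq m κ) = normSq m κ := by
  rw [← xvar_mul_xvar, map_mul, grading_xvar, neg_mul_neg]

theorem grading_euler : grading m κ (euler m κ) = euler m κ := by
  have h := congrArg (grading m κ) (dirac_xvar m κ)
  rw [map_add, map_mul, map_mul, grading_dirac, grading_xvar, neg_mul_neg, neg_mul_neg, dirac_xvar,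
    map_smul] at h
  exact (smul_right_injective _ (two_ne_zero : (2 : ℂ) ≠ 0) h).symm

/-- For fixed `a`, the graded commutator `⟦a, b⟧` is linear in `b`. -/
def gradedCommLin (a : HC m κ) : HC m κ →ₗ[ℂ] HC m κ where
  toFun b := gradedComm m κ a b
  map_add' b c := by
    simp only [gradedComm, evenPart, oddPart, map_add, mul_add, smul_add, smul_sub, add_mul, sub_mul]
    abel
  map_smul' t b := by
    simp only [gradedComm, evenPart, oddPart, map_smul, mul_smul_comm, smul_mul_assoc, smul_add,
      smul_sub, add_mul, sub_mul, RingHom.id_apply, smul_comm t]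

/-- An element supercommutes with all of `𝔬𝔰𝔭(1|2)` as soon as it does so with the two odd
generators. -/
theorem supercomm_iff (a : HC m κ) :
    (∀ g ∈ osp m κ, gradedComm m κ a g = 0) ↔
      a * dirac m κ = dirac m κ * grading m κ a ∧ a * xvar m κ = xvar m κ * grading m κ a := by
  constructor
  · intro h
    have h1 := h _ (Submodule.subset_span (show dirac m κ ∈ _ by simp))
    have h2 := h _ (Submodule.subset_span (show xvar m κ ∈ _ by simp))
    rw [gradedComm_odd m κ (grading_dirac m κ)] at h1
    rw [gradedComm_odd m κ (grading_xvar m κ)] at h2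
    exact ⟨sub_eq_zero.mp h1, sub_eq_zero.mp h2⟩
  · rintro ⟨h1, h2⟩
    have h1' := congrArg (grading m κ) h1
    have h2' := congrArg (grading m κ) h2
    rw [map_mul, map_mul, grading_grading, grading_dirac, mul_neg, neg_mul, neg_inj] at h1'
    rw [map_mul, map_mul, grading_grading, grading_xvar, mul_neg, neg_mul, neg_inj] at h2'
    have key : osp m κ ≤ LinearMap.ker (gradedCommLin m κ a) := by
      refine Submodule.span_le.mpr ?_
      rintro g (rfl | rfl | rfl | rfl | rfl)
      · change gradedComm m κ a _ = 0
        rw [gradedComm_even m κ (grading_lap m κ), ← dirac_mul_dirac, ← mul_assoc, h1, mul_assoc, h1',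
          mul_assoc, sub_self]
      · change gradedComm m κ a _ = 0
        rw [gradedComm_odd m κ (grading_dirac m κ), h1, sub_self]
      · change gradedComm m κ a _ = 0
        rw [gradedComm_even m κ (grading_euler m κ)]
        refine smul_right_injective _ (two_ne_zero : (2 : ℂ) ≠ 0) ?_
        change (2 : ℂ) • _ = (2 : ℂ) • _
        rw [smul_sub, ← mul_smul_comm, ← smul_mul_assoc, ← dirac_xvar, mul_add, add_mul,
          ← mul_assoc, ← mul_assoc, h1, h2, mul_assoc, mul_assoc, h1', h2', mul_assoc, mul_assoc,
          sub_self, smul_zero]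
      · change gradedComm m κ a _ = 0
        rw [gradedComm_odd m κ (grading_xvar m κ), h2, sub_self]
      · change gradedComm m κ a _ = 0
        rw [gradedComm_even m κ (grading_normSq m κ), ← xvar_mul_xvar, ← mul_assoc, h2, mul_assoc,
          h2', mul_assoc, sub_self]
    intro g hg
    exact key hg

/-- The Dunkl total angular momentum algebra `𝔒_κ`: the graded centraliser of `𝔬𝔰𝔭(1|2)` in
`H_κ ⊗ 𝒞`. -/
def TAMA : Subalgebra ℂ (HC m κ) where
  carrier := {a | ∀ g ∈ osp m κ, gradedComm m κ a g = 0}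
  mul_mem' {a b} ha hb := by
    have ha' := (supercomm_iff m κ a).mp ha
    have hb' := (supercomm_iff m κ b).mp hb
    refine (supercomm_iff m κ _).mpr ⟨?_, ?_⟩
    · rw [mul_assoc, hb'.1, ← mul_assoc, ha'.1, mul_assoc, map_mul]
    · rw [mul_assoc, hb'.2, ← mul_assoc, ha'.2, mul_assoc, map_mul]
  add_mem' {a b} ha hb := by
    have ha' := (supercomm_iff m κ a).mp ha
    have hb' := (supercomm_iff m κ b).mp hb
    refine (supercomm_iff m κ _).mpr ⟨?_, ?_⟩
    · rw [add_mul, ha'.1, hb'.1, map_add, mul_add]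
    · rw [add_mul, ha'.2, hb'.2, map_add, mul_add]
  algebraMap_mem' r := by
    refine (supercomm_iff m κ _).mpr ⟨?_, ?_⟩
    · rw [AlgHom.commutes, Algebra.commutes]
    · rw [AlgHom.commutes, Algebra.commutes]

theorem mem_TAMA {a : HC m κ} : a ∈ TAMA m κ ↔
    a * dirac m κ = dirac m κ * grading m κ a ∧ a * xvar m κ = xvar m κ * grading m κ a :=
  supercomm_iff m κ a

theorem projP_eq (a : HC m κ) : projP m κ a = a - (2⁻¹ : ℂ) •
    (dirac m κ * xvar m κ * a - dirac m κ * grading m κ a * xvar m κ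
      + xvar m κ * grading m κ a * dirac m κ - a * xvar m κ * dirac m κ) := by
  rw [projP, gradedComm_odd_left m κ (grading_dirac m κ), gradedComm_odd_left m κ (grading_xvar m κ),
    map_sub, map_mul, map_mul, grading_grading, grading_xvar]
  congr 2
  noncomm_ring

theorem supercomm_aux {A : Type*} [Ring A] [Algebra ℂ A] {D X c c' : A}
    (hD : c * (D * D) = D * D * c) (hD' : c' * (D * D) = D * D * c')
    (hX : c * (X * X) = X * X * c) (hX' : c' * (X * X) = X * X * c')
    (hE : c * (D * X + X * D) = (D * X + X * D) * c)
    (hE' : c' * (D * X + X * D) = (D * X + X * D) * c')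
    (DX : D * D * X - X * (D * D) = (2 : ℂ) • D) (XD : X * X * D - D * (X * X) = (-2 : ℂ) • X) :
    (c - (2⁻¹ : ℂ) • (D * X * c - D * c' * X + X * c' * D - c * X * D)) * D
      = D * (c' - (2⁻¹ : ℂ) • (D * X * c' - D * c * X + X * c * D - c' * X * D)) ∧
    (c - (2⁻¹ : ℂ) • (D * X * c - D * c' * X + X * c' * D - c * X * D)) * X
      = X * (c' - (2⁻¹ : ℂ) • (D * X * c' - D * c * X + X * c * D - c' * X * D)) := by
  have DX' : D * D * X - X * (D * D) = D + D := by rw [DX, two_smul]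
  have XD' : X * X * D - D * (X * X) = -(X + X) := by rw [XD, neg_smul, two_smul]
  have h1 : c * D + c * D - (D * X * c - D * c' * X + X * c' * D - c * X * D) * D
      = D * c' + D * c' - D * (D * X * c' - D * c * X + X * c * D - c' * X * D) := by
    linear_combination (norm := noncomm_ring) hD * X - X * hD' + DX' * c' - c * DX'
  have h2 : c * X + c * X - (D * X * c - D * c' * X + X * c' * D - c * X * D) * X
      = X * c' + X * c' - X * (D * X * c' - D * c * X + X * c * D - c' * X * D) := by
    linear_combination (norm := noncomm_ring)
      hE * X - X * hE' + D * hX' - hX * D + c * XD' - XD' * c'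
  have half : ∀ u : A, u = (2⁻¹ : ℂ) • (u + u) := fun u => by
    rw [← two_smul ℂ u, smul_smul, inv_mul_cancel₀ (two_ne_zero : (2 : ℂ) ≠ 0), one_smul]
  constructor
  · rw [sub_mul, mul_sub, smul_mul_assoc, mul_smul_comm]
    have h := congrArg (fun u => (2⁻¹ : ℂ) • u) h1
    simp only [smul_sub (2⁻¹ : ℂ) (_ + _), ← half] at h
    exact h
  · rw [sub_mul, mul_sub, smul_mul_assoc, mul_smul_comm]
    have h := congrArg (fun u => (2⁻¹ : ℂ) • u) h2
    simp only [smul_sub (2⁻¹ : ℂ) (_ + _), ← half] at h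
    exact h

/-- `P` sends elements that commute with the even part of `𝔬𝔰𝔭(1|2)` into `𝔒_κ`. -/
theorem projP_mem {a : HC m κ} (h1 : a * lap m κ = lap m κ * a) (h2 : a * normSq m κ = normSq m κ * a)
    (h3 : a * euler m κ = euler m κ * a) : projP m κ a ∈ TAMA m κ := by
  have g1 := congrArg (grading m κ) h1
  have g2 := congrArg (grading m κ) h2
  have g3 := congrArg (grading m κ) h3
  rw [map_mul, map_mul, grading_lap] at g1
  rw [map_mul, map_mul, grading_normSq] at g2
  rw [map_mul, map_mul, grading_euler] at g3
  have e : ∀ u : HC m κ, u * euler m κ = euler m κ * u →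
      u * (dirac m κ * xvar m κ + xvar m κ * dirac m κ)
        = (dirac m κ * xvar m κ + xvar m κ * dirac m κ) * u := fun u hu => by
    rw [dirac_xvar, mul_smul_comm, smul_mul_assoc, hu]
  have DX := lap_xvar m κ
  have XD := normSq_dirac m κ
  rw [← dirac_mul_dirac] at h1 g1 DX
  rw [← xvar_mul_xvar] at h2 g2 XD
  rw [mem_TAMA, projP_eq]
  simp only [map_sub, map_smul, map_add, map_mul, grading_grading, grading_dirac, grading_xvar,
    neg_mul, mul_neg, neg_neg]
  exact supercomm_aux h1 g1 h2 g2 (e _ h3) (e _ g3) DX XD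

theorem projP_cl_mem (c : Cl) : projP m κ (1 ⊗ₜ c) ∈ TAMA m κ := by
  refine projP_mem m κ ?_ ?_ ?_
  · simp [lap, Finset.mul_sum, Finset.sum_mul]
  · simp [normSq, Finset.mul_sum, Finset.sum_mul]
  · simp [euler, Finset.mul_sum, Finset.sum_mul]

/-- The symmetry `O(v₁ ∧ ⋯ ∧ v_p) = -½ P(γ(v₁ ∧ ⋯ ∧ v_p)) ∈ 𝔒_κ`. -/
def O {p : ℕ} (v : Fin p → V) : TAMA m κ :=
  ⟨(-2⁻¹ : ℂ) • projP m κ (1 ⊗ₜ quant v), (TAMA m κ).smul_mem (projP_cl_mem m κ _) _⟩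

theorem sum_refl {N : Type*} [AddCommGroup N] [Module ℂ N] (B : V →ₗ[ℂ] V →ₗ[ℂ] N) (a : Fin 2)
    (p : ℕ) :
    ∑ i, B (refl m a p (basisVec i)) (refl m a p (basisVec i))
      = ∑ i, B (basisVec i) (basisVec i) := by
  have hr : ∀ i, refl m a p (basisVec i) = basisVec i - (2 * root m a p i) • root m a p := fun i => by
    rw [refl, Module.reflection_apply, LinearMap.smul_apply, form_symm, form_basis, smul_eq_mul]
  have hone : ∑ i, root m a p i * root m a p i = 1 := by
    rw [← form_root_root m a p]
    simp [dotProductBilin, dotProduct]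
  have hB1 : ∀ y, ∑ i, root m a p i • B (basisVec i) y = B (root m a p) y := fun y => by
    conv_rhs => rw [sum_basis (root m a p)]
    simp
  have hB2 : ∀ y, ∑ i, root m a p i • B y (basisVec i) = B y (root m a p) := fun y => by
    conv_rhs => rw [sum_basis (root m a p)]
    simp
  have e : ∀ i, B (refl m a p (basisVec i)) (refl m a p (basisVec i)) = B (basisVec i) (basisVec i)
      - (2 : ℂ) • (root m a p i • B (basisVec i) (root m a p))
      - (2 : ℂ) • (root m a p i • B (root m a p) (basisVec i))
      + (4 : ℂ) • ((root m a p i * root m a p i) • B (root m a p) (root m a p)) := fun i => by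
    rw [hr]
    simp only [map_sub, map_smul, LinearMap.sub_apply, LinearMap.smul_apply]
    module
  rw [Finset.sum_congr rfl fun i _ => e i]
  simp only [Finset.sum_add_distrib, Finset.sum_sub_distrib, ← Finset.smul_sum, hB1, hB2,
    ← Finset.sum_smul, hone]
  module

theorem gam_root_mul (a : Fin 2) (p : ℕ) (x : V) :
    gam (root m a p) * gam x = - (gam (refl m a p x) * gam (root m a p)) := by
  have h : gam (root m a p) * gam x + gam x * gam (root m a p)
      = algebraMap ℂ Cl (2 * form (root m a p) x) := by
    rw [CliffordAlgebra.ι_mul_ι_add_swap]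
    congr 1
    simp only [QuadraticMap.polar, LinearMap.BilinMap.toQuadraticMap_apply, map_add,
      LinearMap.add_apply]
    rw [form_symm x]
    ring
  have h2 : gam (root m a p) * gam (root m a p) = 1 := by
    rw [CliffordAlgebra.ι_sq_scalar, LinearMap.BilinMap.toQuadraticMap_apply, form_root_root, map_one]
  rw [refl, Module.reflection_apply, LinearMap.smul_apply, smul_eq_mul, map_sub, map_smul, sub_mul,
    smul_mul_assoc, h2, ← Algebra.algebraMap_eq_smul_one, ← h]
  abel

theorem sTilde_mem (a : Fin 2) (p : ℕ) :
    hw m κ (reflW m a p) ⊗ₜ[ℂ] gam (root m a p) ∈ TAMA m κ := by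
  rw [mem_TAMA, grading_tmul, CliffordAlgebra.involute_ι, TensorProduct.tmul_neg, mul_neg, mul_neg]
  constructor
  · have h := sum_refl m (N := HC m κ)
      ((TensorProduct.mk ℂ (Cherednik m κ) Cl).compl₁₂ (hxi m κ ∘ₗ form) gam) a p
    simp only [LinearMap.compl₁₂_apply, LinearMap.comp_apply, TensorProduct.mk_apply] at h
    rw [dirac, Finset.mul_sum, ← h, Finset.sum_mul, ← Finset.sum_neg_distrib]
    refine Finset.sum_congr rfl fun i _ => ?_
    rw [Algebra.TensorProduct.tmul_mul_tmul, Algebra.TensorProduct.tmul_mul_tmul, hw_hxi,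
      gam_root_mul, TensorProduct.tmul_neg, ← form_comp_refl]
    rfl
  · have h := sum_refl m (N := HC m κ)
      ((TensorProduct.mk ℂ (Cherednik m κ) Cl).compl₁₂ (hx m κ) gam) a p
    simp only [LinearMap.compl₁₂_apply, TensorProduct.mk_apply] at h
    rw [xvar, Finset.mul_sum, ← h, Finset.sum_mul, ← Finset.sum_neg_distrib]
    refine Finset.sum_congr rfl fun i _ => ?_
    rw [Algebra.TensorProduct.tmul_mul_tmul, Algebra.TensorProduct.tmul_mul_tmul, hw_hx,
      gam_root_mul, TensorProduct.tmul_neg]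
    rfl

/-- The element `s̃_α = s_α ⊗ γ(α)` of `ρ(W̃) ⊂ 𝔒_κ` for the root `α = root m a p`. -/
def sTilde (a : Fin 2) (p : ℕ) : TAMA m κ :=
  ⟨hw m κ (reflW m a p) ⊗ₜ gam (root m a p), sTilde_mem m κ a p⟩

/-! ### Ladder operators -/

/-- The anticommutator `{a, b} = a b + b a`. -/
def acomm (a b : TAMA m κ) : TAMA m κ := a * b + b * a

/-- `H_a = ½ O(z_a ∧ z̄_a)`, for `a ∈ {1, 2}` (here numbered `0, 1`). -/
def H (a : Fin 2) : TAMA m κ := (2⁻¹ : ℂ) • O m κ ![zvec a 1, zvec a (-1)]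

/-- `Z = O(x₁ ∧ x₂ ∧ x₃ ∧ x₄)`. -/
def Z : TAMA m κ :=
  O m κ ![basisVec (0, 0), basisVec (0, 1), basisVec (1, 0), basisVec (1, 1)]

/-- `r̃_a = z s̃_{m_a} s̃_1` (with reflections in the `a`-th dihedral group), where the central
element `z` of the double cover is `-1` in `𝔒_κ`. -/
def rTilde (a : Fin 2) : TAMA m κ := -(sTilde m κ a (m a) * sTilde m κ a 1)

/-- The even ladder operator `L_{12}^{δε} = {H₁, {H₂, O(z₁^δ ∧ z₂^ε)}}`. -/
def ladderEven (δ ε : ℤˣ) : TAMA m κ :=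
  acomm m κ (H m κ 0) (acomm m κ (H m κ 1) (O m κ ![zvec 0 δ, zvec 1 ε]))

/-- The odd ladder operator `L_b^ε = {H_b, O(z_b^ε ∧ z_a ∧ z̄_a)}`, where `{a, b} = {1, 2}`. -/
def ladderOdd (b : Fin 2) (ε : ℤˣ) : TAMA m κ :=
  acomm m κ (H m κ b) (O m κ ![zvec b ε, zvec (1 - b) 1, zvec (1 - b) (-1)])

/-! ### The parameters `Q_a(j)` -/

/-- The numbers `Q_a(j)`; here `κ_{2a-1}` and `κ_{2a}` are the values of `κ` on the first and second
root of the `a`-th dihedral root system. -/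
def Q (a : Fin 2) (j : ℤ) : ℂ :=
  if Odd (m a) ∧ j ≡ 0 [ZMOD 2 * m a] then m a * κ (root m a 1)
  else if Even (m a) ∧ j ≡ 0 [ZMOD 2 * m a] then
    (m a : ℂ) / 2 * (κ (root m a 2) + κ (root m a 1))
  else if Even (m a) ∧ j ≡ m a [ZMOD 2 * m a] then
    (m a : ℂ) / 2 * (κ (root m a 2) - κ (root m a 1))
  else 0

/-- The parameter function `κ` is small. -/
def IsSmall : Prop := ∀ (a : Fin 2) (j : ℤ), ‖Q m κ a j‖ < 1 / 2

end TAMA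

/-! ### Weights, highest weights, triangle-representations -/

/-- A candidate weight `(λ₁, λ₂, Λ, ζ₁^{ℓ₁}, ζ₂^{ℓ₂})`, for the commuting elements
`H₁, H₂, Z, r̃₁, r̃₂`, with `ζ_a = e^{iπ/m_a}`. -/
structure Weight where
  /-- the eigenvalues `λ₁, λ₂` of `H₁, H₂` -/
  lam : Fin 2 → ℂ
  /-- the eigenvalue `Λ` of `Z` -/
  Lam : ℂ
  /-- the exponents `ℓ₁, ℓ₂` of the eigenvalues of `r̃₁, r̃₂` -/
  ell : Fin 2 → ℕ

section Representations

variable (m : Fin 2 → ℕ) (κ : V → ℂ) (M : Type*) [AddCommGroup M] [Module ℂ M]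
  [Module (TAMA m κ) M]

/-- The weight space `M_μ`. -/
def weightSpace (μ : Weight) : Set M :=
  {v | (∀ a, H m κ a • v = μ.lam a • v) ∧ Z m κ • v = μ.Lam • v ∧
    ∀ a, rTilde m κ a • v = Complex.exp (Complex.I * Real.pi / m a) ^ μ.ell a • v}

/-- `μ` is a weight of `M`. Since `r̃_a ^ m_a = -1`, the eigenvalues of `r̃_a` are the powers
`ζ_a ^ ℓ` with `ℓ ∈ {1, …, 2 m_a - 1}` odd; the exponents are normalised in this way. -/
def IsWeight (μ : Weight) : Prop :=
  (∀ a, Odd (μ.ell a) ∧ μ.ell a < 2 * m a) ∧ ∃ v ∈ weightSpace m κ M μ, v ≠ 0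

/-- The value at `κ = 0` of an eigenvalue of `H_a`. For small `κ` the eigenvalues of `H_a` are
half-integers `n + ½` shifted by some `± Q_a(j)`, with `|Q_a(j)| < ½`, and the value at `κ = 0` is the
half-integer `n + ½`, that is, the one for which `n ≤ Re c < n + 1`. -/
def valueAtZero (c : ℂ) : ℝ := ⌊c.re⌋ + 1 / 2

/-- The weight `μ` is higher than (or level with) `ν`: comparison, in lexicographic order, of the
values at `κ = 0` for `H₁` and `H₂`, then of the eigenvalues of `Z`, then of `ℓ₁` and `ℓ₂` (smaller
exponents being higher). The eigenvalues of `Z` on an irreducible module are `± Λ` for a single `Λ`,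
and are compared through their real parts. -/
def IsHigher (μ ν : Weight) : Prop :=
  valueAtZero (ν.lam 0) < valueAtZero (μ.lam 0) ∨
  valueAtZero (ν.lam 0) = valueAtZero (μ.lam 0) ∧
    (valueAtZero (ν.lam 1) < valueAtZero (μ.lam 1) ∨
    valueAtZero (ν.lam 1) = valueAtZero (μ.lam 1) ∧
      (ν.Lam.re < μ.Lam.re ∨
      ν.Lam.re = μ.Lam.re ∧
        (μ.ell 0 < ν.ell 0 ∨
        μ.ell 0 = ν.ell 0 ∧ μ.ell 1 ≤ ν.ell 1)))

/-- `μ` is a highest weight of `M`. -/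
def IsHighestWeight (μ : Weight) : Prop :=
  IsWeight m κ M μ ∧ ∀ ν, IsWeight m κ M ν → IsHigher μ ν

/-- The weight `μ` has the form required of the highest weight of a triangle-representation. -/
def IsTriangleWeight (μ : Weight) : Prop :=
  ∃ N : ℕ,
    (μ.lam 0 = N + 1 / 2 + Q m κ 0 (μ.ell 0 - 2 * N - 1) ∨
      μ.lam 0 = N + 1 / 2 - Q m κ 0 (μ.ell 0 - 2 * N - 1)) ∧
    (μ.lam 1 = 1 / 2 + Q m κ 1 (μ.ell 1 - 1) ∨ μ.lam 1 = 1 / 2 - Q m κ 1 (μ.ell 1 - 1)) ∧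
    μ.Lam = -1 / 2 - μ.lam 0 - μ.lam 1

/-- The ladder operators `L_2^+`, `L_2^-` and `L_{12}^{--}` vanish on the weight space `M_μ`. -/
def LaddersVanish (μ : Weight) : Prop :=
  ∀ v ∈ weightSpace m κ M μ,
    ladderOdd m κ 1 1 • v = 0 ∧ ladderOdd m κ 1 (-1) • v = 0 ∧ ladderEven m κ (-1) (-1) • v = 0

/-- `M` is a triangle-representation. -/
def IsTriangleRepresentation : Prop :=
  ∃ μ, IsHighestWeight m κ M μ ∧ IsTriangleWeight m κ μ ∧ LaddersVanish m κ M μ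

end Representations

end DunklTAMA

end

open scoped TensorProduct

set_option linter.unusedSimpArgs false

noncomputable section

namespace DunklTAMA

/-! This is a highest weight argument for the ladder operators. For {a, b} = {1, 2} (the code
numbers the planes 0 and 1) let C_b^ε be O(z_b^ε ∧ z_a ∧ z̄_a) up to a scalar, o_b^ε = O(z_b^ε), and
L_b^ε = {H_b, C_b^ε}. The operator L_b^ε shifts the eigenvalue of H_b by ε, keeps that of H_a and
changes the sign of that of Z. Everything rests on the factorisation `LadderSystem.L_L`, L_b^{-ε}
L_b^ε = 4 ((εH_b + ½)² - o_b^{-ε} o_b^ε) ((εH_b + ½)² - (Z + εH_a)²), in which o_b^{-ε} o_b^ε acts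
as the scalar Q_b(ℓ_b + ε)² on eigenvectors of the rotation with eigenvalue ζ_b^{ℓ_b}
(`LadderSystem.HasParameters.o_o_apply`).

Let v be a highest weight vector. A shift by one raises the value at κ = 0, so L_b^+ v = 0;
comparing v with its image under a reflection gives Re λ_b ≥ 0. Since |Q| < ½, the first factor of
the product L_b^- L_b^+ is nonzero on v, so (λ_b + ½)² = (Λ + λ_a)² for both b. The solutions are Λ
= -½ - λ₁ - λ₂ and λ₁ = λ₂, Λ = ½; the second is excluded by evaluating A^- A^+ on v, where A^± =
O(z_1^± ∧ z_2^±) (`LadderSystem.IsTop.Lam_eq`).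

If w = L_2^- v were nonzero, then L_1^+ w = 0 and the factorisation would force λ₂ = ½. No
diagonalisability of H_2 is assumed, so this case is settled by a Jordan block: a reflection applied
to C_2^- v gives a generalised eigenvector above v whose nilpotent part is a multiple of Q_2(ℓ_2 -
1). Such a block cannot sit above a highest weight vector
(`LadderSystem.IsEigenvector.jordan_eq_zero`), so Q_2(ℓ_2 - 1) = 0, and then L_2^- v = 0 after all.
Now L_2^+ L_2^- v = 0 determines λ₂, and an identity expressing L_1^- L_2^- through L_12^{--} yields
L_12^{--} v = 0.

For λ₁, the operator L_2^+ L_1^- moves (λ₁, λ₂) to (λ₁ - 1, λ₂ + 1). By finite dimension there is a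
last N for which its N-th power does not kill v, and the factorisation at the end of this chain
gives (N + ½ - λ₁)² = Q_1(ℓ_1 - 2N - 1)². If λ₁ = N + ½, the factorisation is inconclusive; then a
Jordan block at the end of the chain is carried back to v and again shows that Q_1(ℓ_1 - 2N - 1) =
0.

The relations themselves are identities in H_κ ⊗ 𝒞. Each plane generates a small algebra (`Plane`).
The odd generators of different planes anticommute; multiplying those of one plane by the area
element of the other makes them commute, and the identities become computations in a tensor product
of two algebras (`Plane.twoPlaneRelations`, `Plane.symRelations`). A highest weight exists because a
nonzero finite-dimensional module has finitely many weights and at least one; simplicity of `M`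
enters only through `M ≠ 0`. -/

/-- The elements `γ(z), γ(z̄), z, z̄, ξ_z, ξ_z̄` attached to an isotropic basis `z, z̄` of one of the two
planes, together with the sums `K = ∑ κ(α) s_α`, `psi = ∑ 2 κ(α) (z, α)² s_α` and
`psi' = ∑ 2 κ(α) (z̄, α)² s_α`, and the relations between them. -/
structure Plane (R : Type*) [Ring R] [Algebra ℂ R] where
  e : R
  e' : R
  p : R
  p' : R
  q : R
  q' : R
  K : R
  psi : R
  psi' : R
  e_e : e * e = 0
  e'_e' : e' * e' = 0
  e'_e : e' * e = (4 : ℂ) • (1 : R) - e * e'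
  e_p : e * p = p * e
  e_p' : e * p' = p' * e
  e_q : e * q = q * e
  e_q' : e * q' = q' * e
  e_K : e * K = K * e
  e_psi : e * psi = psi * e
  e_psi' : e * psi' = psi' * e
  e'_p : e' * p = p * e'
  e'_p' : e' * p' = p' * e'
  e'_q : e' * q = q * e'
  e'_q' : e' * q' = q' * e'
  e'_K : e' * K = K * e'
  e'_psi : e' * psi = psi * e'
  e'_psi' : e' * psi' = psi' * e'
  p'_p : p' * p = p * p'
  q'_q : q' * q = q * q'
  q_p : q * p = p * q + psi
  q'_p' : q' * p' = p' * q' + psi'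
  q_p' : q * p' = p' * q + (2 : ℂ) • (1 : R) + (2 : ℂ) • K
  q'_p : q' * p = p * q' + (2 : ℂ) • (1 : R) + (2 : ℂ) • K
  K_p : K * p = (-2⁻¹ : ℂ) • (p' * psi)
  K_p' : K * p' = (-2⁻¹ : ℂ) • (p * psi')
  K_q : K * q = (-2⁻¹ : ℂ) • (q' * psi)
  K_q' : K * q' = (-2⁻¹ : ℂ) • (q * psi')
  psi_p' : psi * p' = (-2 : ℂ) • (p * K)
  psi'_p : psi' * p = (-2 : ℂ) • (p' * K)
  psi_q' : psi * q' = (-2 : ℂ) • (q * K)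
  psi'_q : psi' * q = (-2 : ℂ) • (q' * K)

/-! ### The algebra of a single plane. -/

namespace Plane

variable {R : Type*} [Ring R] [Algebra ℂ R]

/-- Interchanging `z` and `z̄`. -/
def swap (P : Plane R) : Plane R where
  e := P.e'
  e' := P.e
  p := P.p'
  p' := P.p
  q := P.q'
  q' := P.q
  K := P.K
  psi := P.psi'
  psi' := P.psi
  e_e := P.e'_e'
  e'_e' := P.e_e
  e'_e := by rw [P.e'_e, sub_sub_cancel]
  e_p := P.e'_p'
  e_p' := P.e'_p
  e_q := P.e'_q'
  e_q' := P.e'_q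
  e_K := P.e'_K
  e_psi := P.e'_psi'
  e_psi' := P.e'_psi
  e'_p := P.e_p'
  e'_p' := P.e_p
  e'_q := P.e_q'
  e'_q' := P.e_q
  e'_K := P.e_K
  e'_psi := P.e_psi'
  e'_psi' := P.e_psi
  p'_p := P.p'_p.symm
  q'_q := P.q'_q.symm
  q_p := P.q'_p'
  q'_p' := P.q_p
  q_p' := P.q'_p
  q'_p := P.q_p'
  K_p := P.K_p'
  K_p' := P.K_p
  K_q := P.K_q'
  K_q' := P.K_q
  psi_p' := P.psi'_p
  psi'_p := P.psi_p'
  psi_q' := P.psi'_q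
  psi'_q := P.psi_q'

variable (P : Plane R)

/-- The Dunkl–Dirac operator of the plane. -/
def D : R := (2⁻¹ : ℂ) • (P.q * P.e' + P.q' * P.e)

/-- The vector variable of the plane. -/
def X : R := (2⁻¹ : ℂ) • (P.p * P.e' + P.p' * P.e)

/-- The product `j g` of the area element `g` and of the eigenvalue `j` of `g` acting on `z`. -/
def G : R := (2⁻¹ : ℂ) • (P.e' * P.e) - 1

/-- The Scasimir element of the plane. -/
def S : R := (2⁻¹ : ℂ) • (P.D * P.X - P.X * P.D - 1)

/-- The element `O(z)`. -/
def o : R := (2⁻¹ : ℂ) • (P.K * P.e) + (4⁻¹ : ℂ) • (P.psi * P.e')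

/-- With products bracketed to the right, a rewriting rule for a two-letter word also has to fire at
the head of a longer word. -/
theorem assoc_rule {R : Type*} [Ring R] {a b c : R} (h : a * b = c) (d : R) : a * (b * d) = c * d := by
  rw [← mul_assoc, h]

theorem swap_G : P.swap.G = - P.G := by
  simp only [G, swap, P.e'_e]
  module

/-- The relations in the algebra of one plane. -/
structure Relations : Prop where
  e_D : P.e * P.D = -(P.D * P.e) + (2 : ℂ) • P.q
  e_X : P.e * P.X = -(P.X * P.e) + (2 : ℂ) • P.p
  p_D : P.p * P.D = P.D * P.p - P.e - (2 : ℂ) • P.o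
  q_X : P.q * P.X = P.X * P.q + P.e + (2 : ℂ) • P.o
  o_D : P.o * P.D = -(P.D * P.o)
  o_X : P.o * P.X = -(P.X * P.o)
  p_X : P.p * P.X = P.X * P.p
  q_D : P.q * P.D = P.D * P.q
  G_D : P.G * P.D = -(P.D * P.G)
  G_X : P.G * P.X = -(P.X * P.G)
  G_e : P.G * P.e = -P.e
  e_G : P.e * P.G = P.e
  G_o : P.G * P.o = -(P.o * P.G)
  p_G : P.p * P.G = P.G * P.p
  q_G : P.q * P.G = P.G * P.q
  G_G : P.G * P.G = 1
  D_D_X : P.D * (P.D * P.X) = P.X * (P.D * P.D) + (2:ℂ) • P.D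
  X_X_D : P.X * (P.X * P.D) = P.D * (P.X * P.X) - (2:ℂ) • P.X
  X_e : P.X * P.e = P.p + P.G * P.p
  D_e : P.D * P.e = P.q + P.G * P.q
  D_p : P.D * P.p = P.X * P.q + P.S * P.e + (2⁻¹:ℂ) • P.e + P.o + P.G * P.o
  p'_p_eq : P.p' * P.p = P.X * P.X
  q'_q_eq : P.q' * P.q = P.D * P.D
  e'_e_eq : P.e' * P.e = (2:ℂ) • (1:R) + (2:ℂ) • P.G
  p'_q_eq : P.p' * P.q = P.X * P.D + (P.S - (2⁻¹:ℂ) • (1:R) - P.K) * (1+P.G)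
  q'_p_eq : P.q' * P.p = P.D * P.X - (P.S - (2⁻¹:ℂ) • (1:R) - P.K) * (1+P.G)
  e'_p_eq : P.e' * P.p = P.X + P.G * P.X
  p'_e_eq : P.p' * P.e = P.X - P.G * P.X
  e'_q_eq : P.e' * P.q = P.D + P.G * P.D
  q'_e_eq : P.q' * P.e = P.D - P.G * P.D
  o'_e_eq : P.swap.o * P.e = P.K + P.K * P.G
  e'_o_eq : P.e' * P.o = P.K + P.K * P.G
  p'_o_eq : P.p' * P.o = -(P.swap.o * P.p)
  q'_o_eq : P.q' * P.o = -(P.swap.o * P.q)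
  K_G : P.K * P.G = P.G * P.K

/-- The structure fields serve as a rewriting system that orders words: vectors, then covectors,
then reflection sums, then Clifford letters. Both sides of each identity reach normal form and are
compared linearly. -/
theorem relations : P.Relations := by
  constructor
  all_goals
    simp only [D, X, G, S, o, swap, mul_add, add_mul, sub_mul, mul_sub, mul_assoc, smul_mul_assoc,
      mul_smul_comm, smul_smul, smul_add, smul_sub, mul_one, one_mul, mul_zero, zero_mul, smul_zero,
      P.e_e, P.e'_e', P.e'_e, P.e_p, P.e_p', P.e_q, P.e_q', P.e_K, P.e_psi, P.e_psi', P.e'_p, P.e'_p', P.e'_q,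
      P.e'_q', P.e'_K, P.e'_psi, P.e'_psi', P.p'_p, P.q'_q, P.q_p, P.q'_p', P.q_p', P.q'_p, P.K_p, P.K_p', P.K_q,
      P.K_q', P.psi_p', P.psi'_p, P.psi_q', P.psi'_q,
      assoc_rule P.e_e, assoc_rule P.e'_e', assoc_rule P.e'_e, assoc_rule P.e_p, assoc_rule P.e_p', assoc_rule P.e_q,
      assoc_rule P.e_q', assoc_rule P.e_K, assoc_rule P.e_psi, assoc_rule P.e_psi', assoc_rule P.e'_p,
      assoc_rule P.e'_p', assoc_rule P.e'_q, assoc_rule P.e'_q', assoc_rule P.e'_K, assoc_rule P.e'_psi,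
      assoc_rule P.e'_psi', assoc_rule P.p'_p, assoc_rule P.q'_q, assoc_rule P.q_p, assoc_rule P.q'_p',
      assoc_rule P.q_p', assoc_rule P.q'_p, assoc_rule P.K_p, assoc_rule P.K_p', assoc_rule P.K_q, assoc_rule P.K_q',
      assoc_rule P.psi_p', assoc_rule P.psi'_p, assoc_rule P.psi_q', assoc_rule P.psi'_q]
    try module

/-- The commutation relations of the Scasimir element of one plane. -/
structure ScasimirRelations : Prop where
  D_X : P.D * P.X = P.X * P.D + (2:ℂ) • P.S + 1
  D_S : P.D * P.S = -(P.S * P.D)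
  X_S : P.X * P.S = -(P.S * P.X)
  G_S : P.G * P.S = P.S * P.G
  e_S : P.e * P.S = P.S * P.e - (2:ℂ) • (P.D * P.p) + (2:ℂ) • (P.X * P.q) + (2:ℂ) • P.e + (4:ℂ) • P.o
  p_S : P.p * P.S = P.S * P.p - P.p + P.X * P.e + (2:ℂ) • (P.X * P.o)
  q_S : P.q * P.S = P.S * P.q + P.D * P.e + (2:ℂ) • (P.D * P.o) - P.q
  o_S : P.o * P.S = P.S * P.o

/-- These follow from `Relations` by expanding `S`. For instance, that `S` anticommutes with `D`
amounts to [D², X] = 2D, and that it anticommutes with `X` to [X², D] = -2X. -/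
theorem scasimirRelations : P.ScasimirRelations := by
  have h := P.relations
  constructor
  all_goals
    simp only [S, mul_add, add_mul, sub_mul, mul_sub, mul_assoc, smul_mul_assoc, mul_smul_comm, smul_smul, smul_add,
      smul_sub, mul_one, one_mul, neg_mul, mul_neg, h.e_D, h.e_X, h.p_D, h.q_X, h.o_D, h.o_X, h.p_X, h.q_D, h.G_D, h.G_X, h.D_D_X, h.X_X_D,
      assoc_rule h.e_D, assoc_rule h.e_X, assoc_rule h.p_D, assoc_rule h.q_X, assoc_rule h.o_D, assoc_rule h.o_X, assoc_rule h.p_X, assoc_rule h.q_D, assoc_rule h.G_D, assoc_rule h.G_X, assoc_rule h.D_D_X, assoc_rule h.X_X_D]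
    try module

end Plane

/-! ### Two commuting planes in a tensor product. -/

namespace Plane

theorem anticomm_symm {R : Type*} [Ring R] {a b : R} (h : a * b = -(b * a)) : b * a = -(a * b) := by
  rw [h, neg_neg]

section TwoPlanes

variable {A B : Type*} [Ring A] [Algebra ℂ A] [Ring B] [Algebra ℂ B] (P : Plane A) (Q : Plane B)

/-- The element `ε H` of the first plane. -/
def tH₁ : A ⊗[ℂ] B := -((P.S * P.G) ⊗ₜ 1)

/-- The element `ε H` of the second plane. -/
def tH₂ : A ⊗[ℂ] B := -(1 ⊗ₜ (Q.S * Q.G))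

/-- The total Scasimir element. -/
def tS : A ⊗[ℂ] B :=
  P.S ⊗ₜ 1 + 1 ⊗ₜ Q.S + (2⁻¹ : ℂ) • (1 ⊗ₜ 1) + (P.D * P.G) ⊗ₜ Q.X - (P.X * P.G) ⊗ₜ Q.D

/-- The element `Z`. -/
def tZ : A ⊗[ℂ] B := -(tS P Q * (P.G ⊗ₜ Q.G))

/-- The odd symmetry `O(z_a ∧ e₃ ∧ e₄)`, up to a scalar. -/
def tC₁ : A ⊗[ℂ] B :=
  P.e ⊗ₜ ((Q.S + (2⁻¹ : ℂ) • 1) * Q.G) + (P.p * P.G) ⊗ₜ (Q.D * Q.G) - (P.G * P.q) ⊗ₜ (Q.X * Q.G)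
    + P.o ⊗ₜ Q.G

/-- The odd symmetry `O(e₁ ∧ e₂ ∧ z_b)`, up to a scalar. -/
def tC₂ : A ⊗[ℂ] B :=
  (P.S + (2⁻¹ : ℂ) • 1) ⊗ₜ Q.e + (P.D * P.G) ⊗ₜ Q.p - (P.X * P.G) ⊗ₜ Q.q + 1 ⊗ₜ Q.o

/-- The even symmetry `O(z_a ∧ z_b)`. -/
def tA : A ⊗[ℂ] B :=
  P.p ⊗ₜ Q.q - P.q ⊗ₜ Q.p + (2⁻¹ : ℂ) • (P.e ⊗ₜ Q.e) + (P.o * P.G) ⊗ₜ Q.e + P.e ⊗ₜ Q.o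

/-- The even symmetry `O(z̄_a ∧ z̄_b)`. -/
def tA' : A ⊗[ℂ] B :=
  P.p' ⊗ₜ Q.q' - P.q' ⊗ₜ Q.p' - (2⁻¹ : ℂ) • (P.e' ⊗ₜ Q.e') + (P.swap.o * P.G) ⊗ₜ Q.e'
    - P.e' ⊗ₜ Q.swap.o

/-- The odd symmetry `O(e₁ ∧ e₂ ∧ z̄_b)`, up to a scalar. -/
def tC₂' : A ⊗[ℂ] B :=
  (P.S + (2⁻¹ : ℂ) • 1) ⊗ₜ Q.e' + (P.D * P.G) ⊗ₜ Q.p' - (P.X * P.G) ⊗ₜ Q.q' + 1 ⊗ₜ Q.swap.o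

/-- The relations between the symmetries of two planes. -/
structure TwoPlaneRelations : Prop where
  H_C : tH₂ Q * tC₂ P Q - tC₂ P Q * tH₂ Q
    = tC₂ P Q + (2 : ℂ) • ((tZ P Q - tH₁ P) * (P.G ⊗ₜ Q.o))
  C_C : tC₂' P Q * tC₂ P Q = (tZ P Q + tH₁ P) * (tZ P Q + tH₁ P) + 1 ⊗ₜ (Q.swap.o * Q.o)
    - (tH₂ Q + (2⁻¹ : ℂ) • 1) * (tH₂ Q + (2⁻¹ : ℂ) • 1)
  H_A : tH₁ P * tA P Q - tA P Q * tH₁ P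
    = tA P Q + (2 : ℂ) • ((P.o * P.G) ⊗ₜ Q.o) + (2 : ℂ) • ((P.o ⊗ₜ 1) * tC₂ P Q)
  C₁_C₂ : tC₁ P Q * tC₂ P Q = tZ P Q * tA P Q - (2⁻¹ : ℂ) • (tA P Q - (tH₁ P * tA P Q + tA P Q * tH₁ P)
    + (tH₂ Q * tA P Q + tA P Q * tH₂ Q)) - (P.o * P.G) ⊗ₜ Q.o
  A_A : tA' P Q * tA P Q = (tH₁ P + tH₂ Q + 1) * (tH₁ P + tH₂ Q + 1)
    - (tZ P Q - (2⁻¹ : ℂ) • 1) * (tZ P Q - (2⁻¹ : ℂ) • 1) - (2 : ℂ) • ((P.swap.o * P.o) ⊗ₜ 1)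
    - (2 : ℂ) • (1 ⊗ₜ (Q.swap.o * Q.o)) - (2 : ℂ) • ((P.swap.o ⊗ₜ 1) * tC₁ P Q)
    - (2 : ℂ) • ((P.G ⊗ₜ Q.swap.o) * tC₂ P Q)

-- Letters in different tensor factors commute, so each factor is normalised separately by the
-- one-plane relations, now in the letters `D`, `X`, `S`, `G`, `e`, `p`, `q`, `o`. The factors `P.G`
-- on the left record the signs that arise when the planes supercommute.
set_option maxHeartbeats 4000000 in
theorem twoPlaneRelations : TwoPlaneRelations P Q := by
  have h := P.relations
  have k := Q.relations
  have h' := P.scasimirRelations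
  have k' := Q.scasimirRelations
  have hDG := anticomm_symm h.G_D
  have hXG := anticomm_symm h.G_X
  have hoG := anticomm_symm h.G_o
  have kDG := anticomm_symm k.G_D
  have kXG := anticomm_symm k.G_X
  have koG := anticomm_symm k.G_o
  -- Rules for the conjugate generators are those of the swapped plane, whose area element is `-G`.
  have hoG' : P.swap.o * P.G = -(P.G * P.swap.o) := by
    have := anticomm_symm P.swap.relations.G_o
    rwa [swap_G, mul_neg, neg_mul, neg_inj] at this
  have koG' : Q.swap.o * Q.G = -(Q.G * Q.swap.o) := by
    have := anticomm_symm Q.swap.relations.G_o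
    rwa [swap_G, mul_neg, neg_mul, neg_inj] at this
  have hpG' : P.p' * P.G = P.G * P.p' := by
    have := P.swap.relations.p_G
    rwa [swap_G, mul_neg, neg_mul, neg_inj] at this
  have hqG' : P.q' * P.G = P.G * P.q' := by
    have := P.swap.relations.q_G
    rwa [swap_G, mul_neg, neg_mul, neg_inj] at this
  have heG' : P.e' * P.G = -P.e' := by
    have := P.swap.relations.e_G
    rw [swap_G, mul_neg] at this
    exact neg_eq_iff_eq_neg.mp this
  have kpG' : Q.p' * Q.G = Q.G * Q.p' := by
    have := Q.swap.relations.p_G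
    rwa [swap_G, mul_neg, neg_mul, neg_inj] at this
  have kqG' : Q.q' * Q.G = Q.G * Q.q' := by
    have := Q.swap.relations.q_G
    rwa [swap_G, mul_neg, neg_mul, neg_inj] at this
  have keG' : Q.e' * Q.G = -Q.e' := by
    have := Q.swap.relations.e_G
    rw [swap_G, mul_neg] at this
    exact neg_eq_iff_eq_neg.mp this
  constructor
  all_goals
    simp only [tH₁, tH₂, tS, tZ, tC₁, tC₂, tA, tA', tC₂', mul_add, add_mul, sub_mul, mul_sub, neg_mul, mul_neg, neg_neg,
      smul_mul_assoc, mul_smul_comm, Algebra.TensorProduct.one_def, Algebra.TensorProduct.tmul_mul_tmul, mul_assoc,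
      mul_one, one_mul, smul_add, smul_sub, smul_neg, smul_smul,
      TensorProduct.add_tmul, TensorProduct.tmul_add, TensorProduct.sub_tmul, TensorProduct.tmul_sub,
      assoc_rule hpG', assoc_rule hqG', assoc_rule heG', assoc_rule kpG', assoc_rule kqG', assoc_rule keG',
      TensorProduct.neg_tmul, TensorProduct.tmul_neg, ← TensorProduct.smul_tmul', TensorProduct.tmul_smul,
      h'.D_X, h'.D_S, h'.X_S, h'.G_S, h.G_G, h'.e_S, h'.p_S, h'.q_S, h'.o_S, h.e_D, h.e_X, h.e_G, h.p_D,
      h.p_X, h.p_G, h.q_D, h.q_X, h.q_G, h.o_D, h.o_X, h.G_e, h.X_e, h.D_e, h.D_p, h.p'_p_eq, h.q'_q_eq,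
      h.e'_e_eq, h.p'_q_eq, h.q'_p_eq, h.e'_p_eq, h.p'_e_eq, h.e'_q_eq, h.q'_e_eq, h.o'_e_eq, h.e'_o_eq,
      h.p'_o_eq, h.q'_o_eq, h.K_G, hDG, hXG, hoG, hoG', k'.D_X, k'.D_S, k'.X_S, k'.G_S, k.G_G, k'.e_S,
      k'.p_S, k'.q_S, k'.o_S, k.e_D, k.e_X, k.e_G, k.p_D, k.p_X, k.p_G, k.q_D, k.q_X, k.q_G, k.o_D,
      k.o_X, k.G_e, k.X_e, k.D_e, k.D_p, k.p'_p_eq, k.q'_q_eq, k.e'_e_eq, k.p'_q_eq, k.q'_p_eq,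
      k.e'_p_eq, k.p'_e_eq, k.e'_q_eq, k.q'_e_eq, k.o'_e_eq, k.e'_o_eq, k.p'_o_eq, k.q'_o_eq, k.K_G, kDG,
      kXG, koG, koG', hpG', hqG', heG', kpG', kqG', keG', assoc_rule h'.D_X, assoc_rule h'.D_S, assoc_rule h'.X_S, assoc_rule h'.G_S,
      assoc_rule h.G_G, assoc_rule h'.e_S, assoc_rule h'.p_S, assoc_rule h'.q_S, assoc_rule h'.o_S,
      assoc_rule h.e_D, assoc_rule h.e_X, assoc_rule h.e_G, assoc_rule h.p_D, assoc_rule h.p_X,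
      assoc_rule h.p_G, assoc_rule h.q_D, assoc_rule h.q_X, assoc_rule h.q_G, assoc_rule h.o_D,
      assoc_rule h.o_X, assoc_rule h.G_e, assoc_rule h.X_e, assoc_rule h.D_e, assoc_rule h.D_p,
      assoc_rule h.p'_p_eq, assoc_rule h.q'_q_eq, assoc_rule h.e'_e_eq, assoc_rule h.p'_q_eq, assoc_rule
      h.q'_p_eq, assoc_rule h.e'_p_eq, assoc_rule h.p'_e_eq, assoc_rule h.e'_q_eq, assoc_rule h.q'_e_eq,
      assoc_rule h.o'_e_eq, assoc_rule h.e'_o_eq, assoc_rule h.p'_o_eq, assoc_rule h.q'_o_eq, assoc_rule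
      h.K_G, assoc_rule hDG, assoc_rule hXG, assoc_rule hoG, assoc_rule hoG', assoc_rule k'.D_X,
      assoc_rule k'.D_S, assoc_rule k'.X_S, assoc_rule k'.G_S, assoc_rule k.G_G, assoc_rule k'.e_S,
      assoc_rule k'.p_S, assoc_rule k'.q_S, assoc_rule k'.o_S, assoc_rule k.e_D, assoc_rule k.e_X,
      assoc_rule k.e_G, assoc_rule k.p_D, assoc_rule k.p_X, assoc_rule k.p_G, assoc_rule k.q_D,
      assoc_rule k.q_X, assoc_rule k.q_G, assoc_rule k.o_D, assoc_rule k.o_X, assoc_rule k.G_e,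
      assoc_rule k.X_e, assoc_rule k.D_e, assoc_rule k.D_p, assoc_rule k.p'_p_eq, assoc_rule k.q'_q_eq,
      assoc_rule k.e'_e_eq, assoc_rule k.p'_q_eq, assoc_rule k.q'_p_eq, assoc_rule k.e'_p_eq, assoc_rule
      k.p'_e_eq, assoc_rule k.e'_q_eq, assoc_rule k.q'_e_eq, assoc_rule k.o'_e_eq, assoc_rule k.e'_o_eq,
      assoc_rule k.p'_o_eq, assoc_rule k.q'_o_eq, assoc_rule k.K_G, assoc_rule kDG, assoc_rule kXG,
      assoc_rule koG, assoc_rule koG']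
    try module

end TwoPlanes
end Plane

/-! ### From supercommuting to commuting planes. -/

namespace Plane

variable {R : Type*} [Ring R] [Algebra ℂ R]

/-- The even generators. -/
def evenGens (P : Plane R) : Set R := {P.p, P.p', P.q, P.q', P.K, P.psi, P.psi'}

/-- All generators. -/
def gens (P : Plane R) : Set R := {P.e, P.e'} ∪ P.evenGens

/-- Restriction to a subalgebra that contains the generators. -/
def restrict (P : Plane R) (A : Subalgebra ℂ R) (h : P.gens ⊆ A) : Plane A where
  e := ⟨P.e, h (by simp [gens, evenGens])⟩
  e' := ⟨P.e', h (by simp [gens, evenGens])⟩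
  p := ⟨P.p, h (by simp [gens, evenGens])⟩
  p' := ⟨P.p', h (by simp [gens, evenGens])⟩
  q := ⟨P.q, h (by simp [gens, evenGens])⟩
  q' := ⟨P.q', h (by simp [gens, evenGens])⟩
  K := ⟨P.K, h (by simp [gens, evenGens])⟩
  psi := ⟨P.psi, h (by simp [gens, evenGens])⟩
  psi' := ⟨P.psi', h (by simp [gens, evenGens])⟩
  e_e := Subtype.ext P.e_e
  e'_e' := Subtype.ext P.e'_e'
  e'_e := Subtype.ext P.e'_e
  e_p := Subtype.ext P.e_p
  e_p' := Subtype.ext P.e_p'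
  e_q := Subtype.ext P.e_q
  e_q' := Subtype.ext P.e_q'
  e_K := Subtype.ext P.e_K
  e_psi := Subtype.ext P.e_psi
  e_psi' := Subtype.ext P.e_psi'
  e'_p := Subtype.ext P.e'_p
  e'_p' := Subtype.ext P.e'_p'
  e'_q := Subtype.ext P.e'_q
  e'_q' := Subtype.ext P.e'_q'
  e'_K := Subtype.ext P.e'_K
  e'_psi := Subtype.ext P.e'_psi
  e'_psi' := Subtype.ext P.e'_psi'
  p'_p := Subtype.ext P.p'_p
  q'_q := Subtype.ext P.q'_q
  q_p := Subtype.ext P.q_p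
  q'_p' := Subtype.ext P.q'_p'
  q_p' := Subtype.ext P.q_p'
  q'_p := Subtype.ext P.q'_p
  K_p := Subtype.ext P.K_p
  K_p' := Subtype.ext P.K_p'
  K_q := Subtype.ext P.K_q
  K_q' := Subtype.ext P.K_q'
  psi_p' := Subtype.ext P.psi_p'
  psi'_p := Subtype.ext P.psi'_p
  psi_q' := Subtype.ext P.psi_q'
  psi'_q := Subtype.ext P.psi'_q

theorem mul_mul_of_involution {R : Type*} [Ring R] {t x y : R} (ht : t * t = 1) (hx : t * x = x * t) : t * x * (t * y) = x * y := by
  rw [hx, mul_assoc, ← mul_assoc t t, ht, one_mul]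

/-- Multiplying the odd generators of a plane by a commuting involution. -/
def twist (P : Plane R) (t : R) (ht : t * t = 1) (hc : ∀ x ∈ P.gens, t * x = x * t) : Plane R where
  e := t * P.e
  e' := t * P.e'
  p := P.p
  p' := P.p'
  q := P.q
  q' := P.q'
  K := P.K
  psi := P.psi
  psi' := P.psi'
  e_e := by rw [mul_mul_of_involution ht (hc _ (by simp [gens])), P.e_e]
  e'_e' := by rw [mul_mul_of_involution ht (hc _ (by simp [gens])), P.e'_e']
  e'_e := by rw [mul_mul_of_involution ht (hc _ (by simp [gens])), P.e'_e, mul_mul_of_involution ht (hc _ (by simp [gens]))]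
  e_p := by rw [mul_assoc, P.e_p, ← mul_assoc, hc _ (by simp [gens, evenGens]), mul_assoc]
  e_p' := by rw [mul_assoc, P.e_p', ← mul_assoc, hc _ (by simp [gens, evenGens]), mul_assoc]
  e_q := by rw [mul_assoc, P.e_q, ← mul_assoc, hc _ (by simp [gens, evenGens]), mul_assoc]
  e_q' := by rw [mul_assoc, P.e_q', ← mul_assoc, hc _ (by simp [gens, evenGens]), mul_assoc]
  e_K := by rw [mul_assoc, P.e_K, ← mul_assoc, hc _ (by simp [gens, evenGens]), mul_assoc]
  e_psi := by rw [mul_assoc, P.e_psi, ← mul_assoc, hc _ (by simp [gens, evenGens]), mul_assoc]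
  e_psi' := by rw [mul_assoc, P.e_psi', ← mul_assoc, hc _ (by simp [gens, evenGens]), mul_assoc]
  e'_p := by rw [mul_assoc, P.e'_p, ← mul_assoc, hc _ (by simp [gens, evenGens]), mul_assoc]
  e'_p' := by rw [mul_assoc, P.e'_p', ← mul_assoc, hc _ (by simp [gens, evenGens]), mul_assoc]
  e'_q := by rw [mul_assoc, P.e'_q, ← mul_assoc, hc _ (by simp [gens, evenGens]), mul_assoc]
  e'_q' := by rw [mul_assoc, P.e'_q', ← mul_assoc, hc _ (by simp [gens, evenGens]), mul_assoc]
  e'_K := by rw [mul_assoc, P.e'_K, ← mul_assoc, hc _ (by simp [gens, evenGens]), mul_assoc]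
  e'_psi := by rw [mul_assoc, P.e'_psi, ← mul_assoc, hc _ (by simp [gens, evenGens]), mul_assoc]
  e'_psi' := by rw [mul_assoc, P.e'_psi', ← mul_assoc, hc _ (by simp [gens, evenGens]), mul_assoc]
  p'_p := P.p'_p
  q'_q := P.q'_q
  q_p := P.q_p
  q'_p' := P.q'_p'
  q_p' := P.q_p'
  q'_p := P.q'_p
  K_p := P.K_p
  K_p' := P.K_p'
  K_q := P.K_q
  K_q' := P.K_q'
  psi_p' := P.psi_p'
  psi'_p := P.psi'_p
  psi_q' := P.psi_q'
  psi'_q := P.psi'_q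

/-- Two planes supercommute if their odd generators anticommute, while the even ones commute with
everything. -/
structure SuperCommute (P Q : Plane R) : Prop where
  odd : ∀ x ∈ ({P.e, P.e'} : Set R), ∀ y ∈ ({Q.e, Q.e'} : Set R), x * y = -(y * x)
  even_left : ∀ x ∈ P.evenGens, ∀ y ∈ Q.gens, x * y = y * x
  even_right : ∀ x ∈ P.gens, ∀ y ∈ Q.evenGens, x * y = y * x

theorem SuperCommute.symm {P Q : Plane R} (h : SuperCommute P Q) : SuperCommute Q P where
  odd x hx y hy := by rw [h.odd y hy x hx, neg_neg]
  even_left x hx y hy := (h.even_right y hy x hx).symm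
  even_right x hx y hy := (h.even_left y hy x hx).symm

/-- `O(e₁ ∧ e₂ ∧ z)`, up to a scalar, where `e₁, e₂` span the plane `P` and `z` is the basis vector of
`Q`. -/
def oddSym (P Q : Plane R) : R :=
  (P.S + (2⁻¹ : ℂ) • 1) * (P.G * Q.e) + P.D * P.G * Q.p - P.X * P.G * Q.q + P.G * Q.o

/-- `O(z ∧ w)`, where `z` and `w` are the basis vectors of `P` and `Q`. -/
def evenSym (P Q : Plane R) : R :=
  P.p * Q.q - P.q * Q.p + (2⁻¹ : ℂ) • (P.e * Q.e) + P.o * Q.e + P.e * Q.o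

/-- The element `± H` of a plane. -/
def eta (P : Plane R) : R := -(P.S * P.G)

/-- The total Scasimir element of two planes. -/
def totalS (P Q : Plane R) : R :=
  P.S + Q.S + (2⁻¹ : ℂ) • 1 + P.D * Q.X - P.X * Q.D

/-- The element `Z` of two planes. -/
def totalZ (P Q : Plane R) : R := -(totalS P Q * (P.G * Q.G))

/-- The relations between the symmetries attached to two planes. -/
structure SymRelations (P Q : Plane R) : Prop where
  H_C : eta Q * oddSym P Q - oddSym P Q * eta Q
    = oddSym P Q + (2 : ℂ) • ((totalZ P Q - eta P) * Q.o)
  C_C : oddSym P Q.swap * oddSym P Q = (totalZ P Q + eta P) * (totalZ P Q + eta P) + Q.swap.o * Q.o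
    - (eta Q + (2⁻¹ : ℂ) • 1) * (eta Q + (2⁻¹ : ℂ) • 1)
  H_A : eta P * evenSym P Q - evenSym P Q * eta P
    = evenSym P Q + (2 : ℂ) • (P.o * Q.o) + (2 : ℂ) • (P.o * oddSym P Q)
  C_C' : oddSym Q P * oddSym P Q = totalZ P Q * evenSym P Q - (2⁻¹ : ℂ) • (evenSym P Q
    - (eta P * evenSym P Q + evenSym P Q * eta P) + (eta Q * evenSym P Q + evenSym P Q * eta Q)) - P.o * Q.o
  A_A : evenSym P.swap Q.swap * evenSym P Q = (eta P + eta Q + 1) * (eta P + eta Q + 1)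
    - (totalZ P Q - (2⁻¹ : ℂ) • 1) * (totalZ P Q - (2⁻¹ : ℂ) • 1) - (2 : ℂ) • (P.swap.o * P.o)
    - (2 : ℂ) • (Q.swap.o * Q.o) - (2 : ℂ) • (P.swap.o * oddSym Q P)
    - (2 : ℂ) • (Q.swap.o * oddSym P Q)

section Twist

variable {P Q : Plane R}

/-- `P.G` is a scalar plus a product of two odd generators, so the two signs cancel. -/
theorem SuperCommute.G_comm (h : SuperCommute P Q) : ∀ x ∈ Q.gens, P.G * x = x * P.G := by
  intro x hx
  have key : P.e' * P.e * x = x * (P.e' * P.e) := by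
    rcases hx with hx | hx
    · rw [mul_assoc, h.odd _ (by simp) _ hx, mul_neg, ← mul_assoc, h.odd _ (by simp) _ hx, neg_mul, neg_neg, mul_assoc]
    · rw [mul_assoc, h.even_right _ (by simp [gens]) _ hx, ← mul_assoc, h.even_right _ (by simp [gens]) _ hx, mul_assoc]
  simp only [G, sub_mul, mul_sub, smul_mul_assoc, mul_smul_comm, key, one_mul, mul_one]

/-- The plane `Q`, twisted so as to commute with `P`. -/
def SuperCommute.twisted (h : SuperCommute P Q) : Plane R := Q.twist P.G P.relations.G_G h.G_comm

/-- `P.G` anticommutes with the odd generators of `P` and commutes with the even ones. Multiplying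
`Q.e` and `Q.e'` by it therefore cancels exactly the sign by which they fail to commute with `P`. -/
theorem SuperCommute.twisted_comm (h : SuperCommute P Q) : ∀ x ∈ P.gens, ∀ y ∈ h.twisted.gens, x * y = y * x := by
  have hG : ∀ x ∈ P.evenGens, P.G * x = x * P.G := by
    rintro x (rfl | rfl | rfl | rfl | rfl | rfl | rfl)
    · exact P.relations.p_G.symm
    · have := P.swap.relations.p_G
      rw [swap_G, mul_neg, neg_mul, neg_inj] at this
      exact this.symm
    · exact P.relations.q_G.symm
    · have := P.swap.relations.q_G
      rw [swap_G, mul_neg, neg_mul, neg_inj] at this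
      exact this.symm
    · exact P.relations.K_G.symm
    · simp only [G, sub_mul, mul_sub, smul_mul_assoc, mul_smul_comm, one_mul, mul_one, mul_assoc, P.e_psi,
        assoc_rule P.e'_psi]
    · simp only [G, sub_mul, mul_sub, smul_mul_assoc, mul_smul_comm, one_mul, mul_one, mul_assoc, P.e_psi',
        assoc_rule P.e'_psi']
  have hodd : ∀ x ∈ ({P.e, P.e'} : Set R), P.G * x = -(x * P.G) := by
    rintro x (rfl | rfl)
    · rw [P.relations.G_e, P.relations.e_G]
    · have h1 := P.swap.relations.G_e
      have h2 := P.swap.relations.e_G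
      rw [swap_G, neg_mul, neg_inj] at h1
      rw [swap_G, mul_neg] at h2
      exact h1.trans h2.symm
  have hoo : ∀ x ∈ P.gens, ∀ y ∈ ({Q.e, Q.e'} : Set R), x * (P.G * y) = P.G * y * x := by
    intro x hx y hy
    rcases hx with hx | hx
    · rw [mul_assoc, ← neg_eq_iff_eq_neg.mpr (h.odd x hx y hy), mul_neg, ← mul_assoc, ← mul_assoc, hodd x hx, neg_mul,
        neg_neg]
    · rw [mul_assoc, ← h.even_left x hx y (Or.inl hy), ← mul_assoc, ← mul_assoc, hG x hx]
  intro x hx y hy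
  rcases hy with (rfl | rfl) | hy
  · exact hoo x hx _ (by simp)
  · exact hoo x hx _ (by simp)
  · exact h.even_right x hx y hy

end Twist

end Plane

/-! ### Transfer of the relations to supercommuting planes. -/

namespace Plane

variable {R : Type*} [Ring R] [Algebra ℂ R] {P Q : Plane R}

section

variable (h : SuperCommute P Q)

theorem twisted_D : h.twisted.D = P.G * Q.D := by
  have h1 := h.G_comm Q.q (by simp [gens, evenGens])
  have h2 := h.G_comm Q.q' (by simp [gens, evenGens])
  simp only [D, SuperCommute.twisted, twist, mul_add, mul_smul_comm, ← mul_assoc, h1, h2]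

theorem twisted_X : h.twisted.X = P.G * Q.X := by
  have h1 := h.G_comm Q.p (by simp [gens, evenGens])
  have h2 := h.G_comm Q.p' (by simp [gens, evenGens])
  simp only [X, SuperCommute.twisted, twist, mul_add, mul_smul_comm, ← mul_assoc, h1, h2]

theorem twisted_G : h.twisted.G = Q.G := by
  change (2⁻¹ : ℂ) • (P.G * Q.e' * (P.G * Q.e)) - 1 = _
  rw [mul_mul_of_involution P.relations.G_G (h.G_comm Q.e' (by simp [gens]))]
  rfl

theorem SuperCommute.G_comm_D (h : SuperCommute P Q) : P.G * Q.D = Q.D * P.G := by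
  have h1 := h.G_comm Q.q (by simp [gens, evenGens])
  have h2 := h.G_comm Q.q' (by simp [gens, evenGens])
  have h3 := h.G_comm Q.e (by simp [gens, evenGens])
  have h4 := h.G_comm Q.e' (by simp [gens, evenGens])
  simp only [D, mul_smul_comm, smul_mul_assoc, mul_add, add_mul, ← mul_assoc, h1, h2]
  simp only [mul_assoc, h3, h4]

theorem SuperCommute.G_comm_X (h : SuperCommute P Q) : P.G * Q.X = Q.X * P.G := by
  have h1 := h.G_comm Q.p (by simp [gens, evenGens])
  have h2 := h.G_comm Q.p' (by simp [gens, evenGens])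
  have h3 := h.G_comm Q.e (by simp [gens, evenGens])
  have h4 := h.G_comm Q.e' (by simp [gens, evenGens])
  simp only [X, mul_smul_comm, smul_mul_assoc, mul_add, add_mul, ← mul_assoc, h1, h2]
  simp only [mul_assoc, h3, h4]

/-- `S` is even in the Clifford letters, so the two factors `P.G` cancel; odd elements such as `D`,
`X` and `o` keep one. -/
theorem twisted_S : h.twisted.S = Q.S := by
  simp only [S, twisted_D, twisted_X, mul_mul_of_involution P.relations.G_G h.G_comm_D,
    mul_mul_of_involution P.relations.G_G h.G_comm_X]

theorem twisted_o : h.twisted.o = P.G * Q.o := by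
  have h1 := h.G_comm Q.K (by simp [gens, evenGens])
  have h2 := h.G_comm Q.psi (by simp [gens, evenGens])
  simp only [o, SuperCommute.twisted, twist, mul_add, mul_smul_comm, ← mul_assoc, h1, h2]

theorem twisted_swap_o : h.twisted.swap.o = P.G * Q.swap.o := by
  have h1 := h.G_comm Q.K (by simp [gens, evenGens])
  have h2 := h.G_comm Q.psi' (by simp [gens, evenGens])
  simp only [o, SuperCommute.twisted, twist, swap, mul_add, mul_smul_comm, ← mul_assoc, h1, h2]

/-- The subalgebra of the elements that commute with the twisted second plane. -/
def leftAlg : Subalgebra ℂ R := Subalgebra.centralizer ℂ h.twisted.gens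

/-- The subalgebra of the elements that commute with `leftAlg`. -/
def rightAlg : Subalgebra ℂ R := Subalgebra.centralizer ℂ (leftAlg h : Set R)

theorem gens_le_left : P.gens ⊆ leftAlg h := fun x hx =>
  (Subalgebra.mem_centralizer_iff ℂ).mpr fun y hy => (h.twisted_comm x hx y hy).symm

/-- A set lies in its double centraliser. Choosing both subalgebras as centralisers makes them
commute by construction, which is all that `tensorMap` needs. -/
theorem gens_le_right : h.twisted.gens ⊆ rightAlg h := fun x hx =>
  (Subalgebra.mem_centralizer_iff ℂ).mpr fun _ hy => ((Subalgebra.mem_centralizer_iff ℂ).mp hy x hx).symm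

/-- The map from the tensor product of the two commuting subalgebras. -/
def tensorMap : leftAlg h ⊗[ℂ] rightAlg h →ₐ[ℂ] R :=
  Algebra.TensorProduct.lift (leftAlg h).val (rightAlg h).val fun x y =>
    (Subalgebra.mem_centralizer_iff ℂ).mp y.2 x x.2

theorem tensorMap_tmul (x : leftAlg h) (y : rightAlg h) : tensorMap h (x ⊗ₜ y) = (x : R) * (y : R) :=
  Algebra.TensorProduct.lift_tmul _ _ _ _ _

/-- The first plane in `leftAlg`. -/
def leftPlane : Plane (leftAlg h) := P.restrict _ (gens_le_left h)

/-- The twisted second plane in `rightAlg`. -/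
def rightPlane : Plane (rightAlg h) := h.twisted.restrict _ (gens_le_right h)

theorem rightPlane_D : ((rightPlane h).D : R) = P.G * Q.D := twisted_D h
theorem rightPlane_X : ((rightPlane h).X : R) = P.G * Q.X := twisted_X h
theorem rightPlane_G : ((rightPlane h).G : R) = Q.G := twisted_G h
theorem rightPlane_S : ((rightPlane h).S : R) = Q.S := twisted_S h
theorem rightPlane_o : ((rightPlane h).o : R) = P.G * Q.o := twisted_o h
theorem rightPlane_swap_o : ((rightPlane h).swap.o : R) = P.G * Q.swap.o := twisted_swap_o h
theorem rightPlane_e : ((rightPlane h).e : R) = P.G * Q.e := rfl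
theorem rightPlane_e' : ((rightPlane h).e' : R) = P.G * Q.e' := rfl
theorem rightPlane_p : ((rightPlane h).p : R) = Q.p := rfl
theorem rightPlane_p' : ((rightPlane h).p' : R) = Q.p' := rfl
theorem rightPlane_q : ((rightPlane h).q : R) = Q.q := rfl
theorem rightPlane_q' : ((rightPlane h).q' : R) = Q.q' := rfl
theorem leftPlane_D : ((leftPlane h).D : R) = P.D := rfl
theorem leftPlane_X : ((leftPlane h).X : R) = P.X := rfl
theorem leftPlane_G : ((leftPlane h).G : R) = P.G := rfl
theorem leftPlane_S : ((leftPlane h).S : R) = P.S := rfl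
theorem leftPlane_o : ((leftPlane h).o : R) = P.o := rfl
theorem leftPlane_swap_o : ((leftPlane h).swap.o : R) = P.swap.o := rfl
theorem leftPlane_e : ((leftPlane h).e : R) = P.e := rfl
theorem leftPlane_e' : ((leftPlane h).e' : R) = P.e' := rfl
theorem leftPlane_p : ((leftPlane h).p : R) = P.p := rfl
theorem leftPlane_p' : ((leftPlane h).p' : R) = P.p' := rfl
theorem leftPlane_q : ((leftPlane h).q : R) = P.q := rfl
theorem leftPlane_q' : ((leftPlane h).q' : R) = P.q' := rfl

theorem mul_oddSym_factor (x : leftAlg h) (y : rightAlg h) : (x : R) * (y : R) = y * x :=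
  (Subalgebra.mem_centralizer_iff ℂ).mp y.2 x x.2

/-- The map `tensorMap` carries the tensor identities to these: every factor `P.G` introduced by the
twist meets one that was put into `tS`, `tC₁`, `tA`, ..., or is absorbed through `P.G² = 1` and `P.e
* P.G = P.e`. -/
theorem symRelations (h : SuperCommute P Q) : SymRelations P Q := by
  have t := twoPlaneRelations (leftPlane h) (rightPlane h)
  have GG := P.relations.G_G
  have DG := anticomm_symm P.relations.G_D
  have XG := anticomm_symm P.relations.G_X
  have oG := anticomm_symm P.relations.G_o
  have eG := P.relations.e_G
  have Ge := P.relations.G_e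
  have oG' : P.swap.o * P.G = -(P.G * P.swap.o) := by
    have := anticomm_symm P.swap.relations.G_o
    rwa [swap_G, mul_neg, neg_mul, neg_inj] at this
  have eG' : P.e' * P.G = -P.e' := by
    have := P.swap.relations.e_G
    rw [swap_G, mul_neg] at this
    exact neg_eq_iff_eq_neg.mp this
  have Ge' : P.G * P.e' = P.e' := by
    have := P.swap.relations.G_e
    rwa [swap_G, neg_mul, neg_inj] at this
  have Gp' : P.swap.p * P.G = P.G * P.swap.p := by
    have := P.swap.relations.p_G
    rwa [swap_G, mul_neg, neg_mul, neg_inj] at this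
  have oo : P.G * Q.swap.o * (P.G * Q.o) = Q.swap.o * Q.o := by
    have h1 := h.G_comm Q.K (by simp [gens, evenGens])
    have h2 := h.G_comm Q.psi' (by simp [gens, evenGens])
    have h3 := h.G_comm Q.e (by simp [gens, evenGens])
    have h4 := h.G_comm Q.e' (by simp [gens, evenGens])
    refine mul_mul_of_involution GG ?_
    simp only [o, swap, mul_smul_comm, smul_mul_assoc, mul_add, add_mul, ← mul_assoc, h1, h2]
    simp only [mul_assoc, h3, h4]
  have oo' : P.G * (Q.swap.o * (P.G * Q.o)) = Q.swap.o * Q.o := by rw [← mul_assoc, oo]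
  have H1 : tensorMap h (tH₁ (leftPlane h)) = eta P := by
    simp only [tH₁, eta, map_neg, tensorMap_tmul, MulMemClass.coe_mul, leftPlane_S, leftPlane_G, OneMemClass.coe_one,
      mul_one]
  have H2 : tensorMap h (tH₂ (rightPlane h)) = eta Q := by
    simp only [tH₂, eta, map_neg, tensorMap_tmul, MulMemClass.coe_mul, rightPlane_S, rightPlane_G, OneMemClass.coe_one,
      one_mul]
  have HS : tensorMap h (tS (leftPlane h) (rightPlane h)) = totalS P Q := by
    simp only [tS, totalS, map_add, map_sub, map_smul, tensorMap_tmul, MulMemClass.coe_mul, leftPlane_S, leftPlane_D,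
      leftPlane_X, leftPlane_G, rightPlane_S, rightPlane_D, rightPlane_X, OneMemClass.coe_one, one_mul, mul_one,
      mul_assoc, assoc_rule GG]
  have HZ : tensorMap h (tZ (leftPlane h) (rightPlane h)) = totalZ P Q := by
    simp only [tZ, totalZ, map_neg, map_mul, HS, tensorMap_tmul, leftPlane_G, rightPlane_G]
  have HC : tensorMap h (tC₂ (leftPlane h) (rightPlane h)) = oddSym P Q := by
    simp only [tC₂, oddSym, map_add, map_sub, map_smul, tensorMap_tmul, MulMemClass.coe_mul, leftPlane_S, leftPlane_D,
      leftPlane_X, leftPlane_G, rightPlane_e, rightPlane_p, rightPlane_q, rightPlane_o, OneMemClass.coe_one, one_mul,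
      AddMemClass.coe_add, SetLike.val_smul]
  have HC' : tensorMap h (tC₂' (leftPlane h) (rightPlane h)) = oddSym P Q.swap := by
    simp only [tC₂', oddSym, map_add, map_sub, map_smul, tensorMap_tmul, MulMemClass.coe_mul, leftPlane_S, leftPlane_D,
      leftPlane_X, leftPlane_G, rightPlane_e', rightPlane_p', rightPlane_q', rightPlane_swap_o, OneMemClass.coe_one,
      one_mul, AddMemClass.coe_add, SetLike.val_smul]
    rfl
  have HA : tensorMap h (tA (leftPlane h) (rightPlane h)) = evenSym P Q := by
    simp only [tA, evenSym, map_add, map_sub, map_smul, tensorMap_tmul, MulMemClass.coe_mul,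
      leftPlane_G, rightPlane_e, rightPlane_p, rightPlane_q, rightPlane_o, leftPlane_e, leftPlane_p, leftPlane_q,
      leftPlane_o, mul_assoc, assoc_rule GG, assoc_rule eG, one_mul]
  have HA' : tensorMap h (tA' (leftPlane h) (rightPlane h)) = evenSym P.swap Q.swap := by
    simp only [tA', evenSym, map_add, map_sub, map_smul, tensorMap_tmul, MulMemClass.coe_mul,
      leftPlane_G, rightPlane_e', rightPlane_p', rightPlane_q', rightPlane_swap_o, leftPlane_e', leftPlane_p',
      leftPlane_q', leftPlane_swap_o, mul_assoc, assoc_rule GG, assoc_rule eG', one_mul]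
    simp only [swap, neg_mul, smul_neg, sub_neg_eq_add]
  -- The tensor map writes first-plane factors on the left, while `oddSym Q P` has the second plane
  -- on the left; the order is reversed by commutation of the two subalgebras.
  have HC1 : tensorMap h (tC₁ (leftPlane h) (rightPlane h)) = oddSym Q P := by
    have c1 := mul_oddSym_factor h (leftPlane h).e (((rightPlane h).S + (2⁻¹ : ℂ) • 1) * (rightPlane h).G)
    have c2 := mul_oddSym_factor h (leftPlane h).p ((rightPlane h).D * (rightPlane h).G)
    have c3 := mul_oddSym_factor h (leftPlane h).q ((rightPlane h).X * (rightPlane h).G)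
    have c4 := mul_oddSym_factor h (leftPlane h).o (rightPlane h).G
    simp only [MulMemClass.coe_mul, AddMemClass.coe_add, SetLike.val_smul, OneMemClass.coe_one, leftPlane_e,
      leftPlane_p, leftPlane_q, leftPlane_o, rightPlane_S, rightPlane_G, rightPlane_D, rightPlane_X] at c1 c2 c3 c4
    simp only [tC₁, oddSym, map_add, map_sub, map_smul, tensorMap_tmul, MulMemClass.coe_mul, AddMemClass.coe_add,
      SetLike.val_smul, OneMemClass.coe_one, leftPlane_e, leftPlane_p, leftPlane_q, leftPlane_o, leftPlane_G,
      rightPlane_S, rightPlane_G, rightPlane_D, rightPlane_X]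
    have hp : P.p * P.G * (P.G * Q.D * Q.G) = Q.D * Q.G * P.p := by
      rw [P.relations.p_G, mul_assoc P.G, c2]
      simp only [mul_assoc, assoc_rule GG, one_mul]
    have hq : P.G * P.q * (P.G * Q.X * Q.G) = Q.X * Q.G * P.q := by
      rw [mul_assoc P.G, c3]
      simp only [mul_assoc, assoc_rule GG, one_mul]
    rw [c1, c4, ← hp, ← hq]
    simp only [mul_assoc]
  constructor
  · simpa only [map_sub, map_mul, map_add, map_smul, H2, HC, HZ, H1, tensorMap_tmul, leftPlane_G, rightPlane_o,
      assoc_rule GG, one_mul] using congrArg (tensorMap h) t.H_C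
  · simpa only [map_sub, map_mul, map_add, map_smul, map_one, H2, HC, HC', HZ, H1, tensorMap_tmul, rightPlane_o,
      rightPlane_swap_o, MulMemClass.coe_mul, OneMemClass.coe_one, one_mul, oo] using congrArg (tensorMap h) t.C_C
  · simpa only [map_sub, map_mul, map_add, map_smul, HA, HC, H1, tensorMap_tmul, leftPlane_G, leftPlane_o,
      rightPlane_o, MulMemClass.coe_mul, OneMemClass.coe_one, mul_one, mul_assoc, assoc_rule GG, one_mul]
      using congrArg (tensorMap h) t.H_A
  · simpa only [map_sub, map_mul, map_add, map_smul, HA, HC, HC1, H1, H2, HZ, tensorMap_tmul, leftPlane_G, leftPlane_o,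
      rightPlane_o, MulMemClass.coe_mul, mul_assoc, assoc_rule GG, one_mul]
      using congrArg (tensorMap h) t.C₁_C₂
  · simpa only [map_sub, map_mul, map_add, map_smul, map_one, HA, HA', HC, HC1, H1, H2, HZ, tensorMap_tmul, leftPlane_G,
      leftPlane_o, leftPlane_swap_o, rightPlane_swap_o,
      rightPlane_o, MulMemClass.coe_mul, OneMemClass.coe_one, mul_one, mul_assoc, assoc_rule GG, one_mul, oo']
      using congrArg (tensorMap h) t.A_A

end

end Plane

/-! ### The projection to the symmetries, evaluated on Clifford elements. -/

namespace Plane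

variable {R : Type*} [Ring R] [Algebra ℂ R] {P Q : Plane R}

/-- The symmetry attached to an element `c` of the Clifford algebra with image `c'` under the grading
automorphism, for a Dunkl–Dirac operator `D` and a vector variable `X`. -/
def symmetrize (D X c c' : R) : R :=
  (-2⁻¹ : ℂ) • (c - (2⁻¹ : ℂ) • (D * X * c - D * c' * X + X * c' * D - c * X * D))

/-- `D` and `X` are sums of an even generator times an odd one, hence odd themselves. -/
theorem anticomm_of_odd {P Q : Plane R} (h : SuperCommute P Q) :
    ∀ x ∈ ({P.e, P.e', P.D, P.X} : Set R), ∀ y ∈ ({Q.e, Q.e', Q.D, Q.X} : Set R), y * x = -(x * y) := by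
  have key : ∀ x ∈ ({P.e, P.e'} : Set R), ∀ y ∈ ({Q.e, Q.e', Q.D, Q.X} : Set R), y * x = -(x * y) := by
    intro x hx y hy
    have h1 := anticomm_symm (h.odd x hx _ (Or.inl rfl))
    have h2 := anticomm_symm (h.odd x hx Q.e' (by simp))
    have h3 := h.even_right x (Or.inl hx) Q.p (by simp [evenGens])
    have h4 := h.even_right x (Or.inl hx) Q.p' (by simp [evenGens])
    have h5 := h.even_right x (Or.inl hx) Q.q (by simp [evenGens])
    have h6 := h.even_right x (Or.inl hx) Q.q' (by simp [evenGens])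
    rcases hy with rfl | rfl | rfl | rfl
    · exact h1
    · exact h2
    · simp only [D, smul_mul_assoc, mul_smul_comm, add_mul, mul_add, mul_assoc, h1, h2, assoc_rule h5, assoc_rule h6]
      simp only [mul_neg, mul_assoc, smul_add, smul_neg, neg_add]
    · simp only [X, smul_mul_assoc, mul_smul_comm, add_mul, mul_add, mul_assoc, h1, h2, assoc_rule h3, assoc_rule h4]
      simp only [mul_neg, mul_assoc, smul_add, smul_neg, neg_add]
  have key' : ∀ x ∈ P.evenGens, ∀ y ∈ ({Q.e, Q.e', Q.D, Q.X} : Set R), y * x = x * y := by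
    intro x hx y hy
    have h1 := h.even_left x hx Q.e (by simp [gens])
    have h2 := h.even_left x hx Q.e' (by simp [gens])
    have h3 := h.even_left x hx Q.p (by simp [gens, evenGens])
    have h4 := h.even_left x hx Q.p' (by simp [gens, evenGens])
    have h5 := h.even_left x hx Q.q (by simp [gens, evenGens])
    have h6 := h.even_left x hx Q.q' (by simp [gens, evenGens])
    rcases hy with rfl | rfl | rfl | rfl
    · exact h1.symm
    · exact h2.symm
    · simp only [D, smul_mul_assoc, mul_smul_comm, add_mul, mul_add, mul_assoc, ← h1, ← h2, assoc_rule h5, assoc_rule h6]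
    · simp only [X, smul_mul_assoc, mul_smul_comm, add_mul, mul_add, mul_assoc, ← h1, ← h2, assoc_rule h3, assoc_rule h4]
  intro x hx y hy
  have h1 := key P.e (by simp) y hy
  have h2 := key P.e' (by simp) y hy
  have h3 := key' P.p (by simp [evenGens]) y hy
  have h4 := key' P.p' (by simp [evenGens]) y hy
  have h5 := key' P.q (by simp [evenGens]) y hy
  have h6 := key' P.q' (by simp [evenGens]) y hy
  rcases hx with rfl | rfl | rfl | rfl
  · exact h1
  · exact h2
  · simp only [D, smul_mul_assoc, mul_smul_comm, add_mul, mul_add, mul_assoc, assoc_rule h5, assoc_rule h6, h1, h2, mul_neg,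
      smul_neg, smul_add, neg_add]
  · simp only [X, smul_mul_assoc, mul_smul_comm, add_mul, mul_add, mul_assoc, assoc_rule h3, assoc_rule h4, h1, h2, mul_neg,
      smul_neg, smul_add, neg_add]

theorem comm_of_even {P Q : Plane R} (h : SuperCommute P Q) :
    ∀ x ∈ ({P.e, P.p, P.q, P.D, P.X, P.G} : Set R), ∀ y ∈ ({Q.p, Q.q, Q.G} : Set R), y * x = x * y := by
  have key : ∀ y ∈ ({Q.p, Q.q, Q.G} : Set R), ∀ x ∈ P.gens, y * x = x * y := by
    rintro y (rfl | rfl | rfl) x hx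
    · exact (h.even_right x hx _ (by simp [evenGens])).symm
    · exact (h.even_right x hx _ (by simp [evenGens])).symm
    · exact h.symm.G_comm x hx
  intro x hx y hy
  have h1 := key y hy P.e (by simp [gens])
  have h2 := key y hy P.e' (by simp [gens])
  have h3 := key y hy P.p (by simp [gens, evenGens])
  have h4 := key y hy P.p' (by simp [gens, evenGens])
  have h5 := key y hy P.q (by simp [gens, evenGens])
  have h6 := key y hy P.q' (by simp [gens, evenGens])
  rcases hx with rfl | rfl | rfl | rfl | rfl | rfl
  · exact h1
  · exact h3
  · exact h5
  · simp only [D, smul_mul_assoc, mul_smul_comm, add_mul, mul_add, mul_assoc, assoc_rule h5, assoc_rule h6, h1, h2]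
  · simp only [X, smul_mul_assoc, mul_smul_comm, add_mul, mul_add, mul_assoc, assoc_rule h3, assoc_rule h4, h1, h2]
  · simp only [G, smul_mul_assoc, mul_smul_comm, sub_mul, mul_sub, mul_assoc, assoc_rule h2, h1, one_mul, mul_one]

-- With the Dirac operator and vector variable split as sums over the two planes, all letters of `P`
-- are moved to the left of those of `Q`, and each side is then normalised inside its own plane. The
-- first five identities evaluate the projection on z, on the area elements, on z times an area
-- element and on z ∧ w.
set_option maxHeartbeats 1000000 in
theorem symmetrize_relations (h : SuperCommute P Q) :
    symmetrize (P.D + Q.D) (P.X + Q.X) Q.e (-Q.e) = Q.o ∧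
    symmetrize (P.D + Q.D) (P.X + Q.X) (-P.G) (-P.G) = eta P ∧
    symmetrize (P.D + Q.D) (P.X + Q.X) (P.G * Q.e) (-(P.G * Q.e)) = oddSym P Q ∧
    symmetrize (P.D + Q.D) (P.X + Q.X) (P.e * Q.e) (P.e * Q.e) = evenSym P Q ∧
    symmetrize (P.D + Q.D) (P.X + Q.X) (-(P.G * Q.G)) (-(P.G * Q.G)) = totalZ P Q ∧
    eta P * eta Q = eta Q * eta P ∧ eta P * oddSym P Q = oddSym P Q * eta P := by
  have k := P.relations
  have l := Q.relations
  have ks := P.scasimirRelations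
  have ls := Q.scasimirRelations
  have ho := anticomm_of_odd h
  have he := comm_of_even h
  have he' := comm_of_even h.symm
  have o1 := ho P.e (by simp) Q.e (by simp)
  have o2 := ho P.e (by simp) Q.D (by simp)
  have o3 := ho P.e (by simp) Q.X (by simp)
  have o4 := ho P.D (by simp) Q.e (by simp)
  have o5 := ho P.D (by simp) Q.D (by simp)
  have o6 := ho P.D (by simp) Q.X (by simp)
  have o7 := ho P.X (by simp) Q.e (by simp)
  have o8 := ho P.X (by simp) Q.D (by simp)
  have o9 := ho P.X (by simp) Q.X (by simp)
  have a1 := he P.e (by simp) Q.p (by simp)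
  have a2 := he P.D (by simp) Q.p (by simp)
  have a3 := he P.X (by simp) Q.p (by simp)
  have a4 := he P.e (by simp) Q.q (by simp)
  have a5 := he P.D (by simp) Q.q (by simp)
  have a6 := he P.X (by simp) Q.q (by simp)
  have a7 := he P.e (by simp) Q.G (by simp)
  have a8 := he P.D (by simp) Q.G (by simp)
  have a9 := he P.X (by simp) Q.G (by simp)
  have a10 := he P.G (by simp) Q.G (by simp)
  have a11 := he P.G (by simp) Q.p (by simp)
  have a12 := he P.G (by simp) Q.q (by simp)
  have b1 := (he' Q.e (by simp) P.p (by simp)).symm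
  have b2 := (he' Q.D (by simp) P.p (by simp)).symm
  have b3 := (he' Q.X (by simp) P.p (by simp)).symm
  have b4 := (he' Q.e (by simp) P.q (by simp)).symm
  have b5 := (he' Q.D (by simp) P.q (by simp)).symm
  have b6 := (he' Q.X (by simp) P.q (by simp)).symm
  have b7 := (he' Q.e (by simp) P.G (by simp)).symm
  have b8 := (he' Q.D (by simp) P.G (by simp)).symm
  have b9 := (he' Q.X (by simp) P.G (by simp)).symm
  have kDG := anticomm_symm k.G_D
  have kXG := anticomm_symm k.G_X
  have lDG := anticomm_symm l.G_D
  have lXG := anticomm_symm l.G_X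
  -- `Q.S` is quadratic in `Q.D` and `Q.X`, so a common sign in the commutation with both
  -- disappears.
  have hS : ∀ x : R, (Q.D * x = x * Q.D ∧ Q.X * x = x * Q.X ∨ Q.D * x = -(x * Q.D) ∧ Q.X * x = -(x * Q.X)) →
      Q.S * x = x * Q.S := by
    rintro x (⟨h1, h2⟩ | ⟨h1, h2⟩) <;>
    simp only [S, smul_mul_assoc, mul_smul_comm, sub_mul, mul_sub, mul_assoc, one_mul, mul_one, h1, h2,
      mul_neg, neg_neg, assoc_rule h1, assoc_rule h2, neg_mul]
  have c1 := hS P.G (Or.inl ⟨b8, b9⟩)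
  have c2 := hS P.e (Or.inr ⟨o2, o3⟩)
  have c3 := hS P.D (Or.inr ⟨o5, o6⟩)
  have c4 := hS P.X (Or.inr ⟨o8, o9⟩)
  have c5 : Q.S * P.S = P.S * Q.S := by
    rw [show P.S = (2⁻¹ : ℂ) • (P.D * P.X - P.X * P.D - 1) from rfl]
    simp only [smul_mul_assoc, mul_smul_comm, sub_mul, mul_sub, mul_assoc, one_mul, mul_one, c3, c4, assoc_rule c3,
      assoc_rule c4]
  have c6 : Q.G * P.S = P.S * Q.G := by
    rw [show P.S = (2⁻¹ : ℂ) • (P.D * P.X - P.X * P.D - 1) from rfl]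
    simp only [smul_mul_assoc, mul_smul_comm, sub_mul, mul_sub, mul_assoc, one_mul, mul_one, a8, a9, assoc_rule a8,
      assoc_rule a9]
  have d1 : Q.e * P.S = P.S * Q.e := by
    simp only [S, smul_mul_assoc, mul_smul_comm, sub_mul, mul_sub, mul_assoc, one_mul, mul_one, o4, o7, mul_neg,
      neg_neg, neg_mul, assoc_rule o4, assoc_rule o7]
  have d2 : Q.p * P.S = P.S * Q.p := by
    simp only [S, smul_mul_assoc, mul_smul_comm, sub_mul, mul_sub, mul_assoc, one_mul, mul_one, a2, a3,
      assoc_rule a2, assoc_rule a3]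
  have d3 : Q.q * P.S = P.S * Q.q := by
    simp only [S, smul_mul_assoc, mul_smul_comm, sub_mul, mul_sub, mul_assoc, one_mul, mul_one, a5, a6,
      assoc_rule a5, assoc_rule a6]
  have d4 : Q.o * P.G = P.G * Q.o := by
    have h1 := h.G_comm Q.K (by simp [gens, evenGens])
    have h2 := h.G_comm Q.psi (by simp [gens, evenGens])
    have h3 := h.G_comm Q.e' (by simp [gens, evenGens])
    simp only [o, mul_smul_comm, smul_mul_assoc, mul_add, add_mul, mul_assoc, b7, ← h3, assoc_rule h1, assoc_rule h2]
  have hodd : ∀ x ∈ ({P.D, P.X} : Set R), Q.o * x = -(x * Q.o) := by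
    intro x hx
    have hx' : ∀ y ∈ ({Q.K, Q.psi} : Set R), y * x = x * y := by
      intro y hy
      have hy' : y ∈ Q.evenGens := by
        rcases hy with rfl | rfl <;> simp [evenGens]
      have h1 := h.even_right P.e (by simp [gens]) y hy'
      have h2 := h.even_right P.e' (by simp [gens]) y hy'
      have h3 := h.even_right P.p (by simp [gens, evenGens]) y hy'
      have h4 := h.even_right P.p' (by simp [gens, evenGens]) y hy'
      have h5 := h.even_right P.q (by simp [gens, evenGens]) y hy'
      have h6 := h.even_right P.q' (by simp [gens, evenGens]) y hy'
      rcases hx with rfl | rfl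
      · simp only [D, mul_smul_comm, smul_mul_assoc, mul_add, add_mul, mul_assoc, h1, h2, assoc_rule h5.symm, assoc_rule h6.symm]
      · simp only [X, mul_smul_comm, smul_mul_assoc, mul_add, add_mul, mul_assoc, h1, h2, assoc_rule h3.symm, assoc_rule h4.symm]
    have h1 := hx' Q.K (by simp)
    have h2 := hx' Q.psi (by simp)
    have h3 := ho x (by rcases hx with rfl | rfl <;> simp) Q.e (by simp)
    have h4 := ho x (by rcases hx with rfl | rfl <;> simp) Q.e' (by simp)
    simp only [o, mul_smul_comm, smul_mul_assoc, mul_add, add_mul, mul_assoc, h3, h4, mul_neg, assoc_rule h1, assoc_rule h2,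
      smul_neg, neg_add]
  have d5 := hodd P.D (by simp)
  have d6 := hodd P.X (by simp)
  have d7 : Q.o * P.S = P.S * Q.o := by
    simp only [S, smul_mul_assoc, mul_smul_comm, sub_mul, mul_sub, mul_assoc, one_mul, mul_one, d5, d6, mul_neg,
      neg_neg, neg_mul, assoc_rule d5, assoc_rule d6]
  refine ⟨?_, ?_, ?_, ?_, ?_, ?_, ?_⟩
  all_goals
    simp only [symmetrize, eta, oddSym, evenSym, totalZ, totalS, mul_add, add_mul, sub_mul, mul_sub, neg_mul, mul_neg, neg_neg,
      smul_mul_assoc, mul_smul_comm, mul_assoc, mul_one, one_mul, smul_add, smul_sub, smul_neg, smul_smul,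
      o1, o2, o3, o4, o5, o6, o7, o8, o9, a1, a2, a3, a4, a5, a6, a7, a8, a9, a10, b1, b2, b3, b4, b5, b6, b7, b8, b9,
      assoc_rule o1, assoc_rule o2, assoc_rule o3, assoc_rule o4, assoc_rule o5, assoc_rule o6, assoc_rule o7,
      assoc_rule o8, assoc_rule o9, assoc_rule a1, assoc_rule a2, assoc_rule a3, assoc_rule a4, assoc_rule a5,
      assoc_rule a6, assoc_rule a7, assoc_rule a8, assoc_rule a9, assoc_rule a10, assoc_rule b1, assoc_rule b2, assoc_rule b3,
      assoc_rule b4, assoc_rule b5, assoc_rule b6, assoc_rule b7, assoc_rule b8, assoc_rule b9,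
      c1, c2, c3, c4, c5, c6, a11, a12, assoc_rule a11, assoc_rule a12, d1, d2, d3, d4, d7, assoc_rule d1, assoc_rule d2, assoc_rule d3, assoc_rule d4, assoc_rule d7, assoc_rule c1, assoc_rule c2, assoc_rule c3, assoc_rule c4, assoc_rule c5, assoc_rule c6,
      kDG, kXG, lDG, lXG, assoc_rule kDG, assoc_rule kXG, assoc_rule lDG, assoc_rule lXG,
      k.e_D, k.e_X, k.p_D, k.q_X, k.p_X, k.q_D, k.G_G, ks.G_S, ks.D_X, ks.D_S, ks.X_S,
      l.e_D, l.e_X, l.p_D, l.q_X, l.p_X, l.q_D, l.G_G, ls.G_S, ls.D_X, ls.D_S, ls.X_S,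
      assoc_rule k.e_D, assoc_rule k.e_X, assoc_rule k.p_D, assoc_rule k.q_X, assoc_rule k.p_X, assoc_rule k.q_D,
      assoc_rule k.G_G, assoc_rule ks.G_S, assoc_rule ks.D_X, assoc_rule ks.D_S, assoc_rule ks.X_S,
      assoc_rule l.e_D, assoc_rule l.e_X, assoc_rule l.p_D, assoc_rule l.q_X, assoc_rule l.p_X, assoc_rule l.q_D,
      assoc_rule l.G_G, assoc_rule ls.G_S, assoc_rule ls.D_X, assoc_rule ls.D_S, assoc_rule ls.X_S]
    try module

end Plane

/-! ### Isotropic vectors, roots and reflections. -/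

theorem form_zvec_root (m : Fin 2 → ℕ) (a b : Fin 2) (ε : ℤˣ) (p : ℕ) :
    form (zvec a ε) (root m b p) = if a = b then
      (Real.sin (p * Real.pi / m b) : ℂ) - ((ε : ℤ) : ℂ) * Complex.I * (Real.cos (p * Real.pi / m b) : ℂ) else 0 := by
  simp only [zvec, root, map_add, map_sub, map_smul, LinearMap.add_apply, LinearMap.smul_apply, form_basisVec,
    Prod.mk.injEq, zero_ne_one, one_ne_zero, and_true, and_false, if_false, smul_eq_mul]
  split_ifs <;> ring

theorem form_zvec_root_ne (m : Fin 2 → ℕ) {a b : Fin 2} (h : a ≠ b) (ε : ℤˣ) (p : ℕ) :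
    form (zvec a ε) (root m b p) = 0 := by
  rw [form_zvec_root, if_neg h]

/-- This is sin² + cos² = 1. It is the reason why the sum called `K` in a plane is simply ∑ κ(α)
s_α, and it cancels the scalars that reflections produce. -/
theorem form_zvec_root_mul (m : Fin 2 → ℕ) (a : Fin 2) (ε : ℤˣ) (p : ℕ) :
    form (zvec a ε) (root m a p) * form (zvec a (-ε)) (root m a p) = 1 := by
  have h : (Real.sin (p * Real.pi / m a) : ℂ) ^ 2 + (Real.cos (p * Real.pi / m a) : ℂ) ^ 2 = 1 := by
    exact_mod_cast Real.sin_sq_add_cos_sq (p * Real.pi / m a)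
  rw [form_zvec_root, form_zvec_root, if_pos rfl, if_pos rfl, ← h]
  rcases Int.units_eq_one_or ε with rfl | rfl <;> push_cast <;> ring_nf <;> rw [Complex.I_sq] <;> ring

theorem two_smul_root (m : Fin 2 → ℕ) (a : Fin 2) (ε : ℤˣ) (p : ℕ) :
    (2 : ℂ) • root m a p = form (zvec a (-ε)) (root m a p) • zvec a ε
      + form (zvec a ε) (root m a p) • zvec a (-ε) := by
  rw [form_zvec_root, form_zvec_root, if_pos rfl, if_pos rfl, root, zvec, zvec]
  rcases Int.units_eq_one_or ε with rfl | rfl <;> push_cast <;> match_scalars <;> ring_nf <;> rw [Complex.I_sq] <;> ring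

theorem form_zvec_zvec (a b : Fin 2) (ε δ : ℤˣ) :
    form (zvec a ε) (zvec b δ) = if a = b then 1 - ((ε : ℤ) : ℂ) * ((δ : ℤ) : ℂ) else 0 := by
  simp only [zvec, map_add, map_sub, map_smul, LinearMap.add_apply, LinearMap.smul_apply, form_basisVec,
    Prod.mk.injEq, zero_ne_one, one_ne_zero, and_true, and_false, if_false, smul_eq_mul]
  split_ifs <;> ring_nf
  rw [Complex.I_sq]; ring

theorem form_zvec_self (a : Fin 2) (ε : ℤˣ) : form (zvec a ε) (zvec a ε) = 0 := by
  rw [form_zvec_zvec, if_pos rfl]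
  rcases Int.units_eq_one_or ε with rfl | rfl <;> norm_num

theorem form_zvec_neg (a : Fin 2) (ε : ℤˣ) : form (zvec a ε) (zvec a (-ε)) = 2 := by
  rw [form_zvec_zvec, if_pos rfl]
  rcases Int.units_eq_one_or ε with rfl | rfl <;> norm_num

theorem refl_apply (m : Fin 2 → ℕ) (a : Fin 2) (p : ℕ) (x : V) :
    refl m a p x = x - (2 * form x (root m a p)) • root m a p := by
  rw [refl, Module.reflection_apply, LinearMap.smul_apply, form_symm, smul_eq_mul]

theorem refl_of_form_eq_zero (m : Fin 2 → ℕ) {a : Fin 2} {p : ℕ} {x : V} (h : form x (root m a p) = 0) :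
    refl m a p x = x := by
  rw [refl_apply, h, mul_zero, zero_smul, sub_zero]

/-- Expanding the root in the isotropic basis, the coefficient of z^ε cancels by
`form_zvec_root_mul`: a reflection interchanges the two isotropic lines. -/
theorem refl_zvec (m : Fin 2 → ℕ) (a : Fin 2) (ε : ℤˣ) (p : ℕ) :
    refl m a p (zvec a ε) = -(form (zvec a ε) (root m a p) ^ 2) • zvec a (-ε) := by
  rw [refl_apply, mul_comm, mul_smul, two_smul_root m a ε, smul_add, smul_smul, smul_smul, form_zvec_root_mul]
  module

theorem refl_zvec_ne (m : Fin 2 → ℕ) {a b : Fin 2} (h : a ≠ b) (ε : ℤˣ) (p : ℕ) :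
    refl m b p (zvec a ε) = zvec a ε :=
  refl_of_form_eq_zero m (form_zvec_root_ne m h ε p)

/-- Anticommutation in the Clifford algebra. -/
theorem gam_swap (x y : V) : gam x * gam y = (2 * form x y) • (1 : Cl) - gam y * gam x := by
  rw [eq_sub_iff_add_eq, CliffordAlgebra.ι_mul_ι_add_swap, Algebra.algebraMap_eq_smul_one]
  congr 1
  simp only [QuadraticMap.polar, LinearMap.BilinMap.toQuadraticMap_apply, map_add, LinearMap.add_apply]
  rw [form_symm y]
  ring

theorem gam_zvec_ne {a b : Fin 2} (h : a ≠ b) (ε δ : ℤˣ) :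
    gam (zvec a ε) * gam (zvec b δ) = -(gam (zvec b δ) * gam (zvec a ε)) := by
  rw [gam_swap, form_zvec_zvec, if_neg h, mul_zero, zero_smul, zero_sub]

/-! ### The two planes inside `H_κ ⊗ 𝒞`. -/

section Planes

variable (m : Fin 2 → ℕ) (κ : V → ℂ)

theorem hw_reflW_hx (a : Fin 2) (p : ℕ) (x : V) :
    hw m κ (reflW m a p) * hx m κ x = hx m κ (refl m a p x) * hw m κ (reflW m a p) :=
  hw_hx m κ _ x

theorem hw_reflW_hxi (a : Fin 2) (p : ℕ) (x : V) :
    hw m κ (reflW m a p) * hxi m κ (form x) = hxi m κ (form (refl m a p x)) * hw m κ (reflW m a p) := by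
  rw [hw_hxi, ← form_comp_refl]
  rfl

theorem reflW_comm {a b : Fin 2} (h : a ≠ b) (p q : ℕ) :
    reflW m a p * reflW m b q = reflW m b q * reflW m a p := by
  have hr : form (root m a p) (root m b q) = 0 := by
    have := two_smul_root m a 1 p
    have h2 : (2 : ℂ) * form (root m a p) (root m b q) = 0 := by
      rw [← smul_eq_mul, ← LinearMap.smul_apply, ← map_smul, this]
      simp only [map_add, map_smul, LinearMap.add_apply, LinearMap.smul_apply, form_zvec_root_ne m h, smul_zero, add_zero]
    exact (mul_eq_zero.mp h2).resolve_left two_ne_zero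
  refine Subtype.ext (LinearEquiv.ext fun x => ?_)
  change refl m a p (refl m b q x) = refl m b q (refl m a p x)
  have hr' := hr
  rw [form_symm] at hr'
  simp only [refl_apply, map_sub, map_smul, LinearMap.sub_apply, LinearMap.smul_apply, hr, hr', smul_zero, sub_zero, mul_zero]
  module

/-- The sum `∑ κ(α) (x, α) (y, α) s_α` over the positive roots. -/
def reflSum (x y : V) : Cherednik m κ :=
  ∑ a : Fin 2, ∑ p ∈ Finset.Icc 1 (m a),
    (κ (root m a p) * form x (root m a p) * form y (root m a p)) • hw m κ (reflW m a p)

theorem hxi_form_hx (x y : V) :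
    hxi m κ (form x) * hx m κ y = hx m κ y * hxi m κ (form x) + (form x y) • 1 + (2 : ℂ) • reflSum m κ x y := by
  rw [add_assoc, ← sub_eq_iff_eq_add', hxi_hx, Algebra.algebraMap_eq_smul_one, reflSum, Finset.smul_sum]
  congr 1
  refine Finset.sum_congr rfl fun a _ => ?_
  rw [Finset.smul_sum]
  refine Finset.sum_congr rfl fun p _ => ?_
  rw [smul_smul, mul_assoc, mul_assoc, mul_assoc]

theorem reflSum_mul {x y x' y' : V} {u u' : Cherednik m κ} (c : ℂ)
    (h : ∀ a p, (form x (root m a p) * form y (root m a p)) • (hw m κ (reflW m a p) * u)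
      = (c * (form x' (root m a p) * form y' (root m a p))) • (u' * hw m κ (reflW m a p))) :
    reflSum m κ x y * u = c • (u' * reflSum m κ x' y') := by
  simp only [reflSum, Finset.sum_mul, Finset.mul_sum, Finset.smul_sum, smul_mul_assoc, mul_smul_comm]
  refine Finset.sum_congr rfl fun a _ => Finset.sum_congr rfl fun p _ => ?_
  rw [mul_assoc, mul_smul, h, smul_smul, smul_smul]
  congr 1
  ring

/-- Moving s_α past z^{-δ} gives z^δ with the factor -(z^{-δ}, α)², which turns the weight (z^δ, α)
of the sum into (z^{-δ}, α). This is the source of all rules for `K`, `psi` and `psi'` in `Plane`.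
-/
theorem reflSum_mul_hx (b : Fin 2) (ε δ : ℤˣ) :
    reflSum m κ (zvec b ε) (zvec b δ) * hx m κ (zvec b (-δ))
      = (-1 : ℂ) • (hx m κ (zvec b δ) * reflSum m κ (zvec b ε) (zvec b (-δ))) := by
  refine reflSum_mul m κ _ fun a p => ?_
  by_cases h : b = a
  · subst h
    have h1 := form_zvec_root_mul m b δ p
    rw [hw_reflW_hx, refl_zvec, neg_neg, map_smul, smul_mul_assoc, smul_smul]
    congr 1
    linear_combination (-form (zvec b ε) (root m b p) * form (zvec b (-δ)) (root m b p)) * h1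
  · rw [form_zvec_root_ne m h]; simp

theorem reflSum_mul_hxi (b : Fin 2) (ε δ : ℤˣ) :
    reflSum m κ (zvec b ε) (zvec b δ) * hxi m κ (form (zvec b (-δ)))
      = (-1 : ℂ) • (hxi m κ (form (zvec b δ)) * reflSum m κ (zvec b ε) (zvec b (-δ))) := by
  refine reflSum_mul m κ _ fun a p => ?_
  by_cases h : b = a
  · subst h
    have h1 := form_zvec_root_mul m b δ p
    rw [hw_reflW_hxi, refl_zvec, neg_neg, map_smul, map_smul, smul_mul_assoc, smul_smul]
    congr 1
    linear_combination (-form (zvec b ε) (root m b p) * form (zvec b (-δ)) (root m b p)) * h1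
  · rw [form_zvec_root_ne m h]; simp

theorem reflSum_comm (x y : V) : reflSum m κ x y = reflSum m κ y x := by
  simp only [reflSum, mul_right_comm]

/-- The plane spanned by `z_b^±`, oriented by the sign `ε`. -/
def planeHC (b : Fin 2) (ε : ℤˣ) : Plane (HC m κ) where
  e := 1 ⊗ₜ gam (zvec b ε)
  e' := 1 ⊗ₜ gam (zvec b (-ε))
  p := hx m κ (zvec b ε) ⊗ₜ 1
  p' := hx m κ (zvec b (-ε)) ⊗ₜ 1
  q := hxi m κ (form (zvec b ε)) ⊗ₜ 1
  q' := hxi m κ (form (zvec b (-ε))) ⊗ₜ 1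
  K := reflSum m κ (zvec b ε) (zvec b (-ε)) ⊗ₜ 1
  psi := (2 : ℂ) • reflSum m κ (zvec b ε) (zvec b ε) ⊗ₜ 1
  psi' := (2 : ℂ) • reflSum m κ (zvec b (-ε)) (zvec b (-ε)) ⊗ₜ 1
  e_e := by
    rw [Algebra.TensorProduct.tmul_mul_tmul, CliffordAlgebra.ι_sq_scalar, LinearMap.BilinMap.toQuadraticMap_apply,
      form_zvec_self, map_zero, TensorProduct.tmul_zero]
  e'_e' := by
    rw [Algebra.TensorProduct.tmul_mul_tmul, CliffordAlgebra.ι_sq_scalar, LinearMap.BilinMap.toQuadraticMap_apply,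
      form_zvec_self, map_zero, TensorProduct.tmul_zero]
  e'_e := by
    rw [Algebra.TensorProduct.tmul_mul_tmul, Algebra.TensorProduct.tmul_mul_tmul, gam_swap, form_symm, form_zvec_neg,
      TensorProduct.tmul_sub, TensorProduct.tmul_smul, Algebra.TensorProduct.one_def, one_mul]
    norm_num
  e_p := by simp only [Algebra.TensorProduct.tmul_mul_tmul, one_mul, mul_one]
  e_p' := by simp only [Algebra.TensorProduct.tmul_mul_tmul, one_mul, mul_one]
  e_q := by simp only [Algebra.TensorProduct.tmul_mul_tmul, one_mul, mul_one]
  e_q' := by simp only [Algebra.TensorProduct.tmul_mul_tmul, one_mul, mul_one]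
  e_K := by simp only [Algebra.TensorProduct.tmul_mul_tmul, one_mul, mul_one]
  e_psi := by simp only [Algebra.TensorProduct.tmul_mul_tmul, one_mul, mul_one, mul_smul_comm, smul_mul_assoc]
  e_psi' := by simp only [Algebra.TensorProduct.tmul_mul_tmul, one_mul, mul_one, mul_smul_comm, smul_mul_assoc]
  e'_p := by simp only [Algebra.TensorProduct.tmul_mul_tmul, one_mul, mul_one]
  e'_p' := by simp only [Algebra.TensorProduct.tmul_mul_tmul, one_mul, mul_one]
  e'_q := by simp only [Algebra.TensorProduct.tmul_mul_tmul, one_mul, mul_one]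
  e'_q' := by simp only [Algebra.TensorProduct.tmul_mul_tmul, one_mul, mul_one]
  e'_K := by simp only [Algebra.TensorProduct.tmul_mul_tmul, one_mul, mul_one]
  e'_psi := by simp only [Algebra.TensorProduct.tmul_mul_tmul, one_mul, mul_one, mul_smul_comm, smul_mul_assoc]
  e'_psi' := by simp only [Algebra.TensorProduct.tmul_mul_tmul, one_mul, mul_one, mul_smul_comm, smul_mul_assoc]
  p'_p := by simp only [Algebra.TensorProduct.tmul_mul_tmul, one_mul, mul_one, hx_comm]
  q'_q := by simp only [Algebra.TensorProduct.tmul_mul_tmul, one_mul, mul_one, hxi_comm]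
  q_p := by
    simp only [Algebra.TensorProduct.tmul_mul_tmul, one_mul, mul_one, hxi_form_hx, form_zvec_self, zero_smul, add_zero,
      TensorProduct.add_tmul, TensorProduct.smul_tmul']
  q'_p' := by
    simp only [Algebra.TensorProduct.tmul_mul_tmul, one_mul, mul_one, hxi_form_hx, form_zvec_self, zero_smul, add_zero,
      TensorProduct.add_tmul, TensorProduct.smul_tmul']
  q_p' := by
    simp only [Algebra.TensorProduct.tmul_mul_tmul, one_mul, mul_one, hxi_form_hx, form_zvec_neg,
      TensorProduct.add_tmul, TensorProduct.smul_tmul', Algebra.TensorProduct.one_def]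
  q'_p := by
    simp only [Algebra.TensorProduct.tmul_mul_tmul, one_mul, mul_one, hxi_form_hx, form_symm (zvec b (-ε)), form_zvec_neg,
      TensorProduct.add_tmul, TensorProduct.smul_tmul', Algebra.TensorProduct.one_def, reflSum_comm m κ (zvec b (-ε))]
  K_p := by
    have h := reflSum_mul_hx m κ b ε (-ε)
    rw [neg_neg] at h
    simp only [Algebra.TensorProduct.tmul_mul_tmul, one_mul, mul_one, h, mul_smul_comm, ← TensorProduct.smul_tmul']
    module
  K_p' := by
    have h := reflSum_mul_hx m κ b (-ε) ε
    simp only [Algebra.TensorProduct.tmul_mul_tmul, one_mul, mul_one, reflSum_comm m κ (zvec b ε) (zvec b (-ε)), h, mul_smul_comm,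
      ← TensorProduct.smul_tmul']
    module
  K_q := by
    have h := reflSum_mul_hxi m κ b ε (-ε)
    rw [neg_neg] at h
    simp only [Algebra.TensorProduct.tmul_mul_tmul, one_mul, mul_one, h, mul_smul_comm, ← TensorProduct.smul_tmul']
    module
  K_q' := by
    have h := reflSum_mul_hxi m κ b (-ε) ε
    simp only [Algebra.TensorProduct.tmul_mul_tmul, one_mul, mul_one, reflSum_comm m κ (zvec b ε) (zvec b (-ε)), h, mul_smul_comm,
      ← TensorProduct.smul_tmul']
    module
  psi_p' := by
    simp only [Algebra.TensorProduct.tmul_mul_tmul, one_mul, mul_one, smul_mul_assoc, reflSum_mul_hx, ← TensorProduct.smul_tmul']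
    module
  psi'_p := by
    have h := reflSum_mul_hx m κ b (-ε) (-ε)
    rw [neg_neg] at h
    simp only [Algebra.TensorProduct.tmul_mul_tmul, one_mul, mul_one, smul_mul_assoc, h, ← TensorProduct.smul_tmul',
      reflSum_comm m κ (zvec b (-ε)) (zvec b ε)]
    module
  psi_q' := by
    simp only [Algebra.TensorProduct.tmul_mul_tmul, one_mul, mul_one, smul_mul_assoc, reflSum_mul_hxi, ← TensorProduct.smul_tmul']
    module
  psi'_q := by
    have h := reflSum_mul_hxi m κ b (-ε) (-ε)
    rw [neg_neg] at h
    simp only [Algebra.TensorProduct.tmul_mul_tmul, one_mul, mul_one, smul_mul_assoc, h, ← TensorProduct.smul_tmul',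
      reflSum_comm m κ (zvec b (-ε)) (zvec b ε)]
    module

theorem planeHC_swap (b : Fin 2) (ε : ℤˣ) : (planeHC m κ b ε).swap = planeHC m κ b (-ε) := by
  simp only [planeHC, Plane.swap, neg_neg, reflSum_comm m κ (zvec b ε) (zvec b (-ε))]

/-- No root has nonzero pairing with both planes, so the commutator of a covector of one plane with
a vector of the other has no reflection terms. -/
theorem reflSum_ne {a b : Fin 2} (h : a ≠ b) (ε δ : ℤˣ) : reflSum m κ (zvec a ε) (zvec b δ) = 0 := by
  refine Finset.sum_eq_zero fun c _ => Finset.sum_eq_zero fun p _ => ?_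
  by_cases hc : a = c
  · rw [form_zvec_root_ne m (show b ≠ c from hc ▸ h.symm), mul_zero, zero_smul]
  · rw [form_zvec_root_ne m hc, mul_zero, zero_mul, zero_smul]

theorem reflSum_commute {b : Fin 2} {ε δ : ℤˣ} {u : Cherednik m κ}
    (hu : ∀ p, hw m κ (reflW m b p) * u = u * hw m κ (reflW m b p)) :
    reflSum m κ (zvec b ε) (zvec b δ) * u = u * reflSum m κ (zvec b ε) (zvec b δ) := by
  refine (reflSum_mul m κ 1 fun a p => ?_).trans (one_smul _ _)
  by_cases h : b = a
  · subst h
    rw [hu, one_mul]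
  · rw [form_zvec_root_ne m h]; simp

theorem reflSum_reflSum {a b : Fin 2} (h : a ≠ b) (ε δ ε' δ' : ℤˣ) :
    reflSum m κ (zvec a ε) (zvec a δ) * reflSum m κ (zvec b ε') (zvec b δ')
      = reflSum m κ (zvec b ε') (zvec b δ') * reflSum m κ (zvec a ε) (zvec a δ) := by
  refine reflSum_commute m κ fun p => (reflSum_commute m κ fun q => ?_).symm
  rw [← map_mul, ← map_mul, reflW_comm m h]

theorem reflSum_hx {a b : Fin 2} (h : a ≠ b) (ε δ ε' : ℤˣ) :
    reflSum m κ (zvec a ε) (zvec a δ) * hx m κ (zvec b ε')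
      = hx m κ (zvec b ε') * reflSum m κ (zvec a ε) (zvec a δ) :=
  reflSum_commute m κ fun p => by rw [hw_reflW_hx, refl_zvec_ne m h.symm]

theorem reflSum_hxi {a b : Fin 2} (h : a ≠ b) (ε δ ε' : ℤˣ) :
    reflSum m κ (zvec a ε) (zvec a δ) * hxi m κ (form (zvec b ε'))
      = hxi m κ (form (zvec b ε')) * reflSum m κ (zvec a ε) (zvec a δ) :=
  reflSum_commute m κ fun p => by rw [hw_reflW_hxi, refl_zvec_ne m h.symm]

theorem hxi_hx_ne {a b : Fin 2} (h : a ≠ b) (ε δ : ℤˣ) :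
    hxi m κ (form (zvec a ε)) * hx m κ (zvec b δ) = hx m κ (zvec b δ) * hxi m κ (form (zvec a ε)) := by
  rw [hxi_form_hx, reflSum_ne m κ h, form_zvec_zvec, if_neg h, zero_smul, smul_zero, add_zero, add_zero]

theorem planeHC_superCommute {a b : Fin 2} (h : a ≠ b) (ε δ : ℤˣ) :
    (planeHC m κ a ε).SuperCommute (planeHC m κ b δ) := by
  have key : ∀ x ∈ (planeHC m κ a ε).evenGens, ∀ y ∈ (planeHC m κ b δ).evenGens, x * y = y * x := by
    rintro x (rfl | rfl | rfl | rfl | rfl | rfl | rfl) y (rfl | rfl | rfl | rfl | rfl | rfl | rfl)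
    all_goals
      simp only [planeHC, Algebra.TensorProduct.tmul_mul_tmul, one_mul, mul_one, smul_mul_assoc, mul_smul_comm,
        hxi_hx_ne m κ h, hxi_hx_ne m κ h.symm, reflSum_hx m κ h, reflSum_hx m κ h.symm, reflSum_hxi m κ h,
        reflSum_hxi m κ h.symm, reflSum_reflSum m κ h, hx_comm, hxi_comm]
  have heven : ∀ (c : Fin 2) (ζ : ℤˣ), ∀ x ∈ (planeHC m κ c ζ).evenGens, ∃ u : Cherednik m κ, x = u ⊗ₜ 1 := by
    rintro c ζ x (rfl | rfl | rfl | rfl | rfl | rfl | rfl)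
    all_goals exact ⟨_, rfl⟩
  have hodd : ∀ (c : Fin 2) (ζ : ℤˣ), ∀ x ∈ ({(planeHC m κ c ζ).e, (planeHC m κ c ζ).e'} : Set (HC m κ)),
      ∃ η : ℤˣ, x = 1 ⊗ₜ gam (zvec c η) := by
    rintro c ζ x (rfl | rfl)
    all_goals exact ⟨_, rfl⟩
  refine ⟨fun x hx y hy => ?_, fun x hx y hy => ?_, fun x hx y hy => ?_⟩
  · obtain ⟨η, rfl⟩ := hodd _ _ x hx
    obtain ⟨η', rfl⟩ := hodd _ _ y hy
    rw [Algebra.TensorProduct.tmul_mul_tmul, Algebra.TensorProduct.tmul_mul_tmul, gam_zvec_ne h, TensorProduct.tmul_neg]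
  · rcases hy with hy | hy
    · obtain ⟨u, rfl⟩ := heven _ _ x hx
      obtain ⟨η', rfl⟩ := hodd _ _ y hy
      simp only [Algebra.TensorProduct.tmul_mul_tmul, one_mul, mul_one]
    · exact key x hx y hy
  · rcases hx with hx | hx
    · obtain ⟨u, rfl⟩ := heven _ _ y hy
      obtain ⟨η', rfl⟩ := hodd _ _ x hx
      simp only [Algebra.TensorProduct.tmul_mul_tmul, one_mul, mul_one]
    · exact key x hx y hy

/-- A sum over an isotropic basis of a plane. -/
theorem sum_plane {N : Type*} [AddCommGroup N] [Module ℂ N] (B : V →ₗ[ℂ] V →ₗ[ℂ] N) (b : Fin 2) (ε : ℤˣ) :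
    (2⁻¹ : ℂ) • (B (zvec b ε) (zvec b (-ε)) + B (zvec b (-ε)) (zvec b ε))
      = B (basisVec (b, 0)) (basisVec (b, 0)) + B (basisVec (b, 1)) (basisVec (b, 1)) := by
  have hI : ((ε : ℤ) : ℂ) * Complex.I * (((ε : ℤ) : ℂ) * Complex.I) = -1 := by
    rcases Int.units_eq_one_or ε with rfl | rfl <;> simp
  have hm : (((-ε : ℤˣ) : ℤ) : ℂ) = -((ε : ℤ) : ℂ) := by push_cast; ring
  simp only [zvec, map_add, map_smul, LinearMap.add_apply, LinearMap.smul_apply, smul_add, smul_smul, hm]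
  match_scalars <;> first | ring1 | linear_combination (-1 : ℂ) * hI

theorem dirac_eq (ε δ : ℤˣ) : dirac m κ = (planeHC m κ 0 ε).D + (planeHC m κ 1 δ).D := by
  have h := sum_plane (N := HC m κ) ((TensorProduct.mk ℂ (Cherednik m κ) Cl).compl₁₂ (hxi m κ ∘ₗ form) gam)
  simp only [LinearMap.compl₁₂_apply, LinearMap.comp_apply, TensorProduct.mk_apply] at h
  simp only [dirac, Plane.D, planeHC, Algebra.TensorProduct.tmul_mul_tmul, one_mul, mul_one, h, Fintype.sum_prod_type,
    Fin.sum_univ_two]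

theorem xvar_eq (ε δ : ℤˣ) : xvar m κ = (planeHC m κ 0 ε).X + (planeHC m κ 1 δ).X := by
  have h := sum_plane (N := HC m κ) ((TensorProduct.mk ℂ (Cherednik m κ) Cl).compl₁₂ (hx m κ) gam)
  simp only [LinearMap.compl₁₂_apply, TensorProduct.mk_apply] at h
  simp only [xvar, Plane.X, planeHC, Algebra.TensorProduct.tmul_mul_tmul, one_mul, mul_one, h, Fintype.sum_prod_type,
    Fin.sum_univ_two]

/-- The symmetry attached to an element of the Clifford algebra. -/
def opP : Cl →ₗ[ℂ] TAMA m κ where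
  toFun c := ⟨(-2⁻¹ : ℂ) • projP m κ (1 ⊗ₜ c), (TAMA m κ).smul_mem (projP_cl_mem m κ _) _⟩
  map_add' c d := Subtype.ext <| by
    simp only [projP_eq, TensorProduct.tmul_add, map_add, mul_add, add_mul, AddMemClass.coe_add]
    module
  map_smul' t c := Subtype.ext <| by
    simp only [projP_eq, TensorProduct.tmul_smul, map_smul, mul_smul_comm, smul_mul_assoc, RingHom.id_apply,
      SetLike.val_smul]
    module

theorem O_eq {p : ℕ} (v : Fin p → V) : O m κ v = opP m κ (quant v) := rfl

theorem coe_opP (c : Cl) : (opP m κ c : HC m κ) = Plane.symmetrize (dirac m κ) (xvar m κ) (1 ⊗ₜ c)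
    (1 ⊗ₜ CliffordAlgebra.involute c) := by
  change (-2⁻¹ : ℂ) • projP m κ (1 ⊗ₜ c) = _
  rw [projP_eq, grading_tmul, Plane.symmetrize]

/-- An element s̃_α is odd and lies in `TAMA`, so it anticommutes with the Dirac operator and with
the vector variable. Conjugation by it therefore passes through the projection and acts on the
Clifford argument only. -/
theorem sTilde_mul_opP {a : Fin 2} {p : ℕ} {c d : Cl} (h : gam (root m a p) * c = d * gam (root m a p)) :
    sTilde m κ a p * opP m κ c = opP m κ d * sTilde m κ a p := by
  have hs := (mem_TAMA m κ).mp (sTilde m κ a p).2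
  have hg : grading m κ (sTilde m κ a p : HC m κ) = -(sTilde m κ a p : HC m κ) := by
    change grading m κ (_ ⊗ₜ _) = -(_ ⊗ₜ _)
    rw [grading_tmul, CliffordAlgebra.involute_ι, TensorProduct.tmul_neg]
  rw [hg, mul_neg, mul_neg] at hs
  have h1 : (sTilde m κ a p : HC m κ) * (1 ⊗ₜ c) = 1 ⊗ₜ d * (sTilde m κ a p : HC m κ) := by
    change _ ⊗ₜ _ * _ = _ * _ ⊗ₜ _
    rw [Algebra.TensorProduct.tmul_mul_tmul, Algebra.TensorProduct.tmul_mul_tmul, h, one_mul, mul_one]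
  have h2 : (sTilde m κ a p : HC m κ) * (1 ⊗ₜ CliffordAlgebra.involute c)
      = 1 ⊗ₜ CliffordAlgebra.involute d * (sTilde m κ a p : HC m κ) := by
    have h' := congrArg CliffordAlgebra.involute h
    rw [map_mul, map_mul, CliffordAlgebra.involute_ι, neg_mul, mul_neg, neg_inj] at h'
    change _ ⊗ₜ _ * _ = _ * _ ⊗ₜ _
    rw [Algebra.TensorProduct.tmul_mul_tmul, Algebra.TensorProduct.tmul_mul_tmul, h', one_mul, mul_one]
  refine Subtype.ext ?_
  rw [MulMemClass.coe_mul, MulMemClass.coe_mul, coe_opP, coe_opP]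
  simp only [Plane.symmetrize, mul_smul_comm, smul_mul_assoc, mul_sub, sub_mul, mul_add, add_mul, mul_assoc, hs.1, hs.2,
    h1, h2, mul_neg, neg_neg, neg_mul, Plane.assoc_rule hs.1, Plane.assoc_rule hs.2, Plane.assoc_rule h1, Plane.assoc_rule h2]

end Planes

/-! ### Antisymmetrised Clifford products. -/

section Quantization

/-- Peeling off the image of 0 turns a sum over permutations into nested finite sums that `simp` can
expand. -/
theorem sum_perm_succ {N : Type*} [AddCommMonoid N] {n : ℕ} (f : Equiv.Perm (Fin (n + 1)) → N) :
    ∑ g, f g = ∑ p : Fin (n + 1), ∑ e : Equiv.Perm (Fin n), f (Equiv.Perm.decomposeFin.symm (p, e)) := by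
  rw [← Fintype.sum_prod_type', ← Equiv.sum_comp Equiv.Perm.decomposeFin.symm]

theorem quant_two (x y : V) : quant ![x, y] = (2⁻¹ : ℂ) • (gam x * gam y - gam y * gam x) := by
  simp [quant, sum_perm_succ, Fin.sum_univ_succ, List.ofFn_succ, Equiv.Perm.decomposeFin_symm_apply_zero, Equiv.swap_apply_def,
    Equiv.Perm.decomposeFin.symm_sign, sub_eq_add_neg]

/-- Only the first vector is required to be orthogonal to the others: z and z̄ pair nontrivially,
and their antisymmetrisation stays visible as a commutator. -/
theorem quant_three {x y z : V} (hxy : form x y = 0) (hxz : form x z = 0) :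
    quant ![x, y, z] = (2⁻¹ : ℂ) • (gam x * (gam y * gam z - gam z * gam y)) := by
  have h1 : gam y * gam x = -(gam x * gam y) := by rw [gam_swap, form_symm, hxy]; simp
  have h2 : gam z * gam x = -(gam x * gam z) := by rw [gam_swap, form_symm, hxz]; simp
  simp only [quant, sum_perm_succ, List.ofFn_succ, Equiv.Perm.decomposeFin_symm_apply_zero,
    Equiv.Perm.decomposeFin_symm_apply_succ, Equiv.Perm.decomposeFin.symm_sign]
  simp [Fin.sum_univ_succ, Equiv.swap_apply_def, Nat.factorial, h1, h2, Plane.assoc_rule h1, Plane.assoc_rule h2, mul_sub, mul_assoc]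
  module

theorem quant_four {x y z w : V} (hxy : form x y = 0) (hxz : form x z = 0) (hxw : form x w = 0) (hyz : form y z = 0)
    (hyw : form y w = 0) (hzw : form z w = 0) :
    quant ![x, y, z, w] = gam x * gam y * (gam z * gam w) := by
  have h1 : gam y * gam x = -(gam x * gam y) := by rw [gam_swap, form_symm, hxy]; simp
  have h2 : gam z * gam x = -(gam x * gam z) := by rw [gam_swap, form_symm, hxz]; simp
  have h3 : gam w * gam x = -(gam x * gam w) := by rw [gam_swap, form_symm, hxw]; simp
  have h4 : gam z * gam y = -(gam y * gam z) := by rw [gam_swap, form_symm, hyz]; simp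
  have h5 : gam w * gam y = -(gam y * gam w) := by rw [gam_swap, form_symm, hyw]; simp
  have h6 : gam w * gam z = -(gam z * gam w) := by rw [gam_swap, form_symm, hzw]; simp
  simp only [quant, sum_perm_succ, List.ofFn_succ, Equiv.Perm.decomposeFin_symm_apply_zero,
    Equiv.Perm.decomposeFin_symm_apply_succ, Equiv.Perm.decomposeFin.symm_sign]
  simp [Fin.sum_univ_succ, Equiv.swap_apply_def, Nat.factorial, h1, h2, h3, h4, h5, h6, Plane.assoc_rule h1, Plane.assoc_rule h2,
    Plane.assoc_rule h3, Plane.assoc_rule h4, Plane.assoc_rule h5, Plane.assoc_rule h6, mul_assoc]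
  module

end Quantization

/-- The area element of a plane, up to a scalar. -/
def area (b : Fin 2) (ε : ℤˣ) : Cl := (2⁻¹ : ℂ) • (gam (zvec b (-ε)) * gam (zvec b ε)) - 1

theorem gam_zvec_neg_mul (b : Fin 2) (ε : ℤˣ) :
    gam (zvec b ε) * gam (zvec b (-ε)) = (4 : ℂ) • 1 - gam (zvec b (-ε)) * gam (zvec b ε) := by
  rw [gam_swap, form_zvec_neg]
  norm_num

theorem area_neg (b : Fin 2) (ε : ℤˣ) : area b (-ε) = -area b ε := by
  simp only [area, neg_neg, gam_zvec_neg_mul]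
  module

theorem area_eq (b : Fin 2) (ε : ℤˣ) : area b ε = ((ε : ℤ) : ℂ) • area b 1 := by
  rcases Int.units_eq_one_or ε with rfl | rfl
  · simp
  · simp [area_neg]

theorem involute_area (b : Fin 2) (ε : ℤˣ) : CliffordAlgebra.involute (area b ε) = area b ε := by
  simp [area]

theorem quant_zvec (b : Fin 2) : quant ![zvec b 1, zvec b (-1)] = (-2 : ℂ) • area b 1 := by
  rw [quant_two, gam_zvec_neg_mul, area]
  module

theorem quant_zvec_three {a b : Fin 2} (h : b ≠ a) (ε : ℤˣ) :
    quant ![zvec b ε, zvec a 1, zvec a (-1)] = (-2 : ℂ) • (gam (zvec b ε) * area a 1) := by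
  rw [quant_three (by rw [form_zvec_zvec, if_neg h]) (by rw [form_zvec_zvec, if_neg h]), gam_zvec_neg_mul, area]
  simp only [mul_sub, mul_one, mul_smul_comm]
  module

theorem gam_mul_area {a : Fin 2} {x : V} (ε : ℤˣ) (h : ∀ δ, form x (zvec a δ) = 0) :
    gam x * area a ε = area a ε * gam x := by
  have h1 : ∀ δ, gam x * gam (zvec a δ) = -(gam (zvec a δ) * gam x) := fun δ => by rw [gam_swap, h]; simp
  simp only [area, mul_sub, sub_mul, mul_smul_comm, smul_mul_assoc, mul_one, one_mul, ← mul_assoc, h1, neg_mul]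
  simp only [mul_assoc, h1, mul_neg, neg_neg]

theorem area_one (b : Fin 2) : area b 1 = Complex.I • (gam (basisVec (b, 0)) * gam (basisVec (b, 1))) := by
  have h1 := gam_mul_add (b, 0) (b, 0)
  have h2 := gam_mul_add (b, 1) (b, 1)
  have h3 := gam_mul_add (b, 1) (b, 0)
  rw [if_pos rfl, Algebra.algebraMap_eq_smul_one] at h1 h2
  rw [if_neg (by simp), map_zero, add_eq_zero_iff_eq_neg] at h3
  have h1' : gam (basisVec (b, 0)) * gam (basisVec (b, 0)) = 1 := by
    have := congrArg (fun u => (2⁻¹ : ℂ) • u) h1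
    simpa only [← two_smul ℂ (_ * _), smul_smul, inv_mul_cancel₀ (two_ne_zero : (2 : ℂ) ≠ 0), one_smul] using this
  have h2' : gam (basisVec (b, 1)) * gam (basisVec (b, 1)) = 1 := by
    have := congrArg (fun u => (2⁻¹ : ℂ) • u) h2
    simpa only [← two_smul ℂ (_ * _), smul_smul, inv_mul_cancel₀ (two_ne_zero : (2 : ℂ) ≠ 0), one_smul] using this
  simp only [area, zvec, map_add, map_smul, add_mul, mul_add, smul_mul_assoc, mul_smul_comm, h1', h2', h3, smul_smul]
  push_cast
  match_scalars <;> ring_nf <;> simp [Complex.I_sq]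

theorem quant_basis : quant ![basisVec (0, 0), basisVec (0, 1), basisVec (1, 0), basisVec (1, 1)]
    = -(area 0 1 * area 1 1) := by
  rw [quant_four, area_one, area_one, smul_mul_smul_comm, Complex.I_mul_I, neg_smul, one_smul, neg_neg]
  all_goals rw [form_basisVec, if_neg (by simp)]

/-! ### The symmetries of the statement expressed through planes. -/

section Symmetries

variable (m : Fin 2 → ℕ) (κ : V → ℂ)

/-- The symmetry `O(z_b^ε)`. -/
def oOp (b : Fin 2) (ε : ℤˣ) : TAMA m κ := opP m κ (gam (zvec b ε))

/-- The symmetry `O(z_b^ε ∧ z_a ∧ z̄_a)`, up to a scalar, where `a` is the other plane. -/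
def cOp (b : Fin 2) (ε : ℤˣ) : TAMA m κ := opP m κ (area (1 - b) ε * gam (zvec b ε))

/-- The symmetry `O(z_1^ε ∧ z_2^ε)`. -/
def aOp (ε : ℤˣ) : TAMA m κ := opP m κ (gam (zvec 0 ε) * gam (zvec 1 ε))

theorem H_eq (b : Fin 2) (ε : ℤˣ) : ((ε : ℤ) : ℂ) • H m κ b = opP m κ (-area b ε) := by
  rw [H, O_eq, quant_zvec, area_eq b ε, map_smul, map_neg, map_smul]
  module

theorem Z_eq (ε : ℤˣ) : Z m κ = opP m κ (-(area 0 ε * area 1 ε)) := by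
  rw [Z, O_eq, quant_basis]
  rcases Int.units_eq_one_or ε with rfl | rfl
  · rfl
  · rw [area_neg, area_neg, neg_mul_neg]

theorem sub_ne (b : Fin 2) : b ≠ 1 - b := by fin_cases b <;> decide

/-- The quantisation of z_a ∧ z̄_a is -2 times the area element of orientation +1; orienting it by ε
instead contributes the sign. -/
theorem ladderOdd_eq (b : Fin 2) (ε : ℤˣ) :
    ladderOdd m κ b ε = (-2 * ((ε : ℤ) : ℂ)) • acomm m κ (H m κ b) (cOp m κ b ε) := by
  have h : ((ε : ℤ) : ℂ) * ((ε : ℤ) : ℂ) = 1 := by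
    rcases Int.units_eq_one_or ε with rfl | rfl <;> simp
  have h2 : O m κ ![zvec b ε, zvec (1 - b) 1, zvec (1 - b) (-1)] = (-2 * ((ε : ℤ) : ℂ)) • cOp m κ b ε := by
    rw [O_eq, quant_zvec_three (sub_ne b), cOp, area_eq _ ε, map_smul, smul_mul_assoc, map_smul, smul_smul, mul_assoc, h,
      mul_one, gam_mul_area _ fun δ => by rw [form_zvec_zvec, if_neg (sub_ne b)]]
  rw [ladderOdd, h2, acomm, acomm, mul_smul_comm, smul_mul_assoc, smul_add]

theorem O_zvec_zvec (ε : ℤˣ) : O m κ ![zvec 0 ε, zvec 1 ε] = aOp m κ ε := by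
  rw [O_eq, quant_two, gam_zvec_ne (show (0 : Fin 2) ≠ 1 by decide), aOp, gam_zvec_ne (show (0 : Fin 2) ≠ 1 by decide)]
  congr 1
  module

theorem tmul_area (b : Fin 2) (ε : ℤˣ) : (1 ⊗ₜ area b ε : HC m κ) = (planeHC m κ b ε).G := by
  simp only [area, Plane.G, planeHC, Algebra.TensorProduct.tmul_mul_tmul, one_mul, TensorProduct.tmul_sub,
    TensorProduct.tmul_smul, Algebra.TensorProduct.one_def]

theorem tmul_gam (b : Fin 2) (ε : ℤˣ) : (1 ⊗ₜ gam (zvec b ε) : HC m κ) = (planeHC m κ b ε).e := rfl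

theorem tmul_mul (c d : Cl) : (1 ⊗ₜ (c * d) : HC m κ) = 1 ⊗ₜ c * 1 ⊗ₜ d := by
  rw [Algebra.TensorProduct.tmul_mul_tmul, one_mul]

theorem dirac_eq' {a b : Fin 2} (h : a ≠ b) (ε δ : ℤˣ) : dirac m κ = (planeHC m κ a ε).D + (planeHC m κ b δ).D := by
  fin_cases a <;> fin_cases b
  · exact absurd rfl h
  · exact dirac_eq m κ ε δ
  · rw [add_comm]; exact dirac_eq m κ δ ε
  · exact absurd rfl h

theorem xvar_eq' {a b : Fin 2} (h : a ≠ b) (ε δ : ℤˣ) : xvar m κ = (planeHC m κ a ε).X + (planeHC m κ b δ).X := by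
  fin_cases a <;> fin_cases b
  · exact absurd rfl h
  · exact xvar_eq m κ ε δ
  · rw [add_comm]; exact xvar_eq m κ δ ε
  · exact absurd rfl h

variable {a b : Fin 2} (ε δ : ℤˣ)

theorem coe_oOp : (oOp m κ b ε : HC m κ) = (planeHC m κ b ε).o := by
  rw [oOp, coe_opP, CliffordAlgebra.involute_ι, TensorProduct.tmul_neg, dirac_eq' m κ (sub_ne b).symm ε ε,
    xvar_eq' m κ (sub_ne b).symm ε ε, tmul_gam]
  exact (Plane.symmetrize_relations (planeHC_superCommute m κ (sub_ne b).symm ε ε)).1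

theorem coe_H : ((((ε : ℤ) : ℂ) • H m κ b : TAMA m κ) : HC m κ) = (planeHC m κ b ε).eta := by
  rw [H_eq, coe_opP, map_neg, involute_area, TensorProduct.tmul_neg, dirac_eq' m κ (sub_ne b) ε ε,
    xvar_eq' m κ (sub_ne b) ε ε, tmul_area]
  exact (Plane.symmetrize_relations (planeHC_superCommute m κ (sub_ne b) ε ε)).2.1

theorem coe_opP_area_gam (h : a ≠ b) : (opP m κ (area a ε * gam (zvec b δ)) : HC m κ)
    = (planeHC m κ a ε).oddSym (planeHC m κ b δ) := by
  rw [coe_opP, map_mul, involute_area, CliffordAlgebra.involute_ι, mul_neg, TensorProduct.tmul_neg, tmul_mul, tmul_gam,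
    dirac_eq' m κ h ε δ, xvar_eq' m κ h ε δ, tmul_area]
  exact (Plane.symmetrize_relations (planeHC_superCommute m κ h ε δ)).2.2.1

theorem coe_opP_gam_gam (h : a ≠ b) : (opP m κ (gam (zvec a ε) * gam (zvec b δ)) : HC m κ)
    = (planeHC m κ a ε).evenSym (planeHC m κ b δ) := by
  rw [coe_opP, map_mul, CliffordAlgebra.involute_ι, CliffordAlgebra.involute_ι, neg_mul_neg, tmul_mul, tmul_gam, tmul_gam,
    dirac_eq' m κ h ε δ, xvar_eq' m κ h ε δ]
  exact (Plane.symmetrize_relations (planeHC_superCommute m κ h ε δ)).2.2.2.1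

theorem area_comm (a b : Fin 2) (ε δ : ℤˣ) : area a ε * area b δ = area b δ * area a ε := by
  by_cases hab : a = b
  · subst hab
    rw [area_eq a ε, area_eq a δ, smul_mul_smul_comm, smul_mul_smul_comm, mul_comm]
  · have h1 := gam_mul_area (x := zvec a ε) (a := b) δ fun δ => by rw [form_zvec_zvec, if_neg hab]
    have h2 := gam_mul_area (x := zvec a (-ε)) (a := b) δ fun δ => by rw [form_zvec_zvec, if_neg hab]
    rw [area]
    simp only [sub_mul, mul_sub, smul_mul_assoc, mul_smul_comm, mul_assoc, h1, Plane.assoc_rule h2, one_mul, mul_one]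

theorem coe_Z (h : a ≠ b) : (Z m κ : HC m κ) = (planeHC m κ a ε).totalZ (planeHC m κ b ε) := by
  have hZ : Z m κ = opP m κ (-(area a ε * area b ε)) := by
    rw [Z_eq m κ ε]
    fin_cases a <;> fin_cases b
    · exact absurd rfl h
    · rfl
    · rw [area_comm]; rfl
    · exact absurd rfl h
  rw [hZ, coe_opP, map_neg, map_mul, involute_area, involute_area, TensorProduct.tmul_neg, tmul_mul, tmul_area, tmul_area,
    dirac_eq' m κ h ε ε, xvar_eq' m κ h ε ε]
  exact (Plane.symmetrize_relations (planeHC_superCommute m κ h ε ε)).2.2.2.2.1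

end Symmetries

/-! ### Ladder systems and the relations of the ladder operators. -/

/-- The symmetries `H_b`, `Z`, `O(z_b^ε ∧ ⋯)`, `O(z_b^ε)`, `O(z_1^ε ∧ z_2^ε)`, a reflection and a rotation in each
plane, and the relations between them. -/
structure LadderSystem (B : Type*) [Ring B] [Algebra ℂ B] where
  H : Fin 2 → B
  Z : B
  C : Fin 2 → ℤˣ → B
  o : Fin 2 → ℤˣ → B
  A : ℤˣ → B
  s : Fin 2 → B
  r : Fin 2 → B
  zeta : Fin 2 → ℂ
  H_H (a b : Fin 2) : H a * H b = H b * H a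
  H_Z (b : Fin 2) : H b * Z = Z * H b
  r_H (a b : Fin 2) : r a * H b = H b * r a
  r_Z (a : Fin 2) : r a * Z = Z * r a
  r_r (a b : Fin 2) : r a * r b = r b * r a
  C_Z (b : Fin 2) (ε : ℤˣ) : C b ε * Z = -(Z * C b ε)
  o_Z (b : Fin 2) (ε : ℤˣ) : o b ε * Z = -(Z * o b ε)
  s_Z (b : Fin 2) : s b * Z = -(Z * s b)
  A_Z (ε : ℤˣ) : A ε * Z = Z * A ε
  C_H' {a b : Fin 2} (h : a ≠ b) (ε : ℤˣ) : C b ε * H a = H a * C b ε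
  o_H' {a b : Fin 2} (h : a ≠ b) (ε : ℤˣ) : o b ε * H a = H a * o b ε
  s_H' {a b : Fin 2} (h : a ≠ b) : s b * H a = H a * s b
  o_H (b : Fin 2) (ε : ℤˣ) : o b ε * H b = -(H b * o b ε)
  s_H (b : Fin 2) : s b * H b = -(H b * s b)
  C_H {a b : Fin 2} (h : a ≠ b) (ε : ℤˣ) : C b ε * H b = H b * C b ε - ((ε : ℤ) : ℂ) • C b ε
    - (2 * ((ε : ℤ) : ℂ)) • (Z * o b ε) + (2 : ℂ) • (H a * o b ε)
  o_C (b : Fin 2) (ε : ℤˣ) : o b (-ε) * C b ε = -(C b (-ε) * o b ε)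
  C_C {a b : Fin 2} (h : a ≠ b) (ε : ℤˣ) : C b (-ε) * C b ε
    = (((ε : ℤ) : ℂ) • H b + (2⁻¹ : ℂ) • 1) * (((ε : ℤ) : ℂ) • H b + (2⁻¹ : ℂ) • 1)
      - (Z + ((ε : ℤ) : ℂ) • H a) * (Z + ((ε : ℤ) : ℂ) • H a) - o b (-ε) * o b ε
  A_H_zero (ε : ℤˣ) : A ε * H 0 = H 0 * A ε - ((ε : ℤ) : ℂ) • A ε - (2 * ((ε : ℤ) : ℂ)) • (o 0 ε * o 1 ε)
    - (2 * ((ε : ℤ) : ℂ)) • (o 0 ε * C 1 ε)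
  A_H_one (ε : ℤˣ) : A ε * H 1 = H 1 * A ε - ((ε : ℤ) : ℂ) • A ε - (2 * ((ε : ℤ) : ℂ)) • (o 0 ε * o 1 ε)
    + (2 * ((ε : ℤ) : ℂ)) • (o 1 ε * C 0 ε)
  C_C' (ε : ℤˣ) : C 0 ε * C 1 ε = Z * A ε - (2⁻¹ : ℂ) • (A ε - ((ε : ℤ) : ℂ) • (H 0 * A ε + A ε * H 0)
    + ((ε : ℤ) : ℂ) • (H 1 * A ε + A ε * H 1)) - o 0 ε * o 1 ε
  A_A (ε : ℤˣ) : A (-ε) * A ε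
    = (((ε : ℤ) : ℂ) • H 0 + ((ε : ℤ) : ℂ) • H 1 + 1) * (((ε : ℤ) : ℂ) • H 0 + ((ε : ℤ) : ℂ) • H 1 + 1)
      - (Z - (2⁻¹ : ℂ) • 1) * (Z - (2⁻¹ : ℂ) • 1) - (2 : ℂ) • (o 0 (-ε) * o 0 ε) - (2 : ℂ) • (o 1 (-ε) * o 1 ε)
      - (2 : ℂ) • (o 0 (-ε) * C 0 ε) - (2 : ℂ) • (o 1 (-ε) * C 1 ε)
  A_o_o (ε : ℤˣ) : A (-ε) * (o 0 ε * o 1 ε) = o 0 (-ε) * (o 1 (-ε) * A ε)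
  o_o (ε δ : ℤˣ) : o 1 δ * o 0 ε = -(o 0 ε * o 1 δ)
  r_C (b : Fin 2) (ε : ℤˣ) : r b * C b ε = zeta b ^ (2 * (ε : ℤ)) • (C b ε * r b)
  r_C' {a b : Fin 2} (h : a ≠ b) (ε : ℤˣ) : r a * C b ε = C b ε * r a
  r_s (b : Fin 2) : r b * (s b * r b) = s b
  r_s' {a b : Fin 2} (h : a ≠ b) : r a * s b = s b * r a
  s_s (b : Fin 2) : s b * s b = 1

namespace LadderSystem

variable {B : Type*} [Ring B] [Algebra ℂ B] (S : LadderSystem B)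

/-- The odd ladder operators, up to a scalar. -/
def L (b : Fin 2) (ε : ℤˣ) : B := S.H b * S.C b ε + S.C b ε * S.H b

/-- The even ladder operators. -/
def LL (ε : ℤˣ) : B :=
  S.H 0 * (S.H 1 * S.A ε + S.A ε * S.H 1) + (S.H 1 * S.A ε + S.A ε * S.H 1) * S.H 0

theorem L_H' {a b : Fin 2} (h : a ≠ b) (ε : ℤˣ) : S.L b ε * S.H a = S.H a * S.L b ε := by
  simp only [L, add_mul, mul_add, mul_assoc, S.C_H' h, S.H_H b a, Plane.assoc_rule (S.H_H b a), Plane.assoc_rule (S.C_H' h ε)]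

theorem L_Z (b : Fin 2) (ε : ℤˣ) : S.L b ε * S.Z = -(S.Z * S.L b ε) := by
  simp only [L, add_mul, mul_add, mul_assoc, S.C_Z, S.H_Z, mul_neg, Plane.assoc_rule (S.H_Z b),
    Plane.assoc_rule (S.C_Z b ε), neg_mul, neg_add]

theorem r_L (b : Fin 2) (ε : ℤˣ) : S.r b * S.L b ε = S.zeta b ^ (2 * (ε : ℤ)) • (S.L b ε * S.r b) := by
  simp only [L, add_mul, mul_add, mul_assoc, S.r_C, S.r_H, mul_smul_comm, smul_mul_assoc, smul_add,
    Plane.assoc_rule (S.r_H b b), Plane.assoc_rule (S.r_C b ε)]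

theorem r_L' {a b : Fin 2} (h : a ≠ b) (ε : ℤˣ) : S.r a * S.L b ε = S.L b ε * S.r a := by
  simp only [L, add_mul, mul_add, mul_assoc, S.r_C' h, S.r_H, Plane.assoc_rule (S.r_H a b), Plane.assoc_rule (S.r_C' h ε)]

/-- `C b ε` would shift `H b` by ε but for error terms containing `o b ε`. These are left multiples
of `o b ε` by elements commuting with `H b`, and `o b ε` anticommutes with `H b`, so the
anticommutator with `H b` removes them. That is the purpose of the ladder operators. -/
theorem L_H {a b : Fin 2} (h : a ≠ b) (ε : ℤˣ) :
    S.L b ε * S.H b = S.H b * S.L b ε - ((ε : ℤ) : ℂ) • S.L b ε := by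
  simp only [L, add_mul, mul_add, mul_sub, sub_mul, mul_assoc, S.C_H h, S.o_H, S.o_H' h, Plane.assoc_rule (S.H_H b a),
    Plane.assoc_rule (S.C_H h ε), Plane.assoc_rule (S.H_Z b), smul_mul_assoc, mul_smul_comm, mul_neg, S.H_H b a]
  module

-- All `H` and `Z` are moved to the left. The mixed terms in `C` and `o` cancel by `o_C`, the
-- product of the two `C` is given by `C_C`, and the remaining expression in `H`, `Z` and `o b (-ε)
-- * o b ε` factorises.
set_option maxHeartbeats 1000000 in
theorem L_L {a b : Fin 2} (h : a ≠ b) (ε : ℤˣ) : S.L b (-ε) * S.L b ε = (4 : ℂ) •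
    (((((ε : ℤ) : ℂ) • S.H b + (2⁻¹ : ℂ) • 1) * (((ε : ℤ) : ℂ) • S.H b + (2⁻¹ : ℂ) • 1) - S.o b (-ε) * S.o b ε) *
    ((((ε : ℤ) : ℂ) • S.H b + (2⁻¹ : ℂ) • 1) * (((ε : ℤ) : ℂ) • S.H b + (2⁻¹ : ℂ) • 1)
      - (S.Z + ((ε : ℤ) : ℂ) • S.H a) * (S.Z + ((ε : ℤ) : ℂ) • S.H a))) := by
  have h1 := S.C_H h ε
  have h2 := S.C_H h (-ε)
  have h3 := S.C_C h ε
  have h4 := S.o_C b ε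
  have z1 := S.C_Z b ε
  have z2 := S.C_Z b (-ε)
  have z3 := S.o_Z b ε
  have z4 := S.o_Z b (-ε)
  have a1 := S.C_H' h ε
  have a2 := S.C_H' h (-ε)
  have a3 := S.o_H' h ε
  have a4 := S.o_H' h (-ε)
  have o1 := S.o_H b ε
  have o2 := S.o_H b (-ε)
  rcases Int.units_eq_one_or ε with rfl | rfl <;>
  simp only [neg_neg, Units.val_neg, Units.val_one, Int.cast_neg, Int.cast_one, one_smul, neg_smul] at h1 h2 h3 h4 z1 z2 z3 z4 a1 a2 a3 a4 o1 o2 <;>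
  simp only [L, neg_neg, Units.val_neg, Units.val_one, Int.cast_neg, Int.cast_one, one_smul, neg_smul, mul_add, add_mul, mul_sub, sub_mul, mul_assoc, smul_mul_assoc, mul_smul_comm, mul_neg, neg_mul,
    one_mul, mul_one, smul_add, smul_sub, smul_smul, smul_neg,
    h1, h2, h3, h4, z1, z2, z3, z4, a1, a2, a3, a4, o1, o2, S.H_H b a, S.H_Z, Plane.assoc_rule h1, Plane.assoc_rule h2,
    Plane.assoc_rule h3, Plane.assoc_rule h4, Plane.assoc_rule z1, Plane.assoc_rule z2, Plane.assoc_rule z3,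
    Plane.assoc_rule z4, Plane.assoc_rule a1, Plane.assoc_rule a2, Plane.assoc_rule a3, Plane.assoc_rule a4,
    Plane.assoc_rule o1, Plane.assoc_rule o2, Plane.assoc_rule (S.H_H b a), Plane.assoc_rule (S.H_Z a), Plane.assoc_rule (S.H_Z b)] <;>
  module

/-- The product of two lowering operators reduces to the even one. On a vector killed by `L 1 (-1)`
this becomes a linear equation for `LL (-1)`. -/
theorem L_zero_L_one : S.L 0 (-1) * S.L 1 (-1) = S.Z * S.LL (-1) - (2⁻¹ : ℂ) • (S.LL (-1)
    + (S.H 0 * S.LL (-1) + S.LL (-1) * S.H 0) - (S.H 1 * S.LL (-1) + S.LL (-1) * S.H 1)) := by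
  have h01 : (0 : Fin 2) ≠ 1 := by decide
  -- Each `C` commutes with the other plane's `H`, so the product of two anticommutators is the
  -- double anticommutator of the product. The latter kills the term `o 0 (-1) * o 1 (-1)` of
  -- `C_C'`.
  have key : S.L 0 (-1) * S.L 1 (-1)
      = S.H 0 * (S.H 1 * (S.C 0 (-1) * S.C 1 (-1)) + S.C 0 (-1) * S.C 1 (-1) * S.H 1)
        + (S.H 1 * (S.C 0 (-1) * S.C 1 (-1)) + S.C 0 (-1) * S.C 1 (-1) * S.H 1) * S.H 0 := by
    have h : S.C 1 (-1) * (S.H 1 * S.H 0) = S.H 0 * (S.C 1 (-1) * S.H 1) := by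
      rw [S.H_H 1 0, ← mul_assoc, S.C_H' h01, mul_assoc]
    simp only [L, mul_add, add_mul, mul_assoc, h, S.C_H' h01, S.C_H' h01.symm, S.H_H 0 1,
      Plane.assoc_rule (S.C_H' h01 (-1)), Plane.assoc_rule (S.C_H' h01.symm (-1)), Plane.assoc_rule (S.H_H 0 1)]
    abel
  rw [key, S.C_C']
  simp only [LL, Units.val_neg, Units.val_one, Int.cast_neg, Int.cast_one, one_smul, neg_smul, mul_add, add_mul, mul_sub,
    sub_mul, mul_assoc, smul_mul_assoc, mul_smul_comm, mul_neg, neg_mul, smul_add, smul_sub, smul_neg, S.H_H 1 0,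
    Plane.assoc_rule (S.H_H 1 0), Plane.assoc_rule (S.H_Z 0), Plane.assoc_rule (S.H_Z 1), S.o_H, S.o_H' h01, S.o_H' h01.symm,
    Plane.assoc_rule (S.o_H 0 (-1)), Plane.assoc_rule (S.o_H 1 (-1)), Plane.assoc_rule (S.o_H' h01 (-1)),
    Plane.assoc_rule (S.o_H' h01.symm (-1))]
  module

/-- As for the odd operators: the error terms of `A_H_zero` contain `o 0 ε` and vanish under the
anticommutator with `H 0`, those of `A_H_one` contain `o 1 ε` and vanish under that with `H 1`. -/
theorem LL_H (ε : ℤˣ) : S.LL ε * S.H 0 = S.H 0 * S.LL ε - ((ε : ℤ) : ℂ) • S.LL ε ∧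
    S.LL ε * S.H 1 = S.H 1 * S.LL ε - ((ε : ℤ) : ℂ) • S.LL ε ∧ S.LL ε * S.Z = S.Z * S.LL ε := by
  have h01 : (0 : Fin 2) ≠ 1 := by decide
  refine ⟨?_, ?_, ?_⟩
  all_goals
    simp only [LL, mul_add, add_mul, mul_sub, sub_mul, mul_assoc, smul_mul_assoc, mul_smul_comm, mul_neg, neg_mul, smul_add,
      smul_sub, smul_neg, S.A_H_zero, S.A_H_one, S.H_H 1 0, S.H_Z, S.A_Z, Plane.assoc_rule (S.A_Z ε),
      Plane.assoc_rule (S.H_H 1 0), Plane.assoc_rule (S.H_Z 0), Plane.assoc_rule (S.H_Z 1), S.o_H, S.o_H' h01, S.o_H' h01.symm,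
      Plane.assoc_rule (S.o_H 0 ε), Plane.assoc_rule (S.o_H 1 ε), Plane.assoc_rule (S.o_H' h01 ε),
      Plane.assoc_rule (S.o_H' h01.symm ε), S.C_H' h01, S.C_H' h01.symm, Plane.assoc_rule (S.C_H' h01 ε),
      Plane.assoc_rule (S.C_H' h01.symm ε), Plane.assoc_rule (S.A_H_zero ε), Plane.assoc_rule (S.A_H_one ε), S.C_H h01, S.C_H h01.symm,
      Plane.assoc_rule (S.C_H h01 ε), Plane.assoc_rule (S.C_H h01.symm ε), Plane.assoc_rule (S.o_Z 0 ε), Plane.assoc_rule (S.o_Z 1 ε),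
      Plane.assoc_rule (S.o_o ε ε), S.o_o, S.o_Z, S.C_Z]
    try module

end LadderSystem

/-! ### Roots of unity and commutation rules in the Clifford algebra. -/

/-- The root of unity `e^{iπ/m_a}`. -/
def zetaRoot (m : Fin 2 → ℕ) (a : Fin 2) : ℂ := Complex.exp (Complex.I * Real.pi / m a)

theorem zetaRoot_ne_zero (m : Fin 2 → ℕ) (a : Fin 2) : zetaRoot m a ≠ 0 := Complex.exp_ne_zero _

theorem zetaRoot_zpow (m : Fin 2 → ℕ) (a : Fin 2) (n : ℤ) :
    zetaRoot m a ^ n = Complex.exp (n * (Complex.I * Real.pi / m a)) := (Complex.exp_int_mul _ _).symm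

theorem zetaRoot_pow_self {m : Fin 2 → ℕ} {a : Fin 2} (hm : 1 ≤ m a) : zetaRoot m a ^ m a = -1 := by
  have h : (m a : ℂ) ≠ 0 := Nat.cast_ne_zero.mpr (by omega)
  rw [zetaRoot, ← Complex.exp_nat_mul, mul_div_cancel₀ _ h, mul_comm, Complex.exp_pi_mul_I]

/-- Euler's formula turns the pairing with the p-th root into a power of ζ; this makes sums over
roots into discrete Fourier sums. -/
theorem form_zvec_root_eq (m : Fin 2 → ℕ) (a : Fin 2) (ε : ℤˣ) (p : ℕ) :
    form (zvec a ε) (root m a p) = -(((ε : ℤ) : ℂ) * Complex.I) * zetaRoot m a ^ ((ε : ℤ) * p) := by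
  have e : ∀ x : ℂ, Complex.exp (x * Complex.I) = Complex.cos x + Complex.sin x * Complex.I := Complex.exp_mul_I
  have h : (((ε : ℤ) * (p : ℤ) : ℤ) : ℂ) * (Complex.I * Real.pi / m a)
      = (((ε : ℤ) : ℂ) * (p * Real.pi / m a)) * Complex.I := by
    push_cast; ring
  rw [form_zvec_root, if_pos rfl, zetaRoot_zpow, h, e]
  push_cast
  rcases Int.units_eq_one_or ε with rfl | rfl
  · push_cast
    simp only [one_mul]
    linear_combination (Complex.sin (p * Real.pi / m a)) * Complex.I_sq
  · push_cast
    simp only [neg_mul, one_mul, Complex.cos_neg, Complex.sin_neg]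
    linear_combination (Complex.sin (p * Real.pi / m a)) * Complex.I_sq

theorem form_zvec_root_sq (m : Fin 2 → ℕ) (a : Fin 2) (ε : ℤˣ) (p : ℕ) :
    form (zvec a ε) (root m a p) ^ 2 = -zetaRoot m a ^ (2 * ((ε : ℤ) * p)) := by
  rw [form_zvec_root_eq, mul_pow, neg_sq, mul_pow, Complex.I_sq, mul_comm 2, zpow_mul (zetaRoot m a) _ 2]
  rcases Int.units_eq_one_or ε with rfl | rfl <;> norm_num

theorem root_add_self (m : Fin 2 → ℕ) {a : Fin 2} (hm : 1 ≤ m a) (p : ℕ) : root m a (p + m a) = -root m a p := by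
  have h : (m a : ℝ) ≠ 0 := Nat.cast_ne_zero.mpr (by omega)
  have e : ((p + m a : ℕ) : ℝ) * Real.pi / m a = p * Real.pi / m a + Real.pi := by
    push_cast; field_simp
  rw [root, root, e, Real.sin_add_pi, Real.cos_add_pi]
  push_cast
  module

theorem gam_root_sq (m : Fin 2 → ℕ) (a : Fin 2) (p : ℕ) : gam (root m a p) * gam (root m a p) = 1 := by
  rw [CliffordAlgebra.ι_sq_scalar, LinearMap.BilinMap.toQuadraticMap_apply, form_root_root, map_one]

theorem gam_zvec_area (b : Fin 2) (ε δ : ℤˣ) :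
    gam (zvec b δ) * area b ε = -(area b ε * gam (zvec b δ)) := by
  have h : gam (zvec b δ) * area b δ = -(area b δ * gam (zvec b δ)) := by
    have h1 : gam (zvec b δ) * gam (zvec b δ) = 0 := by
      rw [CliffordAlgebra.ι_sq_scalar, LinearMap.BilinMap.toQuadraticMap_apply, form_zvec_self, map_zero]
    simp only [area, mul_sub, sub_mul, mul_smul_comm, smul_mul_assoc, Plane.assoc_rule (gam_zvec_neg_mul b δ), mul_assoc,
      h1, mul_zero, smul_zero, one_mul, mul_one]
    module
  have hd : ((δ : ℤ) : ℂ) * ((δ : ℤ) : ℂ) = 1 := by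
    rcases Int.units_eq_one_or δ with rfl | rfl <;> simp
  have h2 : area b ε = (((ε : ℤ) : ℂ) * ((δ : ℤ) : ℂ)) • area b δ := by
    rw [area_eq b ε, area_eq b δ, smul_smul, mul_assoc, hd, mul_one]
  rw [h2, mul_smul_comm, smul_mul_assoc, h, smul_neg]

theorem gam_root_area (m : Fin 2 → ℕ) (b : Fin 2) (p : ℕ) (ε : ℤˣ) :
    gam (root m b p) * area b ε = -(area b ε * gam (root m b p)) := by
  have h : root m b p = (2⁻¹ : ℂ) • (2 : ℂ) • root m b p := by
    rw [smul_smul, inv_mul_cancel₀ two_ne_zero, one_smul]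
  rw [h, two_smul_root m b 1]
  simp only [map_smul, map_add, smul_mul_assoc, add_mul, mul_add, mul_smul_comm, gam_zvec_area]
  module

theorem gam_root_area_ne (m : Fin 2 → ℕ) {a b : Fin 2} (h : a ≠ b) (p : ℕ) (ε : ℤˣ) :
    gam (root m b p) * area a ε = area a ε * gam (root m b p) :=
  gam_mul_area ε fun δ => by rw [form_symm, form_zvec_root_ne m h]

theorem gam_root_zvec (m : Fin 2 → ℕ) (b : Fin 2) (p : ℕ) (ε : ℤˣ) : gam (root m b p) * gam (zvec b ε)
    = (form (zvec b ε) (root m b p) ^ 2 • gam (zvec b (-ε))) * gam (root m b p) := by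
  rw [gam_root_mul, refl_zvec, map_smul, neg_smul, neg_mul, neg_neg]

theorem gam_root_zvec_ne (m : Fin 2 → ℕ) {a b : Fin 2} (h : a ≠ b) (p : ℕ) (ε : ℤˣ) :
    gam (root m b p) * gam (zvec a ε) = -gam (zvec a ε) * gam (root m b p) := by
  rw [gam_root_mul, refl_zvec_ne m h, neg_mul]

theorem gam_basisVec_area (i : Fin 2 × Fin 2) :
    gam (basisVec i) * area i.1 1 = -(area i.1 1 * gam (basisVec i)) := by
  obtain ⟨b, j⟩ := i
  have h := gam_mul_add (b, 1) (b, 0)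
  rw [if_neg (by simp), map_zero, add_eq_zero_iff_eq_neg] at h
  rw [area_one]
  fin_cases j <;> simp only [mul_smul_comm, smul_mul_assoc, mul_assoc, h, mul_neg, Fin.mk_one, Fin.zero_eta,
    Plane.assoc_rule h, neg_mul, smul_neg, neg_neg, h]

theorem gam_basisVec_area_ne {i : Fin 2 × Fin 2} {a : Fin 2} (h : i.1 ≠ a) :
    gam (basisVec i) * area a 1 = area a 1 * gam (basisVec i) := by
  refine gam_mul_area 1 fun δ => ?_
  rw [form_basis, zvec, Pi.add_apply, Pi.smul_apply, basisVec, basisVec, Pi.single_apply, Pi.single_apply,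
    if_neg fun e => h (by rw [e]), if_neg fun e => h (by rw [e]), smul_zero, add_zero]

/-- In dimension four the volume element anticommutes with every vector, so it implements the
grading automorphism. -/
theorem volume_mul (x : Cl) : area 0 1 * area 1 1 * x = CliffordAlgebra.involute x * (area 0 1 * area 1 1) := by
  induction x using CliffordAlgebra.induction with
  | algebraMap r => rw [AlgHom.commutes, Algebra.commutes]
  | ι v =>
    have h : ∀ i, area 0 1 * area 1 1 * gam (basisVec i) = -(gam (basisVec i) * (area 0 1 * area 1 1)) := by
      rintro ⟨b, j⟩
      have h1 := gam_basisVec_area (b, j)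
      fin_cases b
      · have h2 := gam_basisVec_area_ne (i := (0, j)) (a := 1) (zero_ne_one)
        simp only [Fin.zero_eta] at h1 ⊢
        rw [mul_assoc, ← h2, ← mul_assoc, ← mul_assoc, h1, neg_mul, neg_neg]
      · have h2 := gam_basisVec_area_ne (i := (1, j)) (a := 0) (one_ne_zero)
        simp only [Fin.mk_one] at h1 ⊢
        rw [mul_assoc, eq_neg_iff_add_eq_zero.mpr (by rw [h1]; simp : area 1 1 * gam (basisVec (1, j)) + gam (basisVec (1, j)) * area 1 1 = 0), mul_neg, ← mul_assoc, ← mul_assoc, h2]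
    rw [CliffordAlgebra.involute_ι]
    rw [sum_basis v]
    simp only [map_sum, map_smul, Finset.mul_sum, mul_smul_comm, h, neg_mul, Finset.sum_mul, smul_mul_assoc,
      ← Finset.sum_neg_distrib, smul_neg]
  | mul x y hx hy => rw [← mul_assoc, hx, mul_assoc, hy, ← mul_assoc, map_mul]
  | add x y hx hy => rw [mul_add, hx, hy, map_add, add_mul]

/-! ### Commutation with `Z` and with reflections. -/

section Relations

variable (m : Fin 2 → ℕ) (κ : V → ℂ)

theorem tmul_volume_mul (a : HC m κ) :
    (1 ⊗ₜ (area 0 1 * area 1 1)) * a = grading m κ a * (1 ⊗ₜ (area 0 1 * area 1 1)) := by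
  induction a using TensorProduct.induction_on with
  | zero => simp
  | tmul x y =>
    rw [grading_tmul, Algebra.TensorProduct.tmul_mul_tmul, Algebra.TensorProduct.tmul_mul_tmul, volume_mul, one_mul, mul_one]
  | add x y hx hy => rw [mul_add, hx, hy, map_add, add_mul]

/-- The symmetry attached to an element of the Clifford algebra. -/
def symP : Cl →ₗ[ℂ] HC m κ where
  toFun c := Plane.symmetrize (dirac m κ) (xvar m κ) (1 ⊗ₜ c) (1 ⊗ₜ CliffordAlgebra.involute c)
  map_add' c d := by
    simp only [Plane.symmetrize, TensorProduct.tmul_add, map_add, mul_add, add_mul]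
    module
  map_smul' t c := by
    simp only [Plane.symmetrize, TensorProduct.tmul_smul, map_smul, mul_smul_comm, smul_mul_assoc, RingHom.id_apply]
    module

/-- The element `s_α ⊗ γ(α)`. -/
def sRefl (a : Fin 2) (p : ℕ) : HC m κ := hw m κ (reflW m a p) ⊗ₜ gam (root m a p)

theorem symP_apply (c : Cl) : symP m κ c
    = Plane.symmetrize (dirac m κ) (xvar m κ) (1 ⊗ₜ c) (1 ⊗ₜ CliffordAlgebra.involute c) := rfl

theorem symP_mem (c : Cl) : symP m κ c ∈ TAMA m κ := by
  rw [symP_apply, ← coe_opP]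
  exact (opP m κ c).2

theorem sRefl_mul_symP {a : Fin 2} {p : ℕ} {c d : Cl} (h : gam (root m a p) * c = d * gam (root m a p)) :
    sRefl m κ a p * symP m κ c = symP m κ d * sRefl m κ a p := by
  rw [symP_apply, symP_apply, ← coe_opP, ← coe_opP]
  exact congrArg Subtype.val (sTilde_mul_opP m κ h)

/-- An element of `TAMA` passes the Dirac operator and the vector variable at the price of the
grading, and it passes the volume element at the same price. Counting these in each term of the
projection shows that `Z` commutes with even symmetries and anticommutes with odd ones. -/
theorem mul_symP_volume {a a' : HC m κ} (ha : a ∈ TAMA m κ) (h : grading m κ a = a') :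
    a * symP m κ (-(area 0 1 * area 1 1)) = symP m κ (-(area 0 1 * area 1 1)) * a' := by
  have h1 := (mem_TAMA m κ).mp ha
  have h2 := congrArg (grading m κ) h1.1
  have h3 := congrArg (grading m κ) h1.2
  have v1 := tmul_volume_mul m κ a
  have v2 := tmul_volume_mul m κ a'
  have h' : grading m κ a' = a := by rw [← h, grading_grading]
  rw [h'] at v2
  rw [map_mul, map_mul, grading_grading, grading_dirac, h, mul_neg, neg_mul, neg_inj] at h2
  rw [map_mul, map_mul, grading_grading, grading_xvar, h, mul_neg, neg_mul, neg_inj] at h3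
  rw [h] at h1 v1
  rw [symP_apply, map_neg, map_mul, involute_area, involute_area]
  simp only [Plane.symmetrize, TensorProduct.tmul_neg, mul_smul_comm, smul_mul_assoc, mul_sub, sub_mul, mul_add, add_mul,
    mul_assoc, mul_neg, neg_mul, Plane.assoc_rule h1.1, Plane.assoc_rule h1.2, Plane.assoc_rule h2,
    Plane.assoc_rule h3, h1, h2, h3, ← v1, ← v2, Plane.assoc_rule v1.symm, Plane.assoc_rule v2.symm]

theorem grading_symP (c : Cl) : grading m κ (symP m κ c) = symP m κ (CliffordAlgebra.involute c) := by
  rw [symP_apply, symP_apply, CliffordAlgebra.involute_involute]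
  simp only [Plane.symmetrize, map_sub, map_add, map_mul, map_smul, grading_dirac, grading_xvar, grading_tmul,
    CliffordAlgebra.involute_involute, neg_mul, mul_neg, neg_neg]

theorem symP_mul_volume {c d : Cl} (h : CliffordAlgebra.involute c = d) :
    symP m κ c * symP m κ (-(area 0 1 * area 1 1)) = symP m κ (-(area 0 1 * area 1 1)) * symP m κ d :=
  mul_symP_volume m κ (symP_mem m κ c) (by rw [grading_symP, h])

theorem sRefl_volume (a : Fin 2) (p : ℕ) : sRefl m κ a p * symP m κ (-(area 0 1 * area 1 1))
    = -(symP m κ (-(area 0 1 * area 1 1)) * sRefl m κ a p) := by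
  refine (mul_symP_volume m κ (a := sRefl m κ a p) (a' := -sRefl m κ a p) (sTilde_mem m κ a p) ?_).trans (mul_neg _ _)
  rw [sRefl, grading_tmul, CliffordAlgebra.involute_ι, TensorProduct.tmul_neg]

theorem sRefl_area (b : Fin 2) (p : ℕ) :
    sRefl m κ b p * symP m κ (-area b 1) = -(symP m κ (-area b 1) * sRefl m κ b p) := by
  rw [← neg_mul, ← map_neg]
  exact sRefl_mul_symP m κ (by rw [mul_neg, gam_root_area, neg_neg, neg_neg])

theorem sRefl_area_ne {a b : Fin 2} (hab : a ≠ b) (p : ℕ) :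
    sRefl m κ b p * symP m κ (-area a 1) = symP m κ (-area a 1) * sRefl m κ b p :=
  sRefl_mul_symP m κ (by rw [mul_neg, gam_root_area_ne m hab, neg_mul])

theorem sRefl_area_gam (b : Fin 2) (p : ℕ) (ε : ℤˣ) :
    sRefl m κ b p * symP m κ (area (1 - b) ε * gam (zvec b ε)) = (-form (zvec b ε) (root m b p) ^ 2) •
      (symP m κ (area (1 - b) (-ε) * gam (zvec b (-ε))) * sRefl m κ b p) := by
  rw [← smul_mul_assoc, ← map_smul]
  refine sRefl_mul_symP m κ ?_
  rw [← mul_assoc, gam_root_area_ne m (sub_ne b).symm, mul_assoc, gam_root_zvec, area_neg]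
  simp only [smul_mul_assoc, mul_smul_comm, mul_assoc, neg_mul, smul_neg, neg_smul, neg_neg]

theorem sRefl_area_gam_ne {a b : Fin 2} (hab : a ≠ b) (p : ℕ) (ε : ℤˣ) :
    sRefl m κ a p * symP m κ (area (1 - b) ε * gam (zvec b ε))
      = symP m κ (area (1 - b) ε * gam (zvec b ε)) * sRefl m κ a p := by
  have ha : 1 - b = a := by revert a b; decide
  rw [ha]
  refine sRefl_mul_symP m κ ?_
  rw [← mul_assoc, gam_root_area, neg_mul, mul_assoc, gam_root_zvec_ne m hab.symm]
  simp only [neg_mul, mul_neg, neg_neg, mul_assoc]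

theorem sRefl_sRefl_gam_gam (p q : ℕ) (ε : ℤˣ) :
    sRefl m κ 0 p * (sRefl m κ 1 q * symP m κ (gam (zvec 0 ε) * gam (zvec 1 ε)))
    = (form (zvec 0 ε) (root m 0 p) ^ 2 * form (zvec 1 ε) (root m 1 q) ^ 2) •
      (symP m κ (gam (zvec 0 (-ε)) * gam (zvec 1 (-ε))) * (sRefl m κ 0 p * sRefl m κ 1 q)) := by
  have h01 : (0 : Fin 2) ≠ 1 := by decide
  have h1 : sRefl m κ 1 q * symP m κ (gam (zvec 0 ε) * gam (zvec 1 ε))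
      = symP m κ (-(form (zvec 1 ε) (root m 1 q) ^ 2) • (gam (zvec 0 ε) * gam (zvec 1 (-ε)))) * sRefl m κ 1 q := by
    refine sRefl_mul_symP m κ ?_
    rw [← mul_assoc, gam_root_zvec_ne m h01, mul_assoc, gam_root_zvec]
    simp only [smul_mul_assoc, mul_smul_comm, mul_assoc, neg_mul, smul_neg, neg_smul, neg_neg]
  have h2 : sRefl m κ 0 p * symP m κ (-(form (zvec 1 ε) (root m 1 q) ^ 2) • (gam (zvec 0 ε) * gam (zvec 1 (-ε))))
      = symP m κ ((form (zvec 0 ε) (root m 0 p) ^ 2 * form (zvec 1 ε) (root m 1 q) ^ 2) •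
        (gam (zvec 0 (-ε)) * gam (zvec 1 (-ε)))) * sRefl m κ 0 p := by
    refine sRefl_mul_symP m κ ?_
    rw [mul_smul_comm, ← mul_assoc, gam_root_zvec, mul_assoc, gam_root_zvec_ne m h01.symm]
    simp only [smul_mul_assoc, mul_smul_comm, mul_assoc, neg_mul, mul_neg, smul_neg, neg_smul, neg_neg, smul_smul]
    rw [mul_comm]
  rw [h1, ← mul_assoc, h2, map_smul, smul_mul_assoc, smul_mul_assoc, mul_assoc]

theorem sRefl_sRefl_ne {a b : Fin 2} (h : a ≠ b) (p q : ℕ) :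
    sRefl m κ b q * sRefl m κ a p = -(sRefl m κ a p * sRefl m κ b q) := by
  have h2 : (2 : ℂ) * form (root m a p) (root m b q) = 0 := by
    rw [← smul_eq_mul, ← LinearMap.smul_apply, ← map_smul, two_smul_root m a 1 p]
    simp only [map_add, map_smul, LinearMap.add_apply, LinearMap.smul_apply, form_zvec_root_ne m h, smul_zero, add_zero]
  have h3 := (mul_eq_zero.mp h2).resolve_left two_ne_zero
  rw [sRefl, sRefl, Algebra.TensorProduct.tmul_mul_tmul, Algebra.TensorProduct.tmul_mul_tmul, ← map_mul (hw m κ), ← map_mul (hw m κ),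
    reflW_comm m h, gam_root_mul, refl_of_form_eq_zero m h3, TensorProduct.tmul_neg]

theorem sRefl_sq (a : Fin 2) (p : ℕ) : sRefl m κ a p * sRefl m κ a p = 1 := by
  have h : reflW m a p * reflW m a p = 1 := Subtype.ext <| LinearEquiv.ext fun x =>
    Module.involutive_reflection (two_form_root_root m a p) x
  rw [sRefl, Algebra.TensorProduct.tmul_mul_tmul, gam_root_sq, ← map_mul, h, map_one, Algebra.TensorProduct.one_def]

theorem sRefl_add_self {a : Fin 2} (hm : 1 ≤ m a) (p : ℕ) : sRefl m κ a (p + m a) = -sRefl m κ a p := by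
  have h : reflW m a (p + m a) = reflW m a p := Subtype.ext <| LinearEquiv.ext fun x => by
    change refl m a (p + m a) x = refl m a p x
    rw [refl_apply, refl_apply, root_add_self m hm]
    simp
  rw [sRefl, sRefl, h, root_add_self m hm, map_neg, TensorProduct.tmul_neg]

/-- In the formula `Plane.o` the two Clifford terms recombine, root by root, to γ(α) written in the
isotropic basis. Thus O(z) lies in the span of the s̃_α, and its relations reduce to those of single
reflections. -/
theorem symP_gam_eq_sum (b : Fin 2) (ε : ℤˣ) : symP m κ (gam (zvec b ε))
    = ∑ p ∈ Finset.Icc 1 (m b), (κ (root m b p) * form (zvec b ε) (root m b p)) • sRefl m κ b p := by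
  have hsum : ∀ δ, reflSum m κ (zvec b ε) (zvec b δ) = ∑ p ∈ Finset.Icc 1 (m b),
      (κ (root m b p) * form (zvec b ε) (root m b p) * form (zvec b δ) (root m b p)) • hw m κ (reflW m b p) := by
    intro δ
    rw [reflSum]
    refine Finset.sum_eq_single b (fun a _ ha => ?_) fun h => absurd (Finset.mem_univ b) h
    exact Finset.sum_eq_zero fun p _ => by rw [form_zvec_root_ne m ha.symm]; simp
  rw [symP_apply, ← coe_opP, ← oOp, coe_oOp]
  simp only [Plane.o, planeHC, smul_mul_assoc, Algebra.TensorProduct.tmul_mul_tmul, one_mul, mul_one]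
  simp only [hsum, TensorProduct.sum_tmul, Finset.smul_sum, ← Finset.sum_add_distrib]
  refine Finset.sum_congr rfl fun p _ => ?_
  have h : root m b p = (2⁻¹ : ℂ) • (form (zvec b (-ε)) (root m b p) • zvec b ε
      + form (zvec b ε) (root m b p) • zvec b (-ε)) := by
    rw [← two_smul_root, smul_smul, inv_mul_cancel₀ two_ne_zero, one_smul]
  have h' : gam (root m b p) = (2⁻¹ : ℂ) • (form (zvec b (-ε)) (root m b p) • gam (zvec b ε)
      + form (zvec b ε) (root m b p) • gam (zvec b (-ε))) := by
    conv_lhs => rw [h]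
    rw [map_smul, map_add, map_smul, map_smul]
  rw [sRefl, h']
  simp only [TensorProduct.tmul_smul, TensorProduct.tmul_add, ← TensorProduct.smul_tmul']
  module

theorem symP_gam_mul {b : Fin 2} {ε : ℤˣ} {u v : HC m κ} (h : ∀ p, sRefl m κ b p * u = v * sRefl m κ b p) :
    symP m κ (gam (zvec b ε)) * u = v * symP m κ (gam (zvec b ε)) := by
  rw [symP_gam_eq_sum, Finset.sum_mul, Finset.mul_sum]
  exact Finset.sum_congr rfl fun p _ => by rw [smul_mul_assoc, mul_smul_comm, h]

theorem symP_gam_area_gam (b : Fin 2) (ε : ℤˣ) :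
    symP m κ (gam (zvec b (-ε))) * symP m κ (area (1 - b) ε * gam (zvec b ε))
      = -(symP m κ (area (1 - b) (-ε) * gam (zvec b (-ε))) * symP m κ (gam (zvec b ε))) := by
  rw [symP_gam_eq_sum, symP_gam_eq_sum, Finset.sum_mul, Finset.mul_sum, ← Finset.sum_neg_distrib]
  refine Finset.sum_congr rfl fun p _ => ?_
  rw [smul_mul_assoc, mul_smul_comm, sRefl_area_gam, smul_smul, ← neg_smul]
  congr 1
  linear_combination (-κ (root m b p) * form (zvec b ε) (root m b p)) * form_zvec_root_mul m b ε p

/-- Both sides are sums over pairs of reflections, one from each plane. Such a pair carries O(z_1 ∧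
z_2) to a multiple of O(z̄_1 ∧ z̄_2), and (z, α)(z̄, α) = 1 matches the coefficients. -/
theorem symP_gam_gam_gam_gam (ε : ℤˣ) : symP m κ (gam (zvec 0 (-ε)) * gam (zvec 1 (-ε)))
      * (symP m κ (gam (zvec 0 ε)) * symP m κ (gam (zvec 1 ε)))
    = symP m κ (gam (zvec 0 (-ε))) * (symP m κ (gam (zvec 1 (-ε))) * symP m κ (gam (zvec 0 ε) * gam (zvec 1 ε))) := by
  have e : ∀ (u v : ℕ → ℂ) (x : HC m κ), (∑ p ∈ Finset.Icc 1 (m 0), u p • sRefl m κ 0 p)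
      * ((∑ q ∈ Finset.Icc 1 (m 1), v q • sRefl m κ 1 q) * x)
      = ∑ p ∈ Finset.Icc 1 (m 0), ∑ q ∈ Finset.Icc 1 (m 1), (u p * v q) • (sRefl m κ 0 p * (sRefl m κ 1 q * x)) := by
    intro u v x
    rw [Finset.sum_mul]
    refine Finset.sum_congr rfl fun p _ => ?_
    simp only [Finset.sum_mul, Finset.mul_sum, smul_mul_assoc, mul_smul_comm, smul_smul]
    exact Finset.sum_congr rfl fun q _ => by rw [mul_comm]
  have e' := fun u v => e u v 1
  simp only [mul_one] at e'
  rw [symP_gam_eq_sum m κ 0, symP_gam_eq_sum m κ 1, symP_gam_eq_sum m κ 0, symP_gam_eq_sum m κ 1, e, e']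
  simp only [Finset.mul_sum]
  refine Finset.sum_congr rfl fun p _ => Finset.sum_congr rfl fun q _ => ?_
  rw [mul_smul_comm, sRefl_sRefl_gam_gam, smul_smul]
  congr 1
  have h0 := form_zvec_root_mul m 0 ε p
  have h1 := form_zvec_root_mul m 1 ε q
  linear_combination (-κ (root m 0 p) * form (zvec 0 ε) (root m 0 p) * κ (root m 1 q) * form (zvec 1 ε) (root m 1 q))
    * (form (zvec 1 (-ε)) (root m 1 q) * form (zvec 1 ε) (root m 1 q) * h0 + h1)

end Relations

/-! ### The ladder system in `H_κ ⊗ 𝒞`. -/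

section Planes

variable (m : Fin 2 → ℕ) (κ : V → ℂ)

theorem symP_gam (b : Fin 2) (ε : ℤˣ) : symP m κ (gam (zvec b ε)) = (planeHC m κ b ε).o := by
  rw [symP_apply, ← coe_opP, ← oOp, coe_oOp]

theorem smul_symP_area (b : Fin 2) (ε : ℤˣ) :
    ((ε : ℤ) : ℂ) • symP m κ (-area b 1) = (planeHC m κ b ε).eta := by
  have h := H_eq m κ b ε
  rw [← coe_H, h, coe_opP, ← symP_apply, ← map_smul, smul_neg, ← area_eq]

theorem symP_area_gam {a b : Fin 2} (h : a ≠ b) (ε δ : ℤˣ) :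
    symP m κ (area a ε * gam (zvec b δ)) = (planeHC m κ a ε).oddSym (planeHC m κ b δ) := by
  rw [symP_apply, ← coe_opP, coe_opP_area_gam m κ ε δ h]

theorem symP_gam_gam {a b : Fin 2} (h : a ≠ b) (ε δ : ℤˣ) :
    symP m κ (gam (zvec a ε) * gam (zvec b δ)) = (planeHC m κ a ε).evenSym (planeHC m κ b δ) := by
  rw [symP_apply, ← coe_opP, coe_opP_gam_gam m κ ε δ h]

theorem symP_volume {a b : Fin 2} (h : a ≠ b) (ε : ℤˣ) :
    symP m κ (-(area 0 1 * area 1 1)) = (planeHC m κ a ε).totalZ (planeHC m κ b ε) := by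
  rw [symP_apply, ← coe_opP, ← Z_eq, coe_Z m κ ε h]

theorem smul_cancel {N : Type*} [AddCommGroup N] [Module ℂ N] (ε : ℤˣ) (x : N) :
    ((ε : ℤ) : ℂ) • ((ε : ℤ) : ℂ) • x = x := by
  rcases Int.units_eq_one_or ε with rfl | rfl <;> simp

theorem sub_eq_of_ne {a b : Fin 2} (h : a ≠ b) : 1 - b = a := by revert a b; decide

theorem symP_gam_symP_gam (ε δ : ℤˣ) : symP m κ (gam (zvec 1 δ)) * symP m κ (gam (zvec 0 ε))
    = -(symP m κ (gam (zvec 0 ε)) * symP m κ (gam (zvec 1 δ))) := by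
  rw [← neg_mul]
  refine symP_gam_mul m κ fun p => ?_
  rw [neg_mul, ← mul_neg]
  exact (symP_gam_mul m κ fun q => by
    rw [mul_neg, sRefl_sRefl_ne m κ (show (1 : Fin 2) ≠ 0 by decide), neg_neg]).symm

/-- The ladder system in `H_κ ⊗ 𝒞`. -/
def ladderHC : LadderSystem (HC m κ) where
  H b := symP m κ (-area b 1)
  Z := symP m κ (-(area 0 1 * area 1 1))
  C b ε := symP m κ (area (1 - b) ε * gam (zvec b ε))
  o b ε := symP m κ (gam (zvec b ε))
  A ε := symP m κ (gam (zvec 0 ε) * gam (zvec 1 ε))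
  s b := sRefl m κ b 0
  r b := sRefl m κ b 0 * sRefl m κ b 1
  zeta := zetaRoot m
  H_H a b := by
    by_cases h : a = b
    · rw [h]
    · have h1 := (Plane.symmetrize_relations (planeHC_superCommute m κ h 1 1)).2.2.2.2.2.1
      simpa only [← smul_symP_area, Units.val_one, Int.cast_one, one_smul] using h1
  H_Z b := symP_mul_volume m κ (by rw [map_neg, involute_area])
  r_H a b := by
    by_cases h : b = a
    · subst h
      rw [mul_assoc, sRefl_area, mul_neg, ← mul_assoc, sRefl_area, neg_mul, neg_neg, mul_assoc]
    · rw [mul_assoc, sRefl_area_ne m κ h, ← mul_assoc, sRefl_area_ne m κ h, mul_assoc]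
  r_Z a := by rw [mul_assoc, sRefl_volume, mul_neg, ← mul_assoc, sRefl_volume, neg_mul, neg_neg, mul_assoc]
  r_r a b := by
    by_cases h : a = b
    · rw [h]
    · have e := fun p q => sRefl_sRefl_ne m κ (Ne.symm h) p q
      simp only [mul_assoc, e, Plane.assoc_rule (e _ _), mul_neg, neg_mul, neg_neg]
  C_Z b ε := by
    refine (symP_mul_volume m κ (d := -(area (1 - b) ε * gam (zvec b ε))) ?_).trans ?_
    · rw [map_mul, involute_area, CliffordAlgebra.involute_ι, mul_neg]
    · rw [(symP m κ).map_neg (area (1 - b) ε * _), mul_neg]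
  o_Z b ε := by
    refine (symP_mul_volume m κ (CliffordAlgebra.involute_ι _)).trans ?_
    rw [(symP m κ).map_neg (gam _), mul_neg]
  s_Z b := sRefl_volume m κ b 0
  A_Z ε := symP_mul_volume m κ (by
    rw [map_mul, CliffordAlgebra.involute_ι, CliffordAlgebra.involute_ι, neg_mul_neg])
  C_H' {a b} h ε := by
    have h1 := (Plane.symmetrize_relations (planeHC_superCommute m κ h ε ε)).2.2.2.2.2.2
    rw [← smul_symP_area, ← symP_area_gam m κ h, smul_mul_assoc, mul_smul_comm] at h1
    -- The plane oriented by ε provides the relation for εH; a second factor ε recovers `H` itself.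
    -- The same device is used below.
    have h2 := congrArg (fun u => ((ε : ℤ) : ℂ) • u) h1
    simp only [smul_cancel] at h2
    rw [sub_eq_of_ne h, h2]
  o_H' {a b} h ε := symP_gam_mul m κ fun p => sRefl_area_ne m κ h p
  s_H' h := sRefl_area_ne m κ h 0
  o_H b ε := by
    rw [← neg_mul]
    exact symP_gam_mul m κ fun p => by rw [sRefl_area, neg_mul]
  s_H b := sRefl_area m κ b 0
  C_H {a b} h ε := by
    have h1 := (Plane.symRelations (planeHC_superCommute m κ h ε ε)).H_C
    rw [← smul_symP_area, ← smul_symP_area, ← symP_area_gam m κ h, ← symP_volume m κ h, ← symP_gam, smul_mul_assoc,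
      mul_smul_comm] at h1
    have h2 := congrArg (fun u => ((ε : ℤ) : ℂ) • u) h1
    simp only [smul_sub, smul_add, smul_cancel, sub_mul, smul_mul_assoc, smul_comm (2 : ℂ) ((ε : ℤ) : ℂ)] at h2
    rw [sub_eq_of_ne h]
    rw [sub_eq_iff_eq_add] at h2
    rw [h2]
    simp only [mul_smul, smul_comm (2 : ℂ) ((ε : ℤ) : ℂ)]
    abel
  o_C b ε := symP_gam_area_gam m κ b ε
  C_C {a b} h ε := by
    have h1 := (Plane.symRelations (planeHC_superCommute m κ h ε ε)).C_C
    rw [planeHC_swap, ← smul_symP_area, ← smul_symP_area, ← symP_area_gam m κ h, ← symP_area_gam m κ h, ← symP_volume m κ h,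
      ← symP_gam, ← symP_gam] at h1
    -- `C b (-ε)` uses the area element of orientation -ε, whereas `h1` keeps the orientation ε in
    -- both factors; hence the overall sign.
    rw [sub_eq_of_ne h, area_neg, neg_mul, map_neg, neg_mul, h1]
    abel
  A_H_zero ε := by
    have h01 : (0 : Fin 2) ≠ 1 := by decide
    have h1 := (Plane.symRelations (planeHC_superCommute m κ h01 ε ε)).H_A
    rw [← smul_symP_area, ← symP_area_gam m κ h01, ← symP_gam, ← symP_gam, ← symP_gam_gam m κ h01, smul_mul_assoc,
      mul_smul_comm] at h1
    have h2 := congrArg (fun u => ((ε : ℤ) : ℂ) • u) h1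
    simp only [smul_sub, smul_add, smul_cancel, smul_comm (2 : ℂ) ((ε : ℤ) : ℂ)] at h2
    rw [sub_eq_of_ne h01]
    rw [sub_eq_iff_eq_add] at h2
    rw [h2]
    simp only [mul_smul, smul_comm (2 : ℂ) ((ε : ℤ) : ℂ)]
    abel
  A_H_one ε := by
    -- The relation for `H 0` is used with the planes exchanged; z_2 ∧ z_1 = -(z_1 ∧ z_2) and the
    -- anticommutation of the two `o` account for the signs.
    have h01 : (1 : Fin 2) ≠ 0 := by decide
    have h1 := (Plane.symRelations (planeHC_superCommute m κ h01 ε ε)).H_A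
    rw [← smul_symP_area, ← symP_area_gam m κ h01, ← symP_gam, ← symP_gam, ← symP_gam_gam m κ h01, smul_mul_assoc,
      mul_smul_comm, gam_zvec_ne h01,
      (symP m κ).map_neg (gam (zvec 0 ε) * gam (zvec 1 ε)), mul_neg, neg_mul, symP_gam_symP_gam]  at h1
    have h2 := congrArg (fun u => ((ε : ℤ) : ℂ) • u) h1
    simp only [smul_sub, smul_add, smul_cancel, smul_neg, smul_comm (2 : ℂ) ((ε : ℤ) : ℂ)] at h2
    rw [sub_eq_of_ne h01]
    linear_combination (norm := module) h2
  C_C' ε := by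
    have h01 : (0 : Fin 2) ≠ 1 := by decide
    have h1 := (Plane.symRelations (planeHC_superCommute m κ h01 ε ε)).C_C'
    rw [← smul_symP_area, ← smul_symP_area, ← symP_area_gam m κ h01, ← symP_area_gam m κ h01.symm, ← symP_gam, ← symP_gam,
      ← symP_gam_gam m κ h01, ← symP_volume m κ h01] at h1
    simp only [smul_mul_assoc, mul_smul_comm, ← smul_add] at h1
    rw [sub_eq_of_ne h01, sub_eq_of_ne h01.symm]
    exact h1
  A_A ε := by
    have h01 : (0 : Fin 2) ≠ 1 := by decide
    have h1 := (Plane.symRelations (planeHC_superCommute m κ h01 ε ε)).A_A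
    simp only [planeHC_swap] at h1
    rw [← smul_symP_area, ← smul_symP_area, ← symP_area_gam m κ h01, ← symP_area_gam m κ h01.symm, ← symP_gam, ← symP_gam,
      ← symP_gam, ← symP_gam, ← symP_gam_gam m κ h01, ← symP_gam_gam m κ h01, ← symP_volume m κ h01] at h1
    rw [sub_eq_of_ne h01, sub_eq_of_ne h01.symm]
    exact h1
  A_o_o ε := symP_gam_gam_gam_gam m κ ε
  o_o ε δ := symP_gam_symP_gam m κ ε δ
  r_C b ε := by
    rw [mul_assoc, sRefl_area_gam, mul_smul_comm, ← mul_assoc, sRefl_area_gam, smul_mul_assoc, smul_smul, neg_neg,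
      form_zvec_root_sq, form_zvec_root_sq, mul_assoc]
    simp
  r_C' h ε := by rw [mul_assoc, sRefl_area_gam_ne m κ h, ← mul_assoc, sRefl_area_gam_ne m κ h, mul_assoc]
  r_s b := by
    simp only [mul_assoc, Plane.assoc_rule (sRefl_sq m κ b _), one_mul, sRefl_sq, mul_one]
  r_s' {a b} h := by
    have e := fun p q => sRefl_sRefl_ne m κ h.symm p q
    simp only [mul_assoc, e, Plane.assoc_rule (e _ _), mul_neg, neg_mul, neg_neg]
  s_s b := sRefl_sq m κ b 0

end Planes

/-! ### Action on common eigenvectors. -/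

namespace LadderSystem

variable {M : Type*} [AddCommGroup M] [Module ℂ M] (S : LadderSystem (Module.End ℂ M))

/-- Common eigenvectors of `H_1, H_2, Z, r_1, r_2`; the eigenvalues of `r_b` are odd powers of `ζ_b`. -/
structure IsEigenvector (lam : Fin 2 → ℂ) (Lam : ℂ) (ell : Fin 2 → ℤ) (u : M) : Prop where
  H (b : Fin 2) : S.H b u = lam b • u
  Z : S.Z u = Lam • u
  r (b : Fin 2) : S.r b u = S.zeta b ^ ell b • u
  odd (b : Fin 2) : Odd (ell b)

/-- The action of the elements `O(z_b^ε)` on eigenvectors of the rotations, in terms of parameters `Q_b`. -/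
structure HasParameters (Q : Fin 2 → ℤ → ℂ) : Prop where
  zeta_ne (b : Fin 2) : S.zeta b ≠ 0
  o_apply (b : Fin 2) (ε : ℤˣ) {l : ℤ} (hl : Odd l) {u : M} (hu : S.r b u = S.zeta b ^ l • u) :
    S.o b ε u = (-(Complex.I * ((ε : ℤ) : ℂ) * Q b (l + ε))) • S.s b u
  neg (b : Fin 2) (j : ℤ) : Q b (-j) = Q b j
  small (b : Fin 2) (j : ℤ) : ‖Q b j‖ < 1 / 2

variable {S} {lam : Fin 2 → ℂ} {Lam : ℂ} {ell : Fin 2 → ℤ} {u : M} {Q : Fin 2 → ℤ → ℂ}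

theorem s_s_apply (b : Fin 2) (u : M) : S.s b (S.s b u) = u := by
  rw [← Module.End.mul_apply, S.s_s, Module.End.one_apply]

theorem s_apply_ne_zero (b : Fin 2) (hu : u ≠ 0) : S.s b u ≠ 0 := fun h => hu (by
  rw [← s_s_apply (S := S) b u, h, map_zero])

/-- From r s r = s: a reflection inverts rotation eigenvalues. -/
theorem r_s_apply (h : S.HasParameters Q) (b : Fin 2) {l : ℤ} (hu : S.r b u = S.zeta b ^ l • u) :
    S.r b (S.s b u) = S.zeta b ^ (-l) • S.s b u := by
  have h1 := LinearMap.congr_fun (S.r_s b) u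
  simp only [Module.End.mul_apply, hu, map_smul] at h1
  rw [← h1, smul_smul, ← zpow_add₀ (h.zeta_ne b), neg_add_cancel, zpow_zero, one_smul, h1]

/-- The first `o` reflects `u`, so the second sees the exponent -l and the parameter at -(l + ε);
evenness of `Q` makes the two parameters equal, and the two signs and the two factors i multiply to
1. -/
theorem HasParameters.o_o_apply (h : S.HasParameters Q) (b : Fin 2) (ε : ℤˣ) {l : ℤ} (hl : Odd l)
    (hu : S.r b u = S.zeta b ^ l • u) : S.o b (-ε) (S.o b ε u) = Q b (l + ε) ^ 2 • u := by
  rw [h.o_apply b ε hl hu, map_smul, h.o_apply b (-ε) hl.neg (r_s_apply h b hu), s_s_apply, smul_smul]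
  congr 1
  have e : -l + ((-ε : ℤˣ) : ℤ) = -(l + ε) := by rw [Units.val_neg]; ring
  have e2 : ((ε : ℤ) : ℂ) * ((ε : ℤ) : ℂ) = 1 := by
    rcases Int.units_eq_one_or ε with rfl | rfl <;> simp
  rw [e, h.neg, Units.val_neg, Int.cast_neg]
  linear_combination (-Complex.I ^ 2 * Q b (l + ε) ^ 2) * e2 - Q b (l + ε) ^ 2 * Complex.I_sq

theorem IsEigenvector.s (hu : S.IsEigenvector lam Lam ell u) (h : S.HasParameters Q) (b : Fin 2) :
    S.IsEigenvector (Function.update lam b (-lam b)) (-Lam) (Function.update ell b (-ell b)) (S.s b u) where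
  H a := by
    by_cases hab : a = b
    · subst hab
      have h1 := LinearMap.congr_fun (S.s_H a) u
      simp only [Module.End.mul_apply, LinearMap.neg_apply, hu.H, map_smul] at h1
      rw [Function.update_self, neg_smul, h1, neg_neg]
    · have h1 := LinearMap.congr_fun (S.s_H' hab) u
      simp only [Module.End.mul_apply, hu.H, map_smul] at h1
      rw [Function.update_of_ne hab, h1]
  Z := by
    have h1 := LinearMap.congr_fun (S.s_Z b) u
    simp only [Module.End.mul_apply, LinearMap.neg_apply, hu.Z, map_smul] at h1
    rw [neg_smul, h1, neg_neg]
  r a := by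
    by_cases hab : a = b
    · subst hab
      rw [Function.update_self, r_s_apply h a (hu.r a)]
    · have h1 := LinearMap.congr_fun (S.r_s' hab) u
      simp only [Module.End.mul_apply, hu.r, map_smul] at h1
      rw [Function.update_of_ne hab, h1]
  odd a := by
    by_cases hab : a = b
    · subst hab
      rw [Function.update_self]
      exact (hu.odd a).neg
    · rw [Function.update_of_ne hab]
      exact hu.odd a

theorem H_L_apply (b : Fin 2) (ε : ℤˣ) (u : M) :
    S.H b (S.L b ε u) = S.L b ε (S.H b u) + ((ε : ℤ) : ℂ) • S.L b ε u := by
  have h1 := LinearMap.congr_fun (S.L_H (sub_ne b).symm ε) u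
  simp only [Module.End.mul_apply, LinearMap.sub_apply, LinearMap.smul_apply] at h1
  rw [h1, sub_add_cancel]

theorem H_L_apply' {a b : Fin 2} (hab : a ≠ b) (ε : ℤˣ) (u : M) : S.H a (S.L b ε u) = S.L b ε (S.H a u) :=
  (LinearMap.congr_fun (S.L_H' hab ε) u).symm

theorem Z_L_apply (b : Fin 2) (ε : ℤˣ) (u : M) : S.Z (S.L b ε u) = -S.L b ε (S.Z u) := by
  have h1 := LinearMap.congr_fun (S.L_Z b ε) u
  simp only [Module.End.mul_apply, LinearMap.neg_apply] at h1
  rw [h1, neg_neg]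

theorem IsEigenvector.L (hu : S.IsEigenvector lam Lam ell u) (h : S.HasParameters Q) (b : Fin 2) (ε : ℤˣ) :
    S.IsEigenvector (Function.update lam b (lam b + ((ε : ℤ) : ℂ))) (-Lam)
      (Function.update ell b (ell b + 2 * ε)) (S.L b ε u) where
  H a := by
    by_cases hab : a = b
    · subst hab
      rw [Function.update_self, H_L_apply, hu.H, map_smul, add_smul]
    · rw [Function.update_of_ne hab, H_L_apply' hab, hu.H, map_smul]
  Z := by rw [Z_L_apply, hu.Z, map_smul, neg_smul]
  r a := by
    by_cases hab : a = b
    · subst hab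
      have h1 := LinearMap.congr_fun (S.r_L a ε) u
      simp only [Module.End.mul_apply, LinearMap.smul_apply, hu.r, map_smul, smul_smul] at h1
      rw [Function.update_self, h1, mul_comm, zpow_add₀ (h.zeta_ne a)]
    · have h1 := LinearMap.congr_fun (S.r_L' hab ε) u
      simp only [Module.End.mul_apply, hu.r, map_smul] at h1
      rw [Function.update_of_ne hab, h1]
  odd a := by
    by_cases hab : a = b
    · subst hab
      rw [Function.update_self]
      exact (hu.odd a).add_even (even_two_mul _)
    · rw [Function.update_of_ne hab]
      exact hu.odd a

theorem IsEigenvector.L_L (hu : S.IsEigenvector lam Lam ell u) (h : S.HasParameters Q) {a b : Fin 2} (hab : a ≠ b)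
    (ε : ℤˣ) : S.L b (-ε) (S.L b ε u)
      = (4 * (((((ε : ℤ) : ℂ) * lam b + 2⁻¹) ^ 2 - Q b (ell b + ε) ^ 2)
        * ((((ε : ℤ) : ℂ) * lam b + 2⁻¹) ^ 2 - (Lam + ((ε : ℤ) : ℂ) * lam a) ^ 2))) • u := by
  have h1 := LinearMap.congr_fun (S.L_L hab ε) u
  simp only [Module.End.mul_apply, LinearMap.smul_apply, LinearMap.sub_apply, LinearMap.add_apply,
    Module.End.one_apply, map_add, map_sub, map_smul, hu.H, hu.Z, h.o_o_apply b ε (hu.odd b) (hu.r b)] at h1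
  rw [h1]
  module

theorem IsEigenvector.o (hu : S.IsEigenvector lam Lam ell u) {a b : Fin 2} (hab : a ≠ b) (ε : ℤˣ) :
    S.Z (S.o b ε u) = -(Lam • S.o b ε u) ∧ S.H a (S.o b ε u) = lam a • S.o b ε u
      ∧ S.H b (S.o b ε u) = -(lam b • S.o b ε u) := by
  have h1 := LinearMap.congr_fun (S.o_Z b ε) u
  have h2 := LinearMap.congr_fun (S.o_H' hab ε) u
  have h3 := LinearMap.congr_fun (S.o_H b ε) u
  simp only [Module.End.mul_apply, LinearMap.neg_apply, hu.Z, hu.H, map_smul] at h1 h2 h3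
  exact ⟨by rw [h1, neg_neg], h2.symm, by rw [h3, neg_neg]⟩

theorem IsEigenvector.H_C (hu : S.IsEigenvector lam Lam ell u) {a b : Fin 2} (hab : a ≠ b) (ε : ℤˣ) :
    S.H b (S.C b ε u) = (lam b + ((ε : ℤ) : ℂ)) • S.C b ε u
      - (2 * (((ε : ℤ) : ℂ) * Lam + lam a)) • S.o b ε u := by
  have h1 := LinearMap.congr_fun (S.C_H hab ε) u
  simp only [Module.End.mul_apply, LinearMap.sub_apply, LinearMap.add_apply, LinearMap.smul_apply, hu.H, map_smul,
    (hu.o hab ε).1, (hu.o hab ε).2.1] at h1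
  linear_combination (norm := module) -h1

theorem IsEigenvector.L_apply (hu : S.IsEigenvector lam Lam ell u) {a b : Fin 2} (hab : a ≠ b) (ε : ℤˣ) :
    S.L b ε u = (2 * lam b + ((ε : ℤ) : ℂ)) • S.C b ε u
      - (2 * (((ε : ℤ) : ℂ) * Lam + lam a)) • S.o b ε u := by
  simp only [LadderSystem.L, LinearMap.add_apply, Module.End.mul_apply, hu.H, map_smul, hu.H_C hab]
  module

/-- `h² ≠ Q²` whenever `Re h ≥ ½`. -/
theorem HasParameters.sq_sub_sq_ne_zero (h : S.HasParameters Q) (b : Fin 2) (j : ℤ) {c : ℂ} (hc : 1 / 2 ≤ |c.re|) :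
    c ^ 2 - Q b j ^ 2 ≠ 0 := by
  have h1 := (hc.trans (Complex.abs_re_le_norm c)).trans_lt' (h.small b j)
  intro h2
  rcases sq_eq_sq_iff_eq_or_eq_neg.1 (sub_eq_zero.1 h2) with e | e
  · rw [e] at h1
    exact lt_irrefl _ h1
  · rw [e, norm_neg] at h1
    exact lt_irrefl _ h1

/-- If λ_b = ½, then `C b (-1)` leads to the eigenvalue -½ up to a term in `o`, and the reflection
brings it back to ½. The `o` term becomes a multiple of `u`, so a Jordan block appears whenever its
coefficient is nonzero. -/
theorem IsEigenvector.H_s_C (hu : S.IsEigenvector lam Lam ell u) (h : S.HasParameters Q) {a b : Fin 2} (hab : a ≠ b)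
    (hl : lam b = 2⁻¹) :
    S.H b (S.s b (S.C b (-1) u)) = (2⁻¹ : ℂ) • S.s b (S.C b (-1) u)
      + (2 * (lam a - Lam) * (Complex.I * Q b (ell b - 1))) • u ∧
    S.H a (S.s b (S.C b (-1) u)) = lam a • S.s b (S.C b (-1) u) ∧
    S.Z (S.s b (S.C b (-1) u)) = Lam • S.s b (S.C b (-1) u) := by
  have h1 := LinearMap.congr_fun (S.s_H b) (S.C b (-1) u)
  have h2 := LinearMap.congr_fun (S.s_H' hab) (S.C b (-1) u)
  have h3 := LinearMap.congr_fun (S.s_Z b) (S.C b (-1) u)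
  have h4 := LinearMap.congr_fun (S.C_H' hab (-1)) u
  have h5 := LinearMap.congr_fun (S.C_Z b (-1)) u
  have h6 := hu.H_C hab (-1)
  rw [h.o_apply b (-1) (hu.odd b) (hu.r b)] at h6
  simp only [Module.End.mul_apply, LinearMap.neg_apply, hu.Z, hu.H, map_smul, Units.val_neg, Units.val_one, Int.cast_neg,
    Int.cast_one] at h1 h2 h3 h4 h5 h6
  rw [h6, map_sub, map_smul, map_smul, map_smul, s_s_apply, hl, ← sub_eq_add_neg] at h1
  rw [← h4, map_smul] at h2
  rw [← neg_eq_iff_eq_neg] at h5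
  rw [← h5, map_neg, map_smul] at h3
  refine ⟨?_, h2.symm, ?_⟩
  · rw [sub_eq_add_neg (ell b)]
    linear_combination (norm := module) h1
  · rw [← neg_inj, ← h3]

/-- A vector on which `H_b` acts by a nontrivial Jordan block above an eigenvector cannot be killed by `L_b^+`. -/
theorem IsEigenvector.jordan_eq_zero (hu : S.IsEigenvector lam Lam ell u) (h : S.HasParameters Q) {a b : Fin 2}
    (hab : a ≠ b) (hu0 : u ≠ 0) (hL : Lam + lam a = -(lam b + 2⁻¹)) (hre : 0 ≤ (lam b).re) {w : M} {c : ℂ}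
    (hb : S.H b w = lam b • w + c • u) (ha : S.H a w = lam a • w) (hZ : S.Z w = Lam • w) (hw : S.L b 1 w = 0) :
    c = 0 := by
  have h1 := LinearMap.congr_fun (S.L_L hab 1) w
  have e : (Lam + lam a) ^ 2 = (lam b + 2⁻¹) ^ 2 := by rw [hL]; ring
  -- Because (Λ + λ_a)² = (λ_b + ½)², the diagonal part of the second factor vanishes on `w` and
  -- only its nilpotent part survives; the first factor is then applied to a multiple of the
  -- eigenvector `u`.
  have h2 : ((((((1 : ℤˣ) : ℤ) : ℂ) • S.H b + (2⁻¹ : ℂ) • 1) * ((((1 : ℤˣ) : ℤ) : ℂ) • S.H b + (2⁻¹ : ℂ) • 1)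
      - (S.Z + (((1 : ℤˣ) : ℤ) : ℂ) • S.H a) * (S.Z + (((1 : ℤˣ) : ℤ) : ℂ) • S.H a)) : Module.End ℂ M) w
      = (c * (2 * lam b + 1)) • u := by
    simp only [Module.End.mul_apply, LinearMap.smul_apply, LinearMap.sub_apply, LinearMap.add_apply, Units.val_one,
      Int.cast_one, one_smul, Module.End.one_apply, map_add, map_smul, ha, hb, hu.H, hZ]
    linear_combination (norm := module) -(e • w)
  rw [Module.End.mul_apply, hw, map_zero, LinearMap.smul_apply, Module.End.mul_apply, h2] at h1
  simp only [Module.End.mul_apply, LinearMap.smul_apply, LinearMap.sub_apply, LinearMap.add_apply, Units.val_one,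
    Int.cast_one, one_smul, Module.End.one_apply, map_add, map_smul, hu.H,
    h.o_o_apply b 1 (hu.odd b) (hu.r b)] at h1
  have h3 : (4 * (c * (2 * lam b + 1)) * ((lam b + 2⁻¹) ^ 2 - Q b (ell b + 1) ^ 2)) • u = 0 := by
    rw [h1]
    module
  have hre1 : (2 * lam b + 1).re = 2 * (lam b).re + 1 := by simp
  have hre2 : (lam b + 2⁻¹).re = (lam b).re + 1 / 2 := by norm_num
  have n1 : 2 * lam b + 1 ≠ 0 := fun h0 => by
    rw [h0, Complex.zero_re] at hre1
    linarith
  have n2 := h.sq_sub_sq_ne_zero b (ell b + 1) (c := lam b + 2⁻¹) (by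
    rw [hre2]
    exact le_trans (by linarith) (le_abs_self _))
  simpa [hu0, n1, n2] using h3

end LadderSystem

/-! ### Top vectors: the eigenvalue of `Z`. -/

namespace LadderSystem

variable {M : Type*} [AddCommGroup M] [Module ℂ M] (S : LadderSystem (Module.End ℂ M))

/-- Common eigenvectors for which the values at `κ = 0` of the eigenvalues of `H_1, H_2` are maximal in the
lexicographic order. -/
structure IsTop (lam : Fin 2 → ℂ) (Lam : ℂ) (ell : Fin 2 → ℤ) (v : M) : Prop extends
    S.IsEigenvector lam Lam ell v where
  ne : v ≠ 0
  le_zero {u : M} {c : ℂ} (hu : u ≠ 0) (h0 : S.H 0 u = c • u) : ⌊c.re⌋ ≤ ⌊(lam 0).re⌋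
  le_one {u : M} {c d : ℂ} (hu : u ≠ 0) (h0 : S.H 0 u = c • u) (h1 : S.H 1 u = d • u)
    (hc : ⌊c.re⌋ = ⌊(lam 0).re⌋) : ⌊d.re⌋ ≤ ⌊(lam 1).re⌋

variable {S} {lam : Fin 2 → ℂ} {Lam : ℂ} {ell : Fin 2 → ℤ} {u v : M} {Q : Fin 2 → ℤ → ℂ}

namespace IsTop

/-- Adding 1 to an eigenvalue raises its floor by exactly one, against maximality. -/
theorem eq_zero_of_H_zero (hv : S.IsTop lam Lam ell v) (h0 : S.H 0 u = (lam 0 + 1) • u) : u = 0 := by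
  by_contra hu
  have h := hv.le_zero hu h0
  rw [Complex.add_re, Complex.one_re, Int.floor_add_one] at h
  omega

theorem eq_zero_of_H_one (hv : S.IsTop lam Lam ell v) (h0 : S.H 0 u = lam 0 • u)
    (h1 : S.H 1 u = (lam 1 + 1) • u) : u = 0 := by
  by_contra hu
  have h := hv.le_one hu h0 h1 rfl
  rw [Complex.add_re, Complex.one_re, Int.floor_add_one] at h
  omega

theorem _root_.DunklTAMA.nonneg_of_floor_neg_le {x : ℝ} (h : ⌊-x⌋ ≤ ⌊x⌋) : 0 ≤ x := by
  by_contra! hx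
  have h1 : (0 : ℤ) ≤ ⌊-x⌋ := Int.floor_nonneg.2 (by linarith)
  have h2 : ⌊x⌋ < 0 := Int.floor_lt.2 (by simpa using hx)
  omega

/-- The reflected vector `S.s b v` has eigenvalue -λ_b for `H b` and the same eigenvalue for the
other `H`, so maximality compares the floors of -Re λ_b and Re λ_b. -/
theorem re_nonneg (hv : S.IsTop lam Lam ell v) (h : S.HasParameters Q) (b : Fin 2) : 0 ≤ (lam b).re := by
  have hs := hv.toIsEigenvector.s h b
  have hne := s_apply_ne_zero (S := S) b hv.ne
  apply nonneg_of_floor_neg_le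
  rw [← Complex.neg_re]
  fin_cases b
  · exact hv.le_zero hne (by simpa using hs.H 0)
  · exact hv.le_one hne (by simpa using hs.H 0) (by simpa using hs.H 1) rfl

theorem L_one (hv : S.IsTop lam Lam ell v) (b : Fin 2) : S.L b 1 v = 0 := by
  fin_cases b
  · refine hv.eq_zero_of_H_zero ?_
    show S.H 0 (S.L 0 1 v) = _ • S.L 0 1 v
    rw [H_L_apply, hv.H, map_smul, add_smul]
    simp
  · refine hv.eq_zero_of_H_one ?_ ?_
    · show S.H 0 (S.L 1 1 v) = _ • S.L 1 1 v
      rw [H_L_apply' (by decide), hv.H, map_smul]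
    · show S.H 1 (S.L 1 1 v) = _ • S.L 1 1 v
      rw [H_L_apply, hv.H, map_smul, add_smul]
      simp

theorem add_half_re (hv : S.IsTop lam Lam ell v) (h : S.HasParameters Q) (b : Fin 2) : 1 / 2 ≤ (lam b + 2⁻¹).re := by
  have h1 := hv.re_nonneg h b
  have hre2 : (lam b + 2⁻¹).re = (lam b).re + 1 / 2 := by norm_num
  linarith

theorem add_half_ne_zero (hv : S.IsTop lam Lam ell v) (h : S.HasParameters Q) (b : Fin 2) : lam b + 2⁻¹ ≠ 0 := by
  intro h0
  have h1 := hv.add_half_re h b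
  rw [h0, Complex.zero_re] at h1
  linarith

theorem sq_sub_sq_ne_zero (hv : S.IsTop lam Lam ell v) (h : S.HasParameters Q) (b : Fin 2) (j : ℤ) :
    (lam b + 2⁻¹) ^ 2 - Q b j ^ 2 ≠ 0 :=
  h.sq_sub_sq_ne_zero b j ((hv.add_half_re h b).trans (le_abs_self _))

/-- Evaluate the factorisation on `L b 1 v = 0`. The factor with `Q` cannot vanish, since Re(λ_b +
½) ≥ ½ > |Q|. -/
theorem sq_eq (hv : S.IsTop lam Lam ell v) (h : S.HasParameters Q) {a b : Fin 2} (hab : a ≠ b) :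
    (lam b + 2⁻¹) ^ 2 = (Lam + lam a) ^ 2 := by
  have h1 := hv.L_L h hab 1
  rw [hv.L_one, map_zero] at h1
  have h2 := hv.sq_sub_sq_ne_zero h b (ell b + 1)
  simpa [hv.ne, h2, sub_eq_zero] using h1.symm

/-- The equation `L b 1 v = 0`, solved for `C b 1 v`. -/
theorem C_apply (hv : S.IsTop lam Lam ell v) (h : S.HasParameters Q) {a b : Fin 2} (hab : a ≠ b) :
    S.C b 1 v = ((Lam + lam a) / (lam b + 2⁻¹)) • S.o b 1 v := by
  have h1 := hv.L_apply hab 1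
  have h0 := hv.add_half_ne_zero h b
  rw [hv.L_one] at h1
  have h2 : (lam b + 2⁻¹) • S.C b 1 v = (Lam + lam a) • S.o b 1 v := by
    simp only [Units.val_one, Int.cast_one, one_mul] at h1
    linear_combination (norm := module) -(2⁻¹ : ℂ) • h1
  rw [div_eq_inv_mul, mul_smul, ← h2, inv_smul_smul₀ h0]

theorem A_apply (hv : S.IsTop lam Lam ell v) (h : S.HasParameters Q) :
    S.A 1 v = (-((lam 1 + 2⁻¹ + Lam + lam 0) / ((lam 0 + 2⁻¹) * (lam 1 + 2⁻¹)))) • S.o 0 1 (S.o 1 1 v) := by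
  have h01 : (0 : Fin 2) ≠ 1 := by decide
  have n0 := hv.add_half_ne_zero h 0
  have n1 := hv.add_half_ne_zero h 1
  have h1 := LinearMap.congr_fun (S.A_H_zero 1) v
  have h2 := LinearMap.congr_fun (S.o_H 0 1) (S.o 1 1 v)
  simp only [Module.End.mul_apply, LinearMap.sub_apply, LinearMap.neg_apply, LinearMap.smul_apply, hv.H, map_smul,
    (hv.o h01 1).2.1, hv.C_apply h h01, Units.val_one, Int.cast_one, one_smul, mul_one] at h1 h2
  set X := S.o 0 1 (S.o 1 1 v)
  -- `H 0` maps `A 1 v` to (λ_0 + 1) times itself plus a multiple of `X`, and has eigenvalue -λ_0 on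
  -- `X`. This combination is corrected to be an exact eigenvector for λ_0 + 1, hence zero.
  have h3 : (lam 0 + 2⁻¹) • S.A 1 v + (1 + (Lam + lam 0) / (lam 1 + 2⁻¹)) • X = 0 := by
    refine hv.eq_zero_of_H_zero ?_
    rw [map_add, map_smul, map_smul, ← neg_eq_iff_eq_neg.2 h2]
    linear_combination (norm := module) -((lam 0 + 2⁻¹ : ℂ) • h1)
  have h4 : (lam 0 + 2⁻¹) • S.A 1 v = -(1 + (Lam + lam 0) / (lam 1 + 2⁻¹)) • X := by
    rw [neg_smul, ← add_eq_zero_iff_eq_neg, h3]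
  rw [← inv_smul_smul₀ n0 (S.A 1 v), h4, smul_smul]
  congr 1
  generalize lam 1 + 2⁻¹ = y at n1 ⊢
  generalize lam 0 + 2⁻¹ = x at n0 ⊢
  field_simp
  ring

/-- The two square relations leave one other solution, λ_0 = λ_1 and Λ = ½. There `A_A` becomes a
scalar equation, because `A_apply` and `A_o_o` evaluate `A (-1) * A 1` through the `o`; that
equation contradicts smallness. -/
theorem Lam_eq (hv : S.IsTop lam Lam ell v) (h : S.HasParameters Q) : Lam = -1 / 2 - lam 0 - lam 1 := by
  have h01 : (0 : Fin 2) ≠ 1 := by decide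
  have n0 := hv.add_half_ne_zero h 0
  have n1 := hv.add_half_ne_zero h 1
  have q0 := hv.sq_sub_sq_ne_zero h 0 (ell 0 + 1)
  have q1 := hv.sq_sub_sq_ne_zero h 1 (ell 1 + 1)
  have e0 := hv.sq_eq h h01.symm
  have e1 := hv.sq_eq h h01
  have o0 := h.o_o_apply 0 1 (hv.odd 0) (hv.r 0)
  have o1 := h.o_o_apply 1 1 (hv.odd 1) (hv.r 1)
  have h1 := LinearMap.congr_fun (S.A_A 1) v
  have h2 := LinearMap.congr_fun (S.A_o_o 1) v
  have h3 := LinearMap.congr_fun (S.o_o 1 (-1)) (S.o 1 1 v)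
  simp only [Module.End.mul_apply, LinearMap.sub_apply, LinearMap.neg_apply, LinearMap.smul_apply, LinearMap.add_apply,
    Module.End.one_apply, map_add, map_sub, hv.H, hv.Z, map_smul, hv.C_apply h h01, hv.C_apply h h01.symm, hv.A_apply h,
    Units.val_one, Int.cast_one, one_smul, mul_one, o1] at h1 h2 h3
  rw [h2, h3] at h1
  simp only [map_smul, map_neg, o0] at h1
  by_contra hT
  have hT' : lam 1 + 2⁻¹ + Lam + lam 0 ≠ 0 := fun h0 => hT (by linear_combination h0)
  -- With T = Λ + λ_0 + λ_1 + ½, each square relation reads T (T - 2(λ_b + ½)) = 0.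
  have x_eq : lam 1 + 2⁻¹ + Lam + lam 0 = 2 * (lam 0 + 2⁻¹) :=
    mul_left_cancel₀ hT' (by linear_combination -e0)
  have y_eq : lam 1 + 2⁻¹ + Lam + lam 0 = 2 * (lam 1 + 2⁻¹) :=
    mul_left_cancel₀ hT' (by linear_combination -e1)
  have t0 : (Lam + lam 1) / (lam 0 + 2⁻¹) = 1 := by
    rw [div_eq_one_iff_eq n0]
    linear_combination x_eq
  have t1 : (Lam + lam 0) / (lam 1 + 2⁻¹) = 1 := by
    rw [div_eq_one_iff_eq n1]
    linear_combination y_eq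
  have y_eq_x : lam 1 = lam 0 := by linear_combination (x_eq - y_eq) / 2
  have Lam_eq : Lam = 2⁻¹ := by linear_combination x_eq - y_eq_x
  rw [x_eq, t0, t1, Units.val_one, y_eq_x, Lam_eq, mul_div_mul_right _ _ n0] at h1
  rw [y_eq_x] at q1
  generalize Q 0 (ell 0 + 1) = p at *
  generalize Q 1 (ell 1 + 1) = q at *
  -- For x = λ_0 + ½, multiplying the scalar equation by x²/4 gives x²(x² - p² - q²) + p²q², which
  -- is (x² - p²)(x² - q²).
  have h5 : (((lam 0 + 2⁻¹) ^ 2 - p ^ 2) * ((lam 0 + 2⁻¹) ^ 2 - q ^ 2)) • v = 0 := by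
    have h6 : (4 * ((lam 0 + 2⁻¹) ^ 2 - p ^ 2 - q ^ 2) + (2 / (lam 0 + 2⁻¹)) ^ 2 * (q ^ 2 * p ^ 2)) • v = 0 := by
      linear_combination (norm := module) -h1
    have h7 := congrArg (fun u => ((lam 0 + 2⁻¹) ^ 2 / 4) • u) h6
    simp only [smul_smul, smul_zero] at h7
    rw [← h7]
    congr 1
    generalize lam 0 + 2⁻¹ = x at n0 ⊢
    field_simp
    ring
  simp [hv.ne, q0, q1] at h5

/-- If the sum vanished, both real parts would be 0, and `v` and its reflection in plane 1 would
both be top vectors; `Lam_eq` for the two forces λ_1 = ½, whose real part is not 0. -/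
theorem add_ne_zero (hv : S.IsTop lam Lam ell v) (h : S.HasParameters Q) : lam 0 + lam 1 ≠ 0 := by
  intro h0
  have r0 := hv.re_nonneg h 0
  have r1 := hv.re_nonneg h 1
  have r2 : (lam 0).re + (lam 1).re = 0 := by rw [← Complex.add_re, h0, Complex.zero_re]
  have r3 : (lam 1).re = 0 := by linarith
  have hs := hv.toIsEigenvector.s h 1
  -- As Re λ_1 = 0, the eigenvalues λ_1 and -λ_1 have the same floor.
  have ht : S.IsTop (Function.update lam 1 (-lam 1)) (-Lam) (Function.update ell 1 (-ell 1)) (S.s 1 v) :=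
    { hs with
      ne := s_apply_ne_zero 1 hv.ne
      le_zero := fun hu h0 => by simpa using hv.le_zero hu h0
      le_one := fun hu h0 h1 hc => by simpa [r3] using hv.le_one hu h0 h1 (by simpa using hc) }
  have e1 := hv.Lam_eq h
  have e2 := ht.Lam_eq h
  simp only [Function.update_self, Function.update_of_ne (show (0 : Fin 2) ≠ 1 by decide)] at e2
  have e3 : lam 1 = 2⁻¹ := by linear_combination h0 - (e1 + e2) / 2
  rw [e3] at r3
  norm_num at r3

end IsTop
end LadderSystem

/-! ### Top vectors: vanishing of ladder operators and the value of `lam 1`. -/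

namespace LadderSystem

variable {M : Type*} [AddCommGroup M] [Module ℂ M] {S : LadderSystem (Module.End ℂ M)}
  {lam : Fin 2 → ℂ} {Lam : ℂ} {ell : Fin 2 → ℤ} {u v : M} {Q : Fin 2 → ℤ → ℂ}

theorem _root_.DunklTAMA.ne_zero_of_re_ne_zero {c : ℂ} (h : c.re ≠ 0) : c ≠ 0 := fun h0 => h (by rw [h0, Complex.zero_re])

namespace IsTop

/-- A nonzero `L 1 (-1) v` is still killed by `L 0 1`, which forces λ_1 = ½; the Jordan block
argument then gives Q_1(ℓ_1 - 1) = 0. Both terms of `L_apply` now vanish, one by λ_1 = ½ and the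
other because `o 1 (-1) v = 0`. -/
theorem L_one_neg (hv : S.IsTop lam Lam ell v) (h : S.HasParameters Q) : S.L 1 (-1) v = 0 := by
  have h01 : (0 : Fin 2) ≠ 1 := by decide
  have r0 := hv.re_nonneg h 0
  have r1 := hv.re_nonneg h 1
  have eL := hv.Lam_eq h
  by_contra hw
  have hwe := hv.toIsEigenvector.L h 1 (-1)
  have hw0 : S.L 0 1 (S.L 1 (-1) v) = 0 := hv.eq_zero_of_H_zero (by
    rw [H_L_apply, hwe.H, map_smul]
    simp [add_smul])
  have h1 := hwe.L_L h h01.symm 1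
  rw [hw0, map_zero] at h1
  have q0 := hv.sq_sub_sq_ne_zero h 0 (ell 0 + 1)
  have l1 : lam 1 = 2⁻¹ := by
    -- The second factor of `L_L` at the weight (λ_0, λ_1 - 1, -Λ), after substituting `Lam_eq`.
    have e : (lam 0 + 2⁻¹) ^ 2 - (-Lam + (lam 1 + -1)) ^ 2 = -4 * (lam 1 - 2⁻¹) * (lam 0 + lam 1) := by
      rw [eL]
      ring
    have h2 := h1.symm
    simp only [Function.update_self, Function.update_of_ne h01, Units.val_one, Int.cast_one, one_mul, Units.val_neg,
      Int.cast_neg, e] at h2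
    simpa [hw, q0, hv.add_ne_zero h, sub_eq_zero] using h2
  have rLam : (lam 0 - Lam).re = 1 + 2 * (lam 0).re := by
    have e : lam 0 - Lam = 1 + 2 * lam 0 := by
      rw [eL, l1]
      ring
    rw [e]
    simp
  have nLam : lam 0 - Lam ≠ 0 := ne_zero_of_re_ne_zero (by rw [rLam]; positivity)
  have hq : Q 1 (ell 1 - 1) = 0 := by
    obtain ⟨j1, j0, jZ⟩ := hv.H_s_C h h01 l1
    have hc := hv.jordan_eq_zero h h01 hv.ne (by rw [eL]; ring) r1 (by rw [l1]; exact j1) j0 jZ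
      -- `L 1 1` kills `v`, so it turns the Jordan pair into an honest eigenvector one step above
      -- `v`.
      (hv.eq_zero_of_H_one (by rw [H_L_apply' h01, j0, map_smul]) (by
        rw [H_L_apply, j1, map_add, map_smul, map_smul, hv.L_one, smul_zero, add_zero, l1, add_smul]
        simp))
    simpa [nLam] using hc
  apply hw
  have h3 := hv.L_apply h01 (-1)
  rw [h.o_apply 1 (-1) (hv.odd 1) (hv.r 1), Units.val_neg, Units.val_one, ← sub_eq_add_neg, hq] at h3
  rw [h3, l1]
  simp

/-- Since `L 1 (-1) v = 0`, the factorisation vanishes on `v`; its second factor is -2(λ_0 + λ_1)(1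
+ 2λ_0) ≠ 0, so the first one, (½ - λ_1)² - Q², is zero. -/
theorem lam_one (hv : S.IsTop lam Lam ell v) (h : S.HasParameters Q) :
    lam 1 = 1 / 2 + Q 1 (ell 1 - 1) ∨ lam 1 = 1 / 2 - Q 1 (ell 1 - 1) := by
  have h01 : (0 : Fin 2) ≠ 1 := by decide
  have r0 := hv.re_nonneg h 0
  have h1 := hv.L_L h h01 (-1)
  rw [hv.L_one_neg h, map_zero] at h1
  have e : (-1 * lam 1 + 2⁻¹) ^ 2 - (Lam + -1 * lam 0) ^ 2 = -2 * (lam 0 + lam 1) * (1 + 2 * lam 0) := by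
    rw [hv.Lam_eq h]
    ring
  have n : 1 + 2 * lam 0 ≠ 0 := ne_zero_of_re_ne_zero (by
    simp only [Complex.add_re, Complex.one_re, Complex.mul_re, Complex.re_ofNat, Complex.im_ofNat, zero_mul, sub_zero]
    positivity)
  have h2 := h1.symm
  simp only [Units.val_one, Int.cast_one, Units.val_neg, Int.cast_neg, e, ← sub_eq_add_neg] at h2
  have h3 : (-1 * lam 1 + 2⁻¹) ^ 2 - Q 1 (ell 1 - 1) ^ 2 = 0 := by
    simpa [hv.ne, n, hv.add_ne_zero h] using h2
  rcases sq_eq_sq_iff_eq_or_eq_neg.1 (sub_eq_zero.1 h3) with e | e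
  · right
    linear_combination -e
  · left
    linear_combination -e

/-- In `L_zero_L_one` the left side kills `v`, and `LL (-1) v` is a common eigenvector up to
vanishing; the resulting coefficient is a nonzero multiple of 1 + 2λ_0. -/
theorem LL_neg (hv : S.IsTop lam Lam ell v) (h : S.HasParameters Q) : S.LL (-1) v = 0 := by
  have r0 := hv.re_nonneg h 0
  have h1 := LinearMap.congr_fun S.L_zero_L_one v
  have h2 := LinearMap.congr_fun (S.LL_H (-1)).1 v
  have h3 := LinearMap.congr_fun (S.LL_H (-1)).2.1 v
  have h4 := LinearMap.congr_fun (S.LL_H (-1)).2.2 v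
  simp only [Module.End.mul_apply, LinearMap.sub_apply, LinearMap.add_apply, LinearMap.smul_apply, hv.H, hv.Z, map_smul,
    hv.L_one_neg h, map_zero, Units.val_one, Int.cast_one, Units.val_neg, Int.cast_neg] at h1 h2 h3 h4
  have h5 : (1 + 2 * lam 0) • S.LL (-1) v = 0 := by
    have e : 1 + 2 * lam 0 = -(Lam - 2⁻¹ - lam 0 + lam 1) := by
      rw [hv.Lam_eq h]
      ring
    rw [e]
    linear_combination (norm := module) h1 - h4 + (2⁻¹ : ℂ) • h2 - (2⁻¹ : ℂ) • h3
  have n : 1 + 2 * lam 0 ≠ 0 := ne_zero_of_re_ne_zero (by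
    simp only [Complex.add_re, Complex.one_re, Complex.mul_re, Complex.re_ofNat, Complex.im_ofNat, zero_mul, sub_zero]
    positivity)
  simpa [n] using h5

end IsTop
end LadderSystem

/-! ### The chain of lowered vectors and the value of `lam 0`. -/

namespace LadderSystem

variable {M : Type*} [AddCommGroup M] [Module ℂ M] {S : LadderSystem (Module.End ℂ M)}
  {lam : Fin 2 → ℂ} {Lam : ℂ} {ell : Fin 2 → ℤ} {u v : M} {Q : Fin 2 → ℤ → ℂ}

theorem IsEigenvector.chain (hv : S.IsEigenvector lam Lam ell v) (h : S.HasParameters Q) (k : ℕ) :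
    S.IsEigenvector ![lam 0 - k, lam 1 + k] Lam ![ell 0 - 2 * k, ell 1 + 2 * k] (((S.L 1 1 * S.L 0 (-1)) ^ k) v) := by
  induction k with
  | zero =>
    rw [pow_zero, Module.End.one_apply]
    convert hv using 1
    · funext i
      fin_cases i <;> simp
    · funext i
      fin_cases i <;> simp
  | succ k ih =>
    rw [pow_succ', Module.End.mul_apply, Module.End.mul_apply]
    convert (ih.L h 0 (-1)).L h 1 1 using 1
    · funext i
      fin_cases i <;> simp <;> ring
    · rw [neg_neg]
    · funext i
      fin_cases i <;> simp <;> ring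

namespace IsTop

/-- The sign of Λ is restored after each full step of the chain, so the factorisation applies with
the original Λ. -/
theorem raise_lower (hv : S.IsTop lam Lam ell v) (h : S.HasParameters Q) (k : ℕ) :
    S.L 0 1 (S.L 0 (-1) (((S.L 1 1 * S.L 0 (-1)) ^ k) v))
      = (-8 * ((k + 2⁻¹ - lam 0) ^ 2 - Q 0 (ell 0 - 2 * k - 1) ^ 2) * (lam 0 + lam 1) * (2 * (lam 1 + k + 2⁻¹)))
        • ((S.L 1 1 * S.L 0 (-1)) ^ k) v := by
  have h1 := (hv.chain h k).L_L h (show (1 : Fin 2) ≠ 0 by decide) (-1)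
  simp only [neg_neg, Units.val_neg, Units.val_one, Int.cast_neg, Int.cast_one, Matrix.cons_val_zero,
    Matrix.cons_val_one, ← sub_eq_add_neg] at h1
  rw [h1, hv.Lam_eq h]
  congr 1
  ring

/-- Halfway through a step the eigenvalue of `Z` is -Λ, which is where the factor k + ½ - λ_0 comes
from. -/
theorem lower_raise (hv : S.IsTop lam Lam ell v) (h : S.HasParameters Q) (k : ℕ) :
    S.L 1 (-1) (S.L 1 1 (S.L 0 (-1) (((S.L 1 1 * S.L 0 (-1)) ^ k) v)))
      = (16 * ((lam 1 + k + 2⁻¹) ^ 2 - Q 1 (ell 1 + 2 * k + 1) ^ 2) * (k + 2⁻¹ - lam 0) * (lam 0 + lam 1))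
        • S.L 0 (-1) (((S.L 1 1 * S.L 0 (-1)) ^ k) v) := by
  have h1 := ((hv.chain h k).L h 0 (-1)).L_L h (show (0 : Fin 2) ≠ 1 by decide) 1
  simp only [neg_neg, Units.val_neg, Units.val_one, Int.cast_neg, Int.cast_one, Matrix.cons_val_zero,
    Matrix.cons_val_one, ← sub_eq_add_neg, Function.update_self, Function.update_of_ne (show (1 : Fin 2) ≠ 0 by decide),
    one_mul] at h1
  rw [h1, hv.Lam_eq h]
  congr 1
  ring

theorem re_shift (hv : S.IsTop lam Lam ell v) (h : S.HasParameters Q) (k : ℕ) : 1 / 2 ≤ (lam 1 + k + 2⁻¹).re := by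
  have h1 := hv.re_nonneg h 1
  have hre2 : (lam 1 + k + 2⁻¹).re = (lam 1).re + k + 1 / 2 := by norm_num
  have := k.cast_nonneg (α := ℝ)
  linarith

theorem lower_raise_ne (hv : S.IsTop lam Lam ell v) (h : S.HasParameters Q) (k : ℕ) (j : ℤ) :
    (lam 1 + k + 2⁻¹) ^ 2 - Q 1 j ^ 2 ≠ 0 ∧ lam 1 + k + 2⁻¹ ≠ 0 :=
  ⟨h.sq_sub_sq_ne_zero 1 _ ((hv.re_shift h k).trans (le_abs_self _)),
    ne_zero_of_re_ne_zero (by linarith [hv.re_shift h k])⟩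

/-- Going back along the chain. -/
theorem back (hv : S.IsTop lam Lam ell v) (h : S.HasParameters Q) {N : ℕ} (hl : lam 0 = N + 2⁻¹) (k : ℕ) (hk : k ≤ N) :
    ∃ c : ℂ, c ≠ 0 ∧ ((S.L 0 1 * S.L 1 (-1)) ^ k) (((S.L 1 1 * S.L 0 (-1)) ^ k) v) = c • v := by
  induction k with
  | zero => exact ⟨1, one_ne_zero, by simp⟩
  | succ k ih =>
    obtain ⟨c, hc, e⟩ := ih (by omega)
    have hd : ((k : ℂ) + 2⁻¹ - lam 0) = -((N - k : ℕ) : ℂ) := by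
      rw [hl, Nat.cast_sub (by omega)]
      ring
    have hd0 : ((N - k : ℕ) : ℂ) ≠ 0 := Nat.cast_ne_zero.2 (by omega)
    have h1 := hv.raise_lower h k
    have h2 := hv.lower_raise h k
    have h3 := congrArg (S.L 0 1) h2
    rw [map_smul, h1, smul_smul] at h3
    rw [pow_succ (S.L 0 1 * _), pow_succ' (S.L 1 1 * _)]
    simp only [Module.End.mul_apply, h3, map_smul, e, smul_smul]
    refine ⟨_, ?_, rfl⟩
    rw [hd]
    -- Before the last position N - k is an integer at least 1, which exceeds every |Q|.
    have n1 : (-((N - k : ℕ) : ℂ)) ^ 2 - Q 0 (ell 0 - 2 * k - 1) ^ 2 ≠ 0 := by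
      refine h.sq_sub_sq_ne_zero 0 _ ?_
      rw [Complex.neg_re, Complex.natCast_re, abs_neg, Nat.abs_cast]
      have : (1 : ℝ) ≤ ((N - k : ℕ) : ℝ) := Nat.one_le_cast.2 (by omega)
      linarith
    obtain ⟨n2, n3⟩ := hv.lower_raise_ne h k (ell 1 + 2 * k + 1)
    have n4 := hv.add_ne_zero h
    have n7 : (-8 : ℂ) ≠ 0 := by norm_num
    exact mul_ne_zero (mul_ne_zero (mul_ne_zero (mul_ne_zero (mul_ne_zero (by norm_num) n2) (neg_ne_zero.2 hd0)) n4)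
      (mul_ne_zero (mul_ne_zero (mul_ne_zero n7 n1) n4) (mul_ne_zero two_ne_zero n3))) hc

/-- Nonzero vectors along an endless chain would give infinitely many eigenvalues λ_0 - k of `H 0`.
-/
theorem exists_end [FiniteDimensional ℂ M] (hv : S.IsTop lam Lam ell v) (h : S.HasParameters Q) :
    ∃ N : ℕ, ((S.L 1 1 * S.L 0 (-1)) ^ N) v ≠ 0 ∧ ((S.L 1 1 * S.L 0 (-1)) ^ (N + 1)) v = 0 := by
  by_contra! hN
  have h1 : ∀ k : ℕ, ((S.L 1 1 * S.L 0 (-1)) ^ k) v ≠ 0 := fun k => by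
    induction k with
    | zero => exact hv.ne
    | succ k ih => exact hN k ih
  have h2 : ∀ k : ℕ, (S.H 0).HasEigenvalue (lam 0 - k) := fun k =>
    Module.End.hasEigenvalue_of_hasEigenvector (x := ((S.L 1 1 * S.L 0 (-1)) ^ k) v)
      (Module.End.hasEigenvector_iff.2 ⟨Module.End.mem_eigenspace_iff.2 ((hv.chain h k).H 0), h1 k⟩)
  have h3 : Function.Injective fun k : ℕ => lam 0 - (k : ℂ) := fun i j hij => by
    simpa using hij
  exact Set.infinite_of_injective_forall_mem h3 h2 (Module.End.finite_hasEigenvalue (S.H 0))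

/-- The chain ends at N because the scalar of `lower_raise` or that of `raise_lower` degenerates
there; smallness and `add_ne_zero` leave only the possibilities λ_0 = N + ½ and (N + ½ - λ_0)² = Q².
-/
theorem lam_zero [FiniteDimensional ℂ M] (hv : S.IsTop lam Lam ell v) (h : S.HasParameters Q) :
    ∃ N : ℕ, lam 0 = N + 1 / 2 + Q 0 (ell 0 - 2 * N - 1) ∨ lam 0 = N + 1 / 2 - Q 0 (ell 0 - 2 * N - 1) := by
  obtain ⟨N, hN, hN1⟩ := hv.exists_end h
  have h01 : (0 : Fin 2) ≠ 1 := by decide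
  have n4 := hv.add_ne_zero h
  have eL := hv.Lam_eq h
  obtain ⟨n2, n3⟩ := hv.lower_raise_ne h N (ell 1 + 2 * N + 1)
  refine ⟨N, ?_⟩
  -- If λ_0 = N + ½, the scalar of `lower_raise` vanishes and the end of the chain gives no
  -- equation; it has to be shown that Q_0 = 0 there.
  by_cases hl : lam 0 = N + 2⁻¹
  · suffices hq : Q 0 (ell 0 - 2 * N - 1) = 0 by
      left
      rw [hq, hl]
      ring
    have hc := hv.chain h N
    obtain ⟨j0, j1, jZ⟩ := hc.H_s_C h h01.symm (by simp [hl])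
    obtain ⟨c, hc0, hback⟩ := hv.back h hl N le_rfl
    simp only [Matrix.cons_val_zero, Matrix.cons_val_one] at j0 j1 jZ
    set w := S.s 0 (S.C 0 (-1) (((S.L 1 1 * S.L 0 (-1)) ^ N) v))
    set d := 2 * (lam 1 + N - Lam) * (Complex.I * Q 0 (ell 0 - 2 * N - 1))
    -- Going back along the chain shifts both members of the Jordan pair equally, so the
    -- off-diagonal coefficient `d` is unchanged until the block sits above a nonzero multiple of
    -- `v`.
    have key : ∀ k : ℕ, S.H 0 (((S.L 0 1 * S.L 1 (-1)) ^ k) w) = (k + 2⁻¹ : ℂ) • ((S.L 0 1 * S.L 1 (-1)) ^ k) w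
        + d • ((S.L 0 1 * S.L 1 (-1)) ^ k) (((S.L 1 1 * S.L 0 (-1)) ^ N) v) ∧
        S.H 1 (((S.L 0 1 * S.L 1 (-1)) ^ k) w) = (lam 1 + N - k) • ((S.L 0 1 * S.L 1 (-1)) ^ k) w ∧
        S.Z (((S.L 0 1 * S.L 1 (-1)) ^ k) w) = Lam • ((S.L 0 1 * S.L 1 (-1)) ^ k) w := fun k => by
      induction k with
      | zero => simp [j0, j1, jZ]
      | succ k ih =>
        obtain ⟨i0, i1, iZ⟩ := ih
        simp only [pow_succ' _ k, Module.End.mul_apply]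
        refine ⟨?_, ?_, ?_⟩
        · rw [H_L_apply, H_L_apply' h01, i0]
          simp only [map_add, map_smul, Units.val_one, Int.cast_one]
          push_cast
          module
        · rw [H_L_apply' h01.symm, H_L_apply, i1]
          simp only [map_add, map_smul, Units.val_one, Int.cast_one, Units.val_neg, Int.cast_neg]
          push_cast
          module
        · rw [Z_L_apply, Z_L_apply, iZ]
          simp
    obtain ⟨i0, i1, iZ⟩ := key N
    rw [hback, smul_smul, ← hl] at i0
    rw [add_sub_cancel_right] at i1
    have hd := hv.jordan_eq_zero h h01.symm hv.ne (by rw [eL]; ring) (hv.re_nonneg h 0) i0 i1 iZ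
      (hv.eq_zero_of_H_zero (by
        rw [H_L_apply, i0, map_add, map_smul, map_smul, hv.L_one, smul_zero, add_zero, add_smul]
        simp))
    have n5 : lam 1 + N - Lam ≠ 0 := ne_zero_of_re_ne_zero (by
      have e : lam 1 + N - Lam = 2⁻¹ + lam 0 + lam 1 + (lam 1 + N + 2⁻¹) - 2⁻¹ := by
        rw [eL]
        ring
      have e2 : (lam 1 + N - Lam).re = (lam 0).re + (lam 1).re + (lam 1 + N + 2⁻¹).re := by
        rw [e]
        simp only [Complex.add_re, Complex.sub_re]
        ring
      rw [e2]
      linarith [hv.re_nonneg h 0, hv.re_nonneg h 1, hv.re_shift h N])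
    simpa [d, hc0, n5] using hd
  · have h1 := hv.lower_raise h N
    have h2 := hv.raise_lower h N
    have e : S.L 1 1 (S.L 0 (-1) (((S.L 1 1 * S.L 0 (-1)) ^ N) v)) = 0 := by
      rw [← hN1, pow_succ', Module.End.mul_apply, Module.End.mul_apply]
    have n6 : (N : ℂ) + 2⁻¹ - lam 0 ≠ 0 := fun h0 => hl (by linear_combination -h0)
    rw [e, map_zero] at h1
    -- The scalar in `lower_raise` is nonzero, so it is the lowering operator `L 0 (-1)` that ends
    -- the chain.
    have h3 : S.L 0 (-1) (((S.L 1 1 * S.L 0 (-1)) ^ N) v) = 0 := by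
      simpa [n2, n4, n6] using h1.symm
    rw [h3, map_zero] at h2
    have h4 : ((N : ℂ) + 2⁻¹ - lam 0) ^ 2 - Q 0 (ell 0 - 2 * N - 1) ^ 2 = 0 := by
      simpa [n3, n4, hN] using h2.symm
    rcases sq_eq_sq_iff_eq_or_eq_neg.1 (sub_eq_zero.1 h4) with e | e
    · right
      linear_combination -e
    · left
      linear_combination -e

end IsTop
end LadderSystem

/-! ### Dihedral relations, invariance of `κ` and the parameters `Q`. -/

theorem root_add_root (m : Fin 2 → ℕ) (a : Fin 2) (p : ℕ) :
    root m a p + root m a (p + 2) = (2 * (Real.cos (Real.pi / m a) : ℂ)) • root m a (p + 1) := by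
  have e1 : ((p + 1 : ℕ) : ℝ) * Real.pi / m a = p * Real.pi / m a + Real.pi / m a := by push_cast; ring
  have e2 : ((p + 2 : ℕ) : ℝ) * Real.pi / m a = p * Real.pi / m a + Real.pi / m a + Real.pi / m a := by push_cast; ring
  have hs : ((Real.sin (Real.pi / m a) : ℝ) : ℂ) ^ 2 = 1 - ((Real.cos (Real.pi / m a) : ℝ) : ℂ) ^ 2 := by
    rw [eq_sub_iff_add_eq]
    exact_mod_cast Real.sin_sq_add_cos_sq _
  simp only [root, e1, e2, Real.sin_add, Real.cos_add]
  simp only [Complex.ofReal_add, Complex.ofReal_sub, Complex.ofReal_mul]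
  push_cast at hs
  match_scalars
  · linear_combination (-Complex.sin (p * Real.pi / m a)) * hs
  · linear_combination Complex.cos (p * Real.pi / m a) * hs

theorem form_root_succ (m : Fin 2 → ℕ) (a : Fin 2) (p : ℕ) :
    form (root m a p) (root m a (p + 1)) = Real.cos (Real.pi / m a) := by
  have e1 : Real.pi / m a = ((p + 1 : ℕ) : ℝ) * Real.pi / m a - p * Real.pi / m a := by push_cast; ring
  rw [e1, Real.cos_sub]
  simp only [root, map_sub, map_smul, LinearMap.sub_apply, LinearMap.smul_apply, form_basisVec,
    smul_eq_mul, Prod.mk.injEq, true_and, if_true, zero_ne_one, one_ne_zero, if_false]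
  push_cast
  ring

theorem refl_succ_root (m : Fin 2 → ℕ) (a : Fin 2) (p : ℕ) : refl m a (p + 1) (root m a p) = -root m a (p + 2) := by
  rw [refl_apply, form_root_succ, ← root_add_root]
  abel

/-- The reflection in α_{p+1} sends α_p to -α_{p+2}, so it conjugates the one reflection into the
other. -/
theorem refl_refl (m : Fin 2 → ℕ) (a : Fin 2) (p : ℕ) (x : V) :
    refl m a (p + 1) (refl m a p x) = refl m a (p + 2) (refl m a (p + 1) x) := by
  rw [refl_apply m a p, map_sub, map_smul, refl_succ_root, refl_apply m a (p + 2), ← form_refl m a (p + 1) x,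
    refl_succ_root, map_neg]
  module

theorem reflW_mul_reflW (m : Fin 2 → ℕ) (a : Fin 2) (p : ℕ) :
    reflW m a (p + 1) * reflW m a p = reflW m a (p + 2) * reflW m a (p + 1) :=
  Subtype.ext (LinearEquiv.ext fun x => refl_refl m a p x)

section Invariance

variable {m : Fin 2 → ℕ} {κ : V → ℂ}

theorem IsInvariant.refl (hκ : IsInvariant m κ) (a : Fin 2) (p q : ℕ) : κ (refl m a p (root m a q)) = κ (root m a q) :=
  hκ _ (reflW m a p).2 _ ⟨a, q, rfl⟩

theorem IsInvariant.neg (hκ : IsInvariant m κ) (a : Fin 2) (p : ℕ) : κ (-root m a p) = κ (root m a p) := by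
  rw [← refl_root, hκ.refl]

theorem IsInvariant.add_two (hκ : IsInvariant m κ) (a : Fin 2) (p : ℕ) : κ (root m a (p + 2)) = κ (root m a p) := by
  rw [← hκ.neg, ← refl_succ_root, hκ.refl]

theorem IsInvariant.add_two_mul (hκ : IsInvariant m κ) (a : Fin 2) (p n : ℕ) :
    κ (root m a (p + 2 * n)) = κ (root m a p) := by
  induction n with
  | zero => rfl
  | succ n ih => rw [mul_add, mul_one, ← add_assoc, hκ.add_two, ih]

/-- For odd m, the rule α_{p+m} = -α_p changes the parity of the index, so the two classes of roots
merge. -/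
theorem IsInvariant.eq_one (hκ : IsInvariant m κ) {a : Fin 2} (hm : 1 ≤ m a) (ho : Odd (m a)) (p : ℕ) :
    κ (root m a p) = κ (root m a 1) := by
  obtain ⟨n, hn⟩ := ho
  rcases Nat.even_or_odd' p with ⟨k, rfl | rfl⟩
  · rw [← hκ.neg, ← root_add_self m hm, show 2 * k + m a = 1 + 2 * (k + n) by omega, hκ.add_two_mul]
  · rw [add_comm, hκ.add_two_mul]

end Invariance

theorem isPrimitiveRoot_zetaRoot {m : Fin 2 → ℕ} {a : Fin 2} (hm : 1 ≤ m a) :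
    IsPrimitiveRoot (zetaRoot m a) (2 * m a) := by
  have h := Complex.isPrimitiveRoot_exp (2 * m a) (by omega)
  have h0 : (m a : ℂ) ≠ 0 := Nat.cast_ne_zero.mpr (by omega)
  rw [zetaRoot]
  convert h using 2
  push_cast
  field_simp

theorem sum_range_two_mul {N : Type*} [AddCommMonoid N] (f : ℕ → N) (n : ℕ) :
    ∑ i ∈ Finset.range (2 * n), f i = ∑ i ∈ Finset.range n, (f (2 * i) + f (2 * i + 1)) := by
  induction n with
  | zero => rfl
  | succ n ih => rw [mul_add, mul_one, Finset.sum_range_succ, Finset.sum_range_succ, ih, Finset.sum_range_succ, add_assoc]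

theorem geom_sum_root_of_unity {x : ℂ} {n : ℕ} (hx : x ^ n = 1) :
    ∑ i ∈ Finset.range n, x ^ i = if x = 1 then (n : ℂ) else 0 := by
  split_ifs with h
  · simp [h]
  · rw [geom_sum_eq h, hx, sub_self, zero_div]

theorem Q_neg (m : Fin 2 → ℕ) (κ : V → ℂ) (a : Fin 2) (j : ℤ) : Q m κ a (-j) = Q m κ a j := by
  have h0 : -j ≡ 0 [ZMOD 2 * m a] ↔ j ≡ 0 [ZMOD 2 * m a] := by
    rw [Int.modEq_zero_iff_dvd, Int.modEq_zero_iff_dvd, dvd_neg]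
  have h1 : -j ≡ m a [ZMOD 2 * m a] ↔ j ≡ m a [ZMOD 2 * m a] := by
    rw [Int.modEq_iff_dvd, Int.modEq_iff_dvd, ← dvd_neg, ← dvd_add_right (dvd_refl (2 * (m a : ℤ)))]
    have : 2 * (m a : ℤ) + -(m a - -j) = m a - j := by ring
    rw [this]
  simp only [Q, h0, h1]

/-- The parameter `Q` is the discrete Fourier transform of κ along the positive roots. Since κ
depends at most on the parity of p, the sum consists of one or two geometric sums over roots of
unity. -/
theorem sum_zeta_eq_Q {m : Fin 2 → ℕ} {κ : V → ℂ} (hκ : IsInvariant m κ) {a : Fin 2} (hm : 1 ≤ m a) {j : ℤ}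
    (hj : Even j) : ∑ p ∈ Finset.Icc 1 (m a), κ (root m a p) * zetaRoot m a ^ (j * p) = Q m κ a j := by
  have hz := isPrimitiveRoot_zetaRoot hm
  have hz0 := zetaRoot_ne_zero m a
  have hone : zetaRoot m a ^ j = 1 ↔ j ≡ 0 [ZMOD 2 * m a] := by
    rw [hz.zpow_eq_one_iff_dvd, Int.modEq_zero_iff_dvd]
    push_cast
    rfl
  have hmj : zetaRoot m a ^ (j * m a) = 1 := by
    rw [mul_comm, zpow_mul, zpow_natCast, zetaRoot_pow_self hm, hj.neg_one_zpow]
  have hsum : ∑ p ∈ Finset.Icc 1 (m a), κ (root m a p) * zetaRoot m a ^ (j * p)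
      = ∑ i ∈ Finset.range (m a), κ (root m a (i + 1)) * (zetaRoot m a ^ j * zetaRoot m a ^ (j * i)) := by
    rw [← Finset.Ico_succ_right_eq_Icc, Finset.sum_Ico_eq_sum_range, Order.succ_eq_add_one, Nat.add_sub_cancel]
    refine Finset.sum_congr rfl fun i _ => ?_
    rw [add_comm 1 i, ← zpow_add₀ hz0]
    push_cast
    ring_nf
  rw [hsum]
  rcases Nat.even_or_odd (m a) with he | ho
  · obtain ⟨n, hn⟩ := he.two_dvd
    have hodd : ¬ Odd (m a) := Nat.not_odd_iff_even.2 he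
    -- Consecutive odd and even indices are paired; the ratio is ζ^{2j}, so the sum survives exactly
    -- for ζ^j = ±1, which gives the two nonzero cases.
    have e1 : ∀ i : ℕ, κ (root m a (2 * i + 1)) * (zetaRoot m a ^ j * zetaRoot m a ^ (j * (2 * i : ℕ)))
        + κ (root m a (2 * i + 1 + 1)) * (zetaRoot m a ^ j * zetaRoot m a ^ (j * (2 * i + 1 : ℕ)))
        = (κ (root m a 1) * zetaRoot m a ^ j + κ (root m a 2) * zetaRoot m a ^ (2 * j)) * (zetaRoot m a ^ (2 * j)) ^ i := by
      intro i
      rw [add_comm (2 * i) 1, hκ.add_two_mul, show 1 + 2 * i + 1 = 2 + 2 * i by ring, hκ.add_two_mul, add_mul, mul_assoc,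
        mul_assoc, ← zpow_natCast, ← zpow_mul, ← zpow_add₀ hz0, ← zpow_add₀ hz0, ← zpow_add₀ hz0, ← zpow_add₀ hz0]
      push_cast
      ring_nf
    have hx : (zetaRoot m a ^ (2 * j)) ^ n = 1 := by
      rw [← zpow_natCast, ← zpow_mul, ← hmj, hn]
      push_cast
      ring_nf
    have htwo : zetaRoot m a ^ (2 * j) = 1 ↔ zetaRoot m a ^ j = 1 ∨ zetaRoot m a ^ j = -1 := by
      rw [two_mul, zpow_add₀ hz0, mul_self_eq_one_iff]
    have hmone : zetaRoot m a ^ j = -1 ↔ j ≡ m a [ZMOD 2 * m a] := by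
      rw [← zetaRoot_pow_self hm, ← zpow_natCast, Int.modEq_comm, Int.modEq_iff_dvd, ← div_eq_one_iff_eq (zpow_ne_zero _ hz0),
        ← zpow_sub₀ hz0, hz.zpow_eq_one_iff_dvd]
      push_cast
      rfl
    have hnc : (m a : ℂ) / 2 = n := by
      rw [hn]
      push_cast
      ring
    rw [hn, sum_range_two_mul, Finset.sum_congr rfl fun i _ => e1 i, ← Finset.mul_sum, geom_sum_root_of_unity hx]
    rw [Q]
    simp only [hodd, he, false_and, true_and, if_false, ← hone, ← hmone, htwo, hnc]
    by_cases h1 : zetaRoot m a ^ j = 1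
    · rw [if_pos (Or.inl h1), if_pos h1, htwo.2 (Or.inl h1), h1]
      ring
    · by_cases h2 : zetaRoot m a ^ j = -1
      · rw [if_pos (Or.inr h2), if_neg h1, if_pos h2, htwo.2 (Or.inr h2), h2]
        ring
      · rw [if_neg (not_or.2 ⟨h1, h2⟩), if_neg h1, if_neg h2, mul_zero]
  · have heven : ¬ Even (m a) := Nat.not_even_iff_odd.2 ho
    rw [Q]
    simp only [ho, heven, false_and, true_and, if_false, ← hone]
    have e1 : ∀ i : ℕ, κ (root m a (i + 1)) * (zetaRoot m a ^ j * zetaRoot m a ^ (j * i))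
        = κ (root m a 1) * zetaRoot m a ^ j * (zetaRoot m a ^ j) ^ i := fun i => by
      rw [hκ.eq_one hm ho, zpow_mul, zpow_natCast, mul_assoc]
    have hx : (zetaRoot m a ^ j) ^ m a = 1 := by rw [← zpow_natCast, ← zpow_mul, hmj]
    rw [Finset.sum_congr rfl fun i _ => e1 i, ← Finset.mul_sum, geom_sum_root_of_unity hx]
    split_ifs with h1
    · rw [h1]
      ring
    · rw [mul_zero]

/-! ### Reflections as powers of the rotation. -/

section Rotations

variable (m : Fin 2 → ℕ) (κ : V → ℂ)

theorem sRefl_mul_sRefl (a : Fin 2) (p : ℕ) :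
    sRefl m κ a (p + 1) * sRefl m κ a p = sRefl m κ a (p + 2) * sRefl m κ a (p + 1) := by
  simp only [sRefl, Algebra.TensorProduct.tmul_mul_tmul]
  rw [← map_mul (hw m κ), ← map_mul (hw m κ), reflW_mul_reflW, gam_root_mul, refl_succ_root, map_neg, neg_mul, neg_neg]

theorem sRefl_mul_sRefl_succ (a : Fin 2) (p : ℕ) :
    sRefl m κ a p * sRefl m κ a (p + 1) = sRefl m κ a 0 * sRefl m κ a 1 := by
  induction p with
  | zero => rfl
  | succ p ih =>
    rw [← ih, ← mul_one (sRefl m κ a (p + 1) * sRefl m κ a (p + 1 + 1)), ← sRefl_sq m κ a (p + 1), ← mul_assoc,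
      mul_assoc (sRefl m κ a (p + 1)), ← sRefl_mul_sRefl, ← mul_assoc, sRefl_sq, one_mul]

/-- Products of consecutive reflections s̃_p s̃_{p+1} all equal the same rotation, so s̃_{p+1} is
s̃_p times it. -/
theorem sRefl_eq (a : Fin 2) (p : ℕ) :
    sRefl m κ a p = sRefl m κ a 0 * (sRefl m κ a 0 * sRefl m κ a 1) ^ p := by
  induction p with
  | zero => rw [pow_zero, mul_one]
  | succ p ih =>
    rw [pow_succ, ← mul_assoc, ← ih, ← sRefl_mul_sRefl_succ m κ a p, ← mul_assoc, sRefl_sq, one_mul]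

/-- Compare s̃_m = s̃_0 r^m with s̃_m = -s̃_0, which comes from α_m = -α_0. -/
theorem rotation_pow {a : Fin 2} (hm : 1 ≤ m a) : (sRefl m κ a 0 * sRefl m κ a 1) ^ m a = -1 := by
  have h := sRefl_add_self m κ hm 0
  rw [zero_add, sRefl_eq] at h
  have h2 := congrArg (fun u => sRefl m κ a 0 * u) h
  simp only [mul_neg] at h2
  rwa [← mul_assoc, sRefl_sq, one_mul] at h2

theorem symP_gam_zvec (b : Fin 2) (ε : ℤˣ) : symP m κ (gam (zvec b ε))
    = ∑ p ∈ Finset.Icc 1 (m b), (-(Complex.I * ((ε : ℤ) : ℂ)) * (κ (root m b p) * zetaRoot m b ^ ((ε : ℤ) * p)))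
      • (sRefl m κ b 0 * (sRefl m κ b 0 * sRefl m κ b 1) ^ p) := by
  rw [symP_gam_eq_sum]
  refine Finset.sum_congr rfl fun p _ => ?_
  rw [sRefl_eq, form_zvec_root_eq]
  congr 1
  ring

end Rotations

/-! ### Restricting and transporting ladder systems. -/

namespace LadderSystem

variable {B : Type*} [Ring B] [Algebra ℂ B]

/-- The restriction of a ladder system to a subalgebra that contains it. -/
def restrict (S : LadderSystem B) (T : Subalgebra ℂ B) (hH : ∀ b, S.H b ∈ T) (hZ : S.Z ∈ T) (hC : ∀ b ε, S.C b ε ∈ T)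
    (ho : ∀ b ε, S.o b ε ∈ T) (hA : ∀ ε, S.A ε ∈ T) (hs : ∀ b, S.s b ∈ T) (hr : ∀ b, S.r b ∈ T) : LadderSystem T where
  H b := ⟨S.H b, hH b⟩
  Z := ⟨S.Z, hZ⟩
  C b ε := ⟨S.C b ε, hC b ε⟩
  o b ε := ⟨S.o b ε, ho b ε⟩
  A ε := ⟨S.A ε, hA ε⟩
  s b := ⟨S.s b, hs b⟩
  r b := ⟨S.r b, hr b⟩
  zeta := S.zeta
  H_H a b := Subtype.ext (S.H_H a b)
  H_Z b := Subtype.ext (S.H_Z b)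
  r_H a b := Subtype.ext (S.r_H a b)
  r_Z a := Subtype.ext (S.r_Z a)
  r_r a b := Subtype.ext (S.r_r a b)
  C_Z b ε := Subtype.ext (S.C_Z b ε)
  o_Z b ε := Subtype.ext (S.o_Z b ε)
  s_Z b := Subtype.ext (S.s_Z b)
  A_Z ε := Subtype.ext (S.A_Z ε)
  C_H' h ε := Subtype.ext (S.C_H' h ε)
  o_H' h ε := Subtype.ext (S.o_H' h ε)
  s_H' h := Subtype.ext (S.s_H' h)
  o_H b ε := Subtype.ext (S.o_H b ε)
  s_H b := Subtype.ext (S.s_H b)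
  C_H h ε := Subtype.ext (S.C_H h ε)
  o_C b ε := Subtype.ext (S.o_C b ε)
  C_C h ε := Subtype.ext (S.C_C h ε)
  A_H_zero ε := Subtype.ext (S.A_H_zero ε)
  A_H_one ε := Subtype.ext (S.A_H_one ε)
  C_C' ε := Subtype.ext (S.C_C' ε)
  A_A ε := Subtype.ext (S.A_A ε)
  A_o_o ε := Subtype.ext (S.A_o_o ε)
  o_o ε δ := Subtype.ext (S.o_o ε δ)
  r_C b ε := Subtype.ext (S.r_C b ε)
  r_C' h ε := Subtype.ext (S.r_C' h ε)
  r_s b := Subtype.ext (S.r_s b)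
  r_s' h := Subtype.ext (S.r_s' h)
  s_s b := Subtype.ext (S.s_s b)

/-- The image of a ladder system under a homomorphism. -/
def map {B' : Type*} [Ring B'] [Algebra ℂ B'] (S : LadderSystem B) (f : B →ₐ[ℂ] B') : LadderSystem B' where
  H b := f (S.H b)
  Z := f S.Z
  C b ε := f (S.C b ε)
  o b ε := f (S.o b ε)
  A ε := f (S.A ε)
  s b := f (S.s b)
  r b := f (S.r b)
  zeta := S.zeta
  H_H a b := by simpa only [map_mul] using congrArg f (S.H_H a b)
  H_Z b := by simpa only [map_mul] using congrArg f (S.H_Z b)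
  r_H a b := by simpa only [map_mul] using congrArg f (S.r_H a b)
  r_Z a := by simpa only [map_mul] using congrArg f (S.r_Z a)
  r_r a b := by simpa only [map_mul] using congrArg f (S.r_r a b)
  C_Z b ε := by simpa only [map_mul, map_neg] using congrArg f (S.C_Z b ε)
  o_Z b ε := by simpa only [map_mul, map_neg] using congrArg f (S.o_Z b ε)
  s_Z b := by simpa only [map_mul, map_neg] using congrArg f (S.s_Z b)
  A_Z ε := by simpa only [map_mul] using congrArg f (S.A_Z ε)
  C_H' h ε := by simpa only [map_mul] using congrArg f (S.C_H' h ε)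
  o_H' h ε := by simpa only [map_mul] using congrArg f (S.o_H' h ε)
  s_H' h := by simpa only [map_mul] using congrArg f (S.s_H' h)
  o_H b ε := by simpa only [map_mul, map_neg] using congrArg f (S.o_H b ε)
  s_H b := by simpa only [map_mul, map_neg] using congrArg f (S.s_H b)
  C_H h ε := by simpa only [map_mul, map_add, map_sub, map_smul] using congrArg f (S.C_H h ε)
  o_C b ε := by simpa only [map_mul, map_neg] using congrArg f (S.o_C b ε)
  C_C h ε := by simpa only [map_mul, map_add, map_sub, map_smul, map_one] using congrArg f (S.C_C h ε)
  A_H_zero ε := by simpa only [map_mul, map_add, map_sub, map_smul] using congrArg f (S.A_H_zero ε)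
  A_H_one ε := by simpa only [map_mul, map_add, map_sub, map_smul] using congrArg f (S.A_H_one ε)
  C_C' ε := by simpa only [map_mul, map_add, map_sub, map_smul] using congrArg f (S.C_C' ε)
  A_A ε := by simpa only [map_mul, map_add, map_sub, map_smul, map_one] using congrArg f (S.A_A ε)
  A_o_o ε := by simpa only [map_mul] using congrArg f (S.A_o_o ε)
  o_o ε δ := by simpa only [map_mul, map_neg] using congrArg f (S.o_o ε δ)
  r_C b ε := by simpa only [map_mul, map_smul] using congrArg f (S.r_C b ε)
  r_C' h ε := by simpa only [map_mul] using congrArg f (S.r_C' h ε)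
  r_s b := by simpa only [map_mul] using congrArg f (S.r_s b)
  r_s' h := by simpa only [map_mul] using congrArg f (S.r_s' h)
  s_s b := by simpa only [map_mul, map_one] using congrArg f (S.s_s b)

/-- The anticommutator in a subalgebra. -/
def anticomm (T : Subalgebra ℂ B) (x y : T) : T := x * y + y * x

theorem anticomm_smul (T : Subalgebra ℂ B) {M : Type*} [AddCommGroup M] [Module T M] (x y : T) (u : M) :
    anticomm T x y • u = x • y • u + y • x • u := by
  rw [anticomm, add_smul, mul_smul, mul_smul]

section Module

variable (S : LadderSystem B) (T : Subalgebra ℂ B) (hH : ∀ b, S.H b ∈ T) (hZ : S.Z ∈ T) (hC : ∀ b ε, S.C b ε ∈ T)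
    (ho : ∀ b ε, S.o b ε ∈ T) (hA : ∀ ε, S.A ε ∈ T) (hs : ∀ b, S.s b ∈ T) (hr : ∀ b, S.r b ∈ T)
  (M : Type*) [AddCommGroup M] [Module ℂ M] [Module T M] [IsScalarTower ℂ T M]

/-- The action of a ladder system on a module over a subalgebra that contains it. -/
def onModule : LadderSystem (Module.End ℂ M) := (S.restrict T hH hZ hC ho hA hs hr).map (Algebra.lsmul ℂ ℂ M)

variable {M}

theorem onModule_L (b : Fin 2) (ε : ℤˣ) (u : M) : (S.onModule T hH hZ hC ho hA hs hr M).L b ε u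
    = anticomm T ⟨S.H b, hH b⟩ ⟨S.C b ε, hC b ε⟩ • u := by
  rw [anticomm_smul]
  rfl

theorem onModule_LL (ε : ℤˣ) (u : M) : (S.onModule T hH hZ hC ho hA hs hr M).LL ε u
    = anticomm T ⟨S.H 0, hH 0⟩ (anticomm T ⟨S.H 1, hH 1⟩ ⟨S.A ε, hA ε⟩) • u := by
  simp only [anticomm_smul]
  rfl

theorem onModule_r_pow {b : Fin 2} {n : ℕ} (h : S.r b ^ n = -1) :
    (S.onModule T hH hZ hC ho hA hs hr M).r b ^ n = -1 := by
  have h1 : (S.restrict T hH hZ hC ho hA hs hr).r b ^ n = -1 := Subtype.ext h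
  change (Algebra.lsmul ℂ ℂ M) ((S.restrict T hH hZ hC ho hA hs hr).r b) ^ n = -1
  rw [← map_pow, h1, map_neg, map_one]

theorem onModule_o {ι : Type*} {t : Finset ι} {c : ι → ℂ} {n : ι → ℕ} {b : Fin 2} {ε : ℤˣ}
    (h : S.o b ε = ∑ p ∈ t, c p • (S.s b * S.r b ^ n p)) (u : M) :
    (S.onModule T hH hZ hC ho hA hs hr M).o b ε u
      = ∑ p ∈ t, c p • (S.onModule T hH hZ hC ho hA hs hr M).s b
        (((S.onModule T hH hZ hC ho hA hs hr M).r b ^ n p) u) := by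
  have h1 : (S.restrict T hH hZ hC ho hA hs hr).o b ε
      = ∑ p ∈ t, c p • ((S.restrict T hH hZ hC ho hA hs hr).s b * (S.restrict T hH hZ hC ho hA hs hr).r b ^ n p) := by
    refine Subtype.ext ?_
    rw [AddSubmonoidClass.coe_finsetSum]
    exact h
  change (Algebra.lsmul ℂ ℂ M) ((S.restrict T hH hZ hC ho hA hs hr).o b ε) u = _
  rw [h1]
  simp only [map_sum, map_smul, map_mul, map_pow, LinearMap.sum_apply, LinearMap.smul_apply, Module.End.mul_apply]
  rfl

theorem onModule_H (b : Fin 2) (u : M) :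
    (S.onModule T hH hZ hC ho hA hs hr M).H b u = (⟨S.H b, hH b⟩ : T) • u := rfl

theorem onModule_Z (u : M) : (S.onModule T hH hZ hC ho hA hs hr M).Z u = (⟨S.Z, hZ⟩ : T) • u := rfl

theorem onModule_r (b : Fin 2) (u : M) :
    (S.onModule T hH hZ hC ho hA hs hr M).r b u = (⟨S.r b, hr b⟩ : T) • u := rfl

end Module

end LadderSystem

/-! ### Common eigenvectors and the ladder system of a representation. -/

/-- Pairwise commuting endomorphisms of a finite-dimensional space have a common eigenvector in every nonzero
invariant subspace. -/
theorem exists_common_eigenvector {M : Type*} [AddCommGroup M] [Module ℂ M] [FiniteDimensional ℂ M]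
    (l : List (Module.End ℂ M)) (hl : ∀ f ∈ l, ∀ g ∈ l, f * g = g * f) (K : Submodule ℂ M) (hK : K ≠ ⊥)
    (hfK : ∀ f ∈ l, ∀ u ∈ K, f u ∈ K) : ∃ u ∈ K, u ≠ 0 ∧ ∀ f ∈ l, ∃ c : ℂ, f u = c • u := by
  induction l generalizing K with
  | nil =>
    obtain ⟨u, hu, hu0⟩ := K.ne_bot_iff.1 hK
    exact ⟨u, hu, hu0, by simp⟩
  | cons f l ih =>
    have : Nontrivial K := Submodule.nontrivial_iff_ne_bot.2 hK
    obtain ⟨c, hc⟩ := Module.End.exists_eigenvalue (f.restrict (hfK f List.mem_cons_self))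
    obtain ⟨w, hw⟩ := hc.exists_hasEigenvector
    have hw1 : f w = c • (w : M) := congrArg Subtype.val hw.apply_eq_smul
    have hw0 : (w : M) ≠ 0 := fun h => hw.2 (Subtype.ext h)
    obtain ⟨u, hu, hu0, h⟩ := ih (fun g hg g' hg' => hl g (List.mem_cons_of_mem _ hg) g' (List.mem_cons_of_mem _ hg'))
      (K ⊓ f.eigenspace c) (Submodule.ne_bot_iff _ |>.2 ⟨w, ⟨w.2, Module.End.mem_eigenspace_iff.2 hw1⟩, hw0⟩)
      (fun g hg u hu => ⟨hfK g (List.mem_cons_of_mem _ hg) u hu.1, Module.End.mem_eigenspace_iff.2 (by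
        rw [← Module.End.mul_apply, hl f List.mem_cons_self g (List.mem_cons_of_mem _ hg), Module.End.mul_apply,
          Module.End.mem_eigenspace_iff.1 hu.2, map_smul])⟩)
    refine ⟨u, hu.1, hu0, fun g hg => ?_⟩
    rcases List.mem_cons.1 hg with rfl | hg
    · exact ⟨c, Module.End.mem_eigenspace_iff.1 hu.2⟩
    · exact h g hg

section Representations

variable (m : Fin 2 → ℕ) (κ : V → ℂ)

theorem sRefl_mem (a : Fin 2) (p : ℕ) : sRefl m κ a p ∈ TAMA m κ := sTilde_mem m κ a p

theorem mk_symP (c : Cl) : (⟨symP m κ c, symP_mem m κ c⟩ : TAMA m κ) = opP m κ c :=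
  Subtype.ext (coe_opP m κ c).symm

theorem mk_H (b : Fin 2) : (⟨symP m κ (-area b 1), symP_mem m κ _⟩ : TAMA m κ) = H m κ b := by
  have h := H_eq m κ b 1
  rw [Units.val_one, Int.cast_one, one_smul] at h
  rw [h, mk_symP]

theorem mk_Z : (⟨symP m κ (-(area 0 1 * area 1 1)), symP_mem m κ _⟩ : TAMA m κ) = Z m κ := by
  rw [Z_eq m κ 1, mk_symP]

/-- The sign in the definition of r̃ is absorbed by s̃_0 = -s̃_m. -/
theorem mk_r {b : Fin 2} (hm : 1 ≤ m b) (h : sRefl m κ b 0 * sRefl m κ b 1 ∈ TAMA m κ) :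
    (⟨sRefl m κ b 0 * sRefl m κ b 1, h⟩ : TAMA m κ) = rTilde m κ b := by
  refine Subtype.ext ?_
  change sRefl m κ b 0 * sRefl m κ b 1 = -(sRefl m κ b (m b) * sRefl m κ b 1)
  have h := sRefl_add_self m κ hm 0
  rw [zero_add] at h
  rw [h, neg_mul, neg_neg]

/-- An existential form retains only the listed properties and keeps the concrete tensor product
algebra from being unfolded later. -/
theorem exists_ladderSystem (hm : ∀ a, 1 ≤ m a) : ∃ S : LadderSystem (HC m κ), S.zeta = zetaRoot m ∧
    (∀ b, S.H b = symP m κ (-area b 1)) ∧ S.Z = symP m κ (-(area 0 1 * area 1 1)) ∧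
    (∀ b ε, S.C b ε = symP m κ (area (1 - b) ε * gam (zvec b ε))) ∧ (∀ b ε, S.o b ε = symP m κ (gam (zvec b ε))) ∧
    (∀ ε, S.A ε = symP m κ (gam (zvec 0 ε) * gam (zvec 1 ε))) ∧ (∀ b, S.s b = sRefl m κ b 0) ∧
    (∀ b, S.r b = sRefl m κ b 0 * sRefl m κ b 1) ∧ (∀ b, S.r b ^ m b = -1) ∧
    ∀ b ε, S.o b ε = ∑ p ∈ Finset.Icc 1 (m b),
      (-(Complex.I * ((ε : ℤ) : ℂ)) * (κ (root m b p) * zetaRoot m b ^ ((ε : ℤ) * p))) • (S.s b * S.r b ^ p) :=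
  ⟨ladderHC m κ, rfl, fun _ => rfl, rfl, fun _ _ => rfl, fun _ _ => rfl, fun _ => rfl, fun _ => rfl, fun _ => rfl,
    fun b => rotation_pow m κ (hm b), symP_gam_zvec m κ⟩

theorem acomm_eq (x y : TAMA m κ) : acomm m κ x y = LadderSystem.anticomm (TAMA m κ) x y := rfl

/-- The ladder system in the endomorphisms of a representation of `𝔒_κ`. -/
theorem exists_ladderSystem_module {m : Fin 2 → ℕ} {κ : V → ℂ} (hm : ∀ a, 1 ≤ m a) (hκ : IsInvariant m κ)
    (hsmall : IsSmall m κ) (M : Type*) [AddCommGroup M] [Module ℂ M] [Module (TAMA m κ) M]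
    [IsScalarTower ℂ (TAMA m κ) M] : ∃ S : LadderSystem (Module.End ℂ M), S.zeta = zetaRoot m ∧
    (∀ b u, S.H b u = H m κ b • u) ∧ (∀ u, S.Z u = Z m κ • u) ∧ (∀ b u, S.r b u = rTilde m κ b • u) ∧
    (∀ b, S.r b ^ m b = -1) ∧
    (∀ b ε u, ladderOdd m κ b ε • u = (-2 * ((ε : ℤ) : ℂ)) • S.L b ε u) ∧
    (∀ ε u, ladderEven m κ ε ε • u = S.LL ε u) ∧ S.HasParameters (Q m κ) := by
  obtain ⟨S, hzeta, hH, hZ, hC, ho, hA, hs, hr, hpow, hsum⟩ := exists_ladderSystem m κ hm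
  have mH : ∀ b, S.H b ∈ TAMA m κ := fun b => by rw [hH]; exact symP_mem m κ _
  have mZ : S.Z ∈ TAMA m κ := by rw [hZ]; exact symP_mem m κ _
  have mC : ∀ b ε, S.C b ε ∈ TAMA m κ := fun b ε => by rw [hC]; exact symP_mem m κ _
  have mo : ∀ b ε, S.o b ε ∈ TAMA m κ := fun b ε => by rw [ho]; exact symP_mem m κ _
  have mA : ∀ ε, S.A ε ∈ TAMA m κ := fun ε => by rw [hA]; exact symP_mem m κ _
  have ms : ∀ b, S.s b ∈ TAMA m κ := fun b => by rw [hs]; exact sRefl_mem m κ _ _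
  have mr : ∀ b, S.r b ∈ TAMA m κ := fun b => by
    rw [hr]
    exact (TAMA m κ).mul_mem (sRefl_mem m κ _ _) (sRefl_mem m κ _ _)
  have eH : ∀ b, (⟨S.H b, mH b⟩ : TAMA m κ) = H m κ b := fun b => by
    rw [← mk_H]
    exact Subtype.ext (hH b)
  have eZ : (⟨S.Z, mZ⟩ : TAMA m κ) = Z m κ := by
    rw [← mk_Z]
    exact Subtype.ext hZ
  have er : ∀ b, (⟨S.r b, mr b⟩ : TAMA m κ) = rTilde m κ b := fun b => by
    rw [← mk_r m κ (hm b) (hr b ▸ mr b)]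
    exact Subtype.ext (hr b)
  have eC : ∀ b ε, (⟨S.C b ε, mC b ε⟩ : TAMA m κ) = cOp m κ b ε := fun b ε => by
    rw [cOp, ← mk_symP]
    exact Subtype.ext (hC b ε)
  have eA : ∀ ε, (⟨S.A ε, mA ε⟩ : TAMA m κ) = aOp m κ ε := fun ε => by
    rw [aOp, ← mk_symP]
    exact Subtype.ext (hA ε)
  have kH := S.onModule_H (TAMA m κ) mH mZ mC mo mA ms mr (M := M)
  have kZ := S.onModule_Z (TAMA m κ) mH mZ mC mo mA ms mr (M := M)
  have kr := S.onModule_r (TAMA m κ) mH mZ mC mo mA ms mr (M := M)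
  have kL := S.onModule_L (TAMA m κ) mH mZ mC mo mA ms mr (M := M)
  have kLL := S.onModule_LL (TAMA m κ) mH mZ mC mo mA ms mr (M := M)
  have kpow := fun b => S.onModule_r_pow (TAMA m κ) mH mZ mC mo mA ms mr (M := M) (hpow b)
  have ko := fun b ε => S.onModule_o (TAMA m κ) mH mZ mC mo mA ms mr (M := M) (n := fun p => p) (hsum b ε)
  have kzeta : (S.onModule (TAMA m κ) mH mZ mC mo mA ms mr M).zeta = zetaRoot m := hzeta
  simp only [eH, eZ, er, eC, eA] at kH kZ kr kL kLL
  generalize S.onModule (TAMA m κ) mH mZ mC mo mA ms mr M = S' at *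
  refine ⟨S', kzeta, kH, kZ, kr, kpow, fun b ε u => ?_, fun ε u => ?_, ?_⟩
  · rw [ladderOdd_eq, smul_assoc, acomm_eq, kL]
  · rw [ladderEven, acomm_eq, acomm_eq, O_zvec_zvec, kLL]
  · refine ⟨fun b => ?_, fun b ε l hl u hu => ?_, Q_neg m κ, hsmall⟩
    · rw [kzeta]
      exact zetaRoot_ne_zero m b
    rw [kzeta] at hu
    have hu' : ∀ p : ℕ, (S'.r b ^ p) u = zetaRoot m b ^ (l * p) • u := fun p => by
      induction p with
      | zero => simp
      | succ p ih =>
        rw [pow_succ', Module.End.mul_apply, ih, map_smul, hu, smul_smul, ← zpow_add₀ (zetaRoot_ne_zero m b)]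
        congr 2
        push_cast
        ring
    -- The exponent l comes from the powers of the rotation and ε from the pairing with the roots; l
    -- is odd, so l + ε is even, as the Fourier formula requires.
    rw [ko, ← sum_zeta_eq_Q hκ (hm b) (hl.add_odd (Int.odd_iff.2 (by
      rcases Int.units_eq_one_or ε with rfl | rfl <;> rfl))), Finset.mul_sum, ← Finset.sum_neg_distrib, Finset.sum_smul]
    refine Finset.sum_congr rfl fun p _ => ?_
    rw [hu', map_smul, smul_smul, add_mul, zpow_add₀ (zetaRoot_ne_zero m b)]
    congr 1
    ring

end Representations

/-! ### Weights and highest weights. -/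

theorem exists_odd_pow_of_pow_eq_neg_one {m : Fin 2 → ℕ} {a : Fin 2} (hm : 1 ≤ m a) {c : ℂ} (hc : c ^ m a = -1) :
    ∃ l : ℕ, Odd l ∧ l < 2 * m a ∧ c = zetaRoot m a ^ l := by
  have hz := isPrimitiveRoot_zetaRoot hm
  have : NeZero (2 * m a) := ⟨by omega⟩
  obtain ⟨l, hl, rfl⟩ := hz.eq_pow_of_pow_eq_one (ξ := c) (by rw [mul_comm, pow_mul, hc]; norm_num)
  refine ⟨l, ?_, hl, rfl⟩
  rw [pow_right_comm, zetaRoot_pow_self hm] at hc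
  by_contra ho
  rw [Nat.not_odd_iff_even] at ho
  rw [ho.neg_one_pow] at hc
  norm_num at hc

theorem mem_eigenspace_of_comm {M : Type*} [AddCommGroup M] [Module ℂ M] {f g : Module.End ℂ M} (h : f * g = g * f)
    {c : ℂ} {u : M} (hu : u ∈ f.eigenspace c) : g u ∈ f.eigenspace c := by
  rw [Module.End.mem_eigenspace_iff, ← Module.End.mul_apply, h, Module.End.mul_apply, Module.End.mem_eigenspace_iff.1 hu,
    map_smul]

section Representations

variable {m : Fin 2 → ℕ} {κ : V → ℂ} {M : Type*} [AddCommGroup M] [Module ℂ M] [Module (TAMA m κ) M]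

/-- Every nonzero subspace that is invariant under `H_1, H_2, Z, r_1, r_2` contains a weight vector. -/
theorem exists_weight [FiniteDimensional ℂ M] (hm : ∀ a, 1 ≤ m a) {S : LadderSystem (Module.End ℂ M)}
    (hH : ∀ b u, S.H b u = H m κ b • u) (hZ : ∀ u, S.Z u = Z m κ • u) (hr : ∀ b u, S.r b u = rTilde m κ b • u)
    (hpow : ∀ b, S.r b ^ m b = -1) (K : Submodule ℂ M) (hK : K ≠ ⊥) (kH : ∀ b, ∀ u ∈ K, S.H b u ∈ K)
    (kZ : ∀ u ∈ K, S.Z u ∈ K) (kr : ∀ b, ∀ u ∈ K, S.r b u ∈ K) :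
    ∃ μ, (∀ a, Odd (μ.ell a) ∧ μ.ell a < 2 * m a) ∧ ∃ v ∈ weightSpace m κ M μ, v ≠ 0 ∧ v ∈ K := by
  obtain ⟨u, huK, hu0, hu⟩ := exists_common_eigenvector [S.H 0, S.H 1, S.Z, S.r 0, S.r 1] (by
    simp only [List.forall_mem_cons, List.not_mem_nil, false_imp_iff, implies_true, and_true, S.H_H 1 0, S.H_Z, S.r_H,
      S.r_Z, S.r_r 1 0]) K hK (by
    simp only [List.forall_mem_cons, List.not_mem_nil, false_imp_iff, implies_true, and_true]
    exact ⟨kH 0, kH 1, kZ, kr 0, kr 1⟩)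
  simp only [List.forall_mem_cons, List.not_mem_nil, false_imp_iff, implies_true, and_true] at hu
  obtain ⟨h0, h1, ⟨Lam, hLam⟩, r0, r1⟩ := hu
  have eH : ∀ b, ∃ c : ℂ, S.H b u = c • u := Fin.forall_fin_two.2 ⟨h0, h1⟩
  have er : ∀ b, ∃ c : ℂ, S.r b u = c • u := Fin.forall_fin_two.2 ⟨r0, r1⟩
  choose lam hlam using eH
  have el : ∀ b, ∃ l : ℕ, Odd l ∧ l < 2 * m b ∧ S.r b u = zetaRoot m b ^ l • u := fun b => by
    obtain ⟨c, hc⟩ := er b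
    have hk : ∀ k : ℕ, (S.r b ^ k) u = c ^ k • u := fun k => by
      induction k with
      | zero => simp
      | succ k ih => rw [pow_succ', Module.End.mul_apply, ih, map_smul, hc, smul_smul, pow_succ]
    have h := hk (m b)
    rw [hpow, LinearMap.neg_apply, Module.End.one_apply, ← neg_one_smul ℂ u] at h
    obtain ⟨l, hl, hl', e⟩ := exists_odd_pow_of_pow_eq_neg_one (hm b) (smul_left_injective ℂ hu0 h).symm
    exact ⟨l, hl, hl', by rw [hc, e]⟩
  choose ell hodd hlt hell using el
  refine ⟨⟨lam, Lam, ell⟩, fun a => ⟨hodd a, hlt a⟩, u, ⟨fun a => ?_, ?_, fun a => ?_⟩, hu0, huK⟩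
  · rw [← hH, hlam]
  · rw [← hZ, hLam]
  · rw [← hr, hell]
    rfl

theorem floor_le_of_valueAtZero_le {c d : ℂ} (h : valueAtZero c ≤ valueAtZero d) : ⌊c.re⌋ ≤ ⌊d.re⌋ := by
  have h1 : (⌊c.re⌋ : ℝ) ≤ ⌊d.re⌋ := by
    simp only [valueAtZero] at h
    linarith
  exact_mod_cast h1

theorem valueAtZero_congr {c d : ℂ} (h : ⌊c.re⌋ = ⌊d.re⌋) : valueAtZero c = valueAtZero d := by
  rw [valueAtZero, valueAtZero, h]

/-- Every vector of a highest weight space is a top vector. -/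
theorem IsHighestWeight.isTop [FiniteDimensional ℂ M] (hm : ∀ a, 1 ≤ m a) {S : LadderSystem (Module.End ℂ M)}
    (hzeta : S.zeta = zetaRoot m) (hH : ∀ b u, S.H b u = H m κ b • u) (hZ : ∀ u, S.Z u = Z m κ • u)
    (hr : ∀ b u, S.r b u = rTilde m κ b • u) (hpow : ∀ b, S.r b ^ m b = -1) {μ : Weight}
    (hμ : IsHighestWeight m κ M μ) {v : M} (hv : v ∈ weightSpace m κ M μ) (hv0 : v ≠ 0) :
    S.IsTop μ.lam μ.Lam (fun b => (μ.ell b : ℤ)) v where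
  H b := by rw [hH, hv.1]
  Z := by rw [hZ, hv.2.1]
  r b := by
    rw [hr, hv.2.2, hzeta, zpow_natCast]
    rfl
  odd b := by exact_mod_cast (hμ.1.1 b).1
  ne := hv0
  le_zero {u c} hu h0 := by
    -- The given eigenvector of `H 0` need not be a weight vector, but its eigenspace is invariant
    -- under the commuting family and hence contains one with the same eigenvalue.
    obtain ⟨ν, hν, w, hw, hw0, hwK⟩ := exists_weight hm hH hZ hr hpow ((S.H 0).eigenspace c)
      ((Submodule.ne_bot_iff _).2 ⟨u, Module.End.mem_eigenspace_iff.2 h0, hu⟩)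
      (fun b _ => mem_eigenspace_of_comm (S.H_H 0 b))
      (fun _ => mem_eigenspace_of_comm (S.H_Z 0))
      (fun b _ => mem_eigenspace_of_comm (S.r_H b 0).symm)
    have e : ν.lam 0 = c := smul_left_injective ℂ hw0 (by
      change ν.lam 0 • w = c • w
      rw [← hw.1, ← hH, Module.End.mem_eigenspace_iff.1 hwK])
    have h := hμ.2 ν ⟨hν, w, hw, hw0⟩
    rw [← e]
    exact floor_le_of_valueAtZero_le (h.elim le_of_lt fun h => h.1.le)
  le_one {u c d} hu h0 h1 hc := by
    obtain ⟨ν, hν, w, hw, hw0, hwK⟩ := exists_weight hm hH hZ hr hpow ((S.H 0).eigenspace c ⊓ (S.H 1).eigenspace d)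
      ((Submodule.ne_bot_iff _).2 ⟨u, ⟨Module.End.mem_eigenspace_iff.2 h0, Module.End.mem_eigenspace_iff.2 h1⟩, hu⟩)
      (fun b w hw => ⟨mem_eigenspace_of_comm (S.H_H 0 b) hw.1,
        mem_eigenspace_of_comm (S.H_H 1 b) hw.2⟩)
      (fun w hw => ⟨mem_eigenspace_of_comm (S.H_Z 0) hw.1,
        mem_eigenspace_of_comm (S.H_Z 1) hw.2⟩)
      (fun b w hw => ⟨mem_eigenspace_of_comm (S.r_H b 0).symm hw.1,
        mem_eigenspace_of_comm (S.r_H b 1).symm hw.2⟩)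
    have e0 : ν.lam 0 = c := smul_left_injective ℂ hw0 (by
      change ν.lam 0 • w = c • w
      rw [← hw.1, ← hH, Module.End.mem_eigenspace_iff.1 hwK.1])
    have e1 : ν.lam 1 = d := smul_left_injective ℂ hw0 (by
      change ν.lam 1 • w = d • w
      rw [← hw.1, ← hH, Module.End.mem_eigenspace_iff.1 hwK.2])
    have h := hμ.2 ν ⟨hν, w, hw, hw0⟩
    rw [← e1]
    rw [← e0] at hc
    refine floor_le_of_valueAtZero_le ((h.resolve_left ?_).2.elim le_of_lt fun h => h.1.le)
    rw [valueAtZero_congr hc]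
    exact lt_irrefl _

/-- The linear order on the data by which weights are compared. -/
def Weight.key (μ : Weight) : ℝ ×ₗ ℝ ×ₗ ℝ ×ₗ ℕᵒᵈ ×ₗ ℕᵒᵈ :=
  toLex (valueAtZero (μ.lam 0), toLex (valueAtZero (μ.lam 1), toLex (μ.Lam.re,
    toLex (OrderDual.toDual (μ.ell 0), OrderDual.toDual (μ.ell 1)))))

/-- `IsHigher` is the unfolded lexicographic order on the keys; the order duals encode that smaller
exponents are higher. -/
theorem isHigher_of_key_le {μ ν : Weight} (h : ν.key ≤ μ.key) : IsHigher μ ν := by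
  simp only [Weight.key, Prod.Lex.toLex_le_toLex] at h
  simp only [IsHigher]
  simpa only [OrderDual.toDual_lt_toDual, OrderDual.toDual_le_toDual, OrderDual.toDual_inj, eq_comm] using h

/-- A weight is determined by eigenvalues of three endomorphisms of a finite-dimensional space and
two bounded exponents. -/
theorem finite_setOf_isWeight [FiniteDimensional ℂ M] {S : LadderSystem (Module.End ℂ M)}
    (hH : ∀ b u, S.H b u = H m κ b • u) (hZ : ∀ u, S.Z u = Z m κ • u) : {μ | IsWeight m κ M μ}.Finite := by
  let F : Weight → (Fin 2 → ℂ) × ℂ × (Fin 2 → ℕ) := fun μ => (μ.lam, μ.Lam, μ.ell)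
  have hF : Function.Injective F := fun μ ν h => by
    cases μ
    cases ν
    simp only [F, Prod.mk.injEq] at h
    simp [h]
  refine Set.Finite.of_finite_image (f := F) ?_ hF.injOn
  refine Set.Finite.subset ((Set.Finite.pi fun b => Module.End.finite_hasEigenvalue (S.H b)).prod
    ((Module.End.finite_hasEigenvalue S.Z).prod (Set.Finite.pi fun b => Set.finite_lt_nat (2 * m b)))) ?_
  rintro _ ⟨μ, ⟨hμ, v, hv, hv0⟩, rfl⟩
  refine ⟨fun b _ => ?_, ?_, fun b _ => (hμ b).2⟩
  · exact Module.End.hasEigenvalue_of_hasEigenvector (x := v) (Module.End.hasEigenvector_iff.2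
      ⟨Module.End.mem_eigenspace_iff.2 (by rw [hH, hv.1]), hv0⟩)
  · exact Module.End.hasEigenvalue_of_hasEigenvector (x := v) (Module.End.hasEigenvector_iff.2
      ⟨Module.End.mem_eigenspace_iff.2 (by rw [hZ, hv.2.1]), hv0⟩)

theorem exists_isHighestWeight [FiniteDimensional ℂ M] [Nontrivial M] (hm : ∀ a, 1 ≤ m a)
    {S : LadderSystem (Module.End ℂ M)} (hH : ∀ b u, S.H b u = H m κ b • u) (hZ : ∀ u, S.Z u = Z m κ • u)
    (hr : ∀ b u, S.r b u = rTilde m κ b • u) (hpow : ∀ b, S.r b ^ m b = -1) : ∃ μ, IsHighestWeight m κ M μ := by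
  obtain ⟨ν, hν, v, hv, hv0, -⟩ := exists_weight hm hH hZ hr hpow ⊤ top_ne_bot (fun _ _ _ => trivial)
    (fun _ _ => trivial) (fun _ _ _ => trivial)
  obtain ⟨μ, hμ, hmax⟩ := Set.exists_max_image _ Weight.key (finite_setOf_isWeight hH hZ) ⟨ν, hν, v, hv, hv0⟩
  exact ⟨μ, hμ, fun ν hν => isHigher_of_key_le (hmax ν hν)⟩

end Representations

end DunklTAMA

end

theorem mainTheorem6 (m : Fin 2 → ℕ) (hm : ∀ a, 1 ≤ m a)
    (κ : DunklTAMA.V → ℂ) (hκ : DunklTAMA.IsInvariant m κ) (hsmall : DunklTAMA.IsSmall m κ)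
    (M : Type*) [AddCommGroup M] [Module ℂ M] [Module (DunklTAMA.TAMA m κ) M]
    [IsScalarTower ℂ (DunklTAMA.TAMA m κ) M] [FiniteDimensional ℂ M]
    [IsSimpleModule (DunklTAMA.TAMA m κ) M] :
    DunklTAMA.IsTriangleRepresentation m κ M ∧
      ∀ μ, DunklTAMA.IsHighestWeight m κ M μ →
        DunklTAMA.IsTriangleWeight m κ μ ∧ DunklTAMA.LaddersVanish m κ M μ := by
  have : Nontrivial M := IsSimpleModule.nontrivial (DunklTAMA.TAMA m κ) M
  obtain ⟨S, hzeta, hH, hZ, hr, hpow, hodd, heven, hQ⟩ := DunklTAMA.exists_ladderSystem_module hm hκ hsmall M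
  have key : ∀ μ, DunklTAMA.IsHighestWeight m κ M μ →
      DunklTAMA.IsTriangleWeight m κ μ ∧ DunklTAMA.LaddersVanish m κ M μ := fun μ hμ => by
    -- Every nonzero vector of the weight space is a top vector, so the vanishing holds on the whole
    -- weight space and not just for one chosen vector.
    have htop := fun v hv hv0 => hμ.isTop hm hzeta hH hZ hr hpow (v := v) hv hv0
    constructor
    · obtain ⟨-, v, hv, hv0⟩ := hμ.1
      obtain ⟨N, hN⟩ := (htop v hv hv0).lam_zero hQ
      exact ⟨N, hN, (htop v hv hv0).lam_one hQ, (htop v hv hv0).Lam_eq hQ⟩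
    · intro v hv
      rcases eq_or_ne v 0 with rfl | hv0
      · exact ⟨smul_zero _, smul_zero _, smul_zero _⟩
      · have h := htop v hv hv0
        rw [hodd, hodd, heven, h.L_one, h.L_one_neg hQ, h.LL_neg hQ, smul_zero, smul_zero]
        exact ⟨rfl, rfl, rfl⟩
  obtain ⟨μ, hμ⟩ := DunklTAMA.exists_isHighestWeight hm hH hZ hr hpow
  exact ⟨⟨μ, hμ, key μ hμ⟩, key⟩
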